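/- A Calderón–Zygmund operator (CZO) on $\mathbb{R}^d$ is a bounded linear operator $T$ on $L^2(\mathbb{R}^d;\mathbb{C})$ for which there are a kernel $K$, a constant $C$ and $\delta\in(0,1]$ such that $|K(x,y)|\le C|x-y|^{-d}$ for $x\ne y$, such that $|K(x,y)-K(x',y)|+|K(y,x)-K(y,x')|\le C|x-x'|^{\delta}|x-y|^{-d-\delta}$ whenever $x\neq y$ and $2|x-x'|\le|x-y|$, and such that $Tf(x)=\int K(x,y)f(y)\,dy$ for every compactly supported $f\in L^2$ and a.e. $x\notin\operatorname{supp}f$. For $f\in L^1$, $Tf$ is the limit in measure of $Tu_n$, for any $u_n\in L^1\cap L^2$ with $u_n\to f$ in $L^1$ (the limit exists and does not depend on $(u_n)$). $T\otimes \mathbf{I}_m$ denotes $T$ acting componentwise on $\mathbb{C}^m$-valued functions, $M_B$ is multiplication by the matrix function $B$, and $[M_B,T\otimes\mathbf{I}_m]f=B\,(T\otimes\mathbf{I}_m)f-(T\otimes\mathbf{I}_m)(Bf)$. A dyadic grid is a collection of half-open cubes with sides parallel to the axes and side lengths $2^k$, $k\in\mathbb{Z}$, any two of which are nested or disjoint,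 and such that for each $k$ the cubes of side length $2^k$ cover $\mathbb{R}^d$. A subcollection $\mathcal{S}$ of a dyadic grid is sparse if there are pairwise disjoint measurable sets $E_Q\subset Q$ ($Q\in\mathcal{S}$) with $|Q|\le 2|E_Q|$. **Theorem.** Let $d\ge 1$, $m\in\mathbb{N}$, and let $T$ be a CZO on $\mathbb{R}^d$. There is a constant $c=c_{d,m,T}>0$, depending only on $d$, $m$ and $T$, such that the following holds. For every $f\in L^1(\mathbb{R}^d;\mathbb{C}^m)$ with compact support and every $m\times m$ complex matrix function $B$ on $\mathbb{R}^d$ with $Bf\in L^1$, there exist $3^d$ sparse families $\mathcal{S}_1,\dots,\mathcal{S}_{3^d}$, each contained in a dyadic grid, and for each $j$ and each $Q\in\mathcal{S}_j$ a measurable function $k_Q=k_{Q,j}:Q\times Q\to\mathbb{C}$ with $\|k_Q\|_{L^\infty(Q\times Q)}\le 1$, such that for a.e. $x\in\mathbb{R}^d$ $$[M_B,T\otimes\mathbf{I}_m]f(x)=c\sum_{j=1}^{3^d}\sum_{Q\in\mathcal{S}_j}\mathbf{1}_Q(x)\frac1{|Q|}\int_Q k_Q(x,y)\,(B(x)-B(y))f(y)\,dy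 ,$$ where the sums over $Q$ converge absolutely. If $T$ maps real-valued functions to real-valued functions, then the $k_Q$ can be chosen real-valued. -/

import Mathlib

open MeasureTheory Filter Topology

/-- The space `ℝ^d` with its Euclidean norm and Lebesgue measure. -/
abbrev Rd (d : ℕ) : Type := EuclideanSpace ℝ (Fin d)

/-- The half-open cube with lower corner `a` and side length `l`. -/
def halfOpenCube {d : ℕ} (a : Rd d) (l : ℝ) : Set (Rd d) :=
  {x | ∀ i, a i ≤ x i ∧ x i < a i + l}

/-- A dyadic grid: a collection of half-open cubes with side lengths `2 ^ k`, `k ∈ ℤ`, any two of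
which are nested or disjoint, such that for each `k` the cubes of side length `2 ^ k` cover `ℝ^d`
(hence, by nestedness, partition it). -/
structure IsDyadicGrid {d : ℕ} (D : Set (Set (Rd d))) : Prop where
  isCube : ∀ Q ∈ D, ∃ (a : Rd d) (k : ℤ), Q = halfOpenCube a ((2 : ℝ) ^ k)
  nested : ∀ Q ∈ D, ∀ R ∈ D, Q ⊆ R ∨ R ⊆ Q ∨ Disjoint Q R
  covers : ∀ (k : ℤ) (x : Rd d), ∃ a : Rd d,
    halfOpenCube a ((2 : ℝ) ^ k) ∈ D ∧ x ∈ halfOpenCube a ((2 : ℝ) ^ k)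

/-- `S` is a sparse family of cubes of `D`: there are pairwise disjoint measurable sets
`E Q ⊆ Q` (`Q ∈ S`) with `|Q| ≤ 2 |E Q|`. -/
def IsSparse {d : ℕ} (D S : Set (Set (Rd d))) : Prop :=
  S ⊆ D ∧ ∃ E : Set (Rd d) → Set (Rd d),
    (∀ Q ∈ S, MeasurableSet (E Q) ∧ E Q ⊆ Q ∧ volume Q ≤ 2 * volume (E Q)) ∧
    S.PairwiseDisjoint E

/-- A standard Calderón–Zygmund kernel on `ℝ^d`: the size condition and Hölder regularity in each
of the two variables, off the diagonal. -/
def IsCZKernel {d : ℕ} (K : Rd d → Rd d → ℂ) : Prop :=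
  ∃ C δ : ℝ, 0 < δ ∧ δ ≤ 1 ∧
    (∀ x y, x ≠ y → ‖K x y‖ ≤ C / ‖x - y‖ ^ d) ∧
    (∀ x x' y, x ≠ y → 2 * ‖x - x'‖ ≤ ‖x - y‖ →
      ‖K x y - K x' y‖ + ‖K y x - K y x'‖ ≤ C * ‖x - x'‖ ^ δ / ‖x - y‖ ^ ((d : ℝ) + δ))

/-- A Calderón–Zygmund operator: a bounded linear operator on `L²(ℝ^d; ℂ)` that is given by
integration against a standard kernel away from the support of the function. -/
def IsCZO {d : ℕ}
    (T : Lp ℂ 2 (volume : Measure (Rd d)) →L[ℂ] Lp ℂ 2 (volume : Measure (Rd d))) : Prop :=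
  ∃ K : Rd d → Rd d → ℂ, IsCZKernel K ∧
    ∀ (f : Rd d → ℂ) (hf : MemLp f 2 volume), HasCompactSupport f →
      ∀ᵐ x, x ∉ tsupport f → T (hf.toLp f) x = ∫ y, K x y * f y

/-- `T` maps real-valued functions to real-valued functions. -/
def IsRealOperator {d : ℕ}
    (T : Lp ℂ 2 (volume : Measure (Rd d)) →L[ℂ] Lp ℂ 2 (volume : Measure (Rd d))) : Prop :=
  ∀ f : Lp ℂ 2 (volume : Measure (Rd d)), (∀ᵐ x, (f x).im = 0) → ∀ᵐ x, (T f x).im = 0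

/-- `g = T f` for the continuous extension of `T` to `L¹`: whenever functions `u n ∈ L¹ ∩ L²`
converge to `f` in `L¹`, the functions `T (u n)` converge to `g` in measure. As `L¹ ∩ L²` is
dense in `L¹`, this determines `g` up to a null set, and for `f ∈ L¹ ∩ L²` it is the original
`T f`. -/
def IsL1Value {d : ℕ}
    (T : Lp ℂ 2 (volume : Measure (Rd d)) →L[ℂ] Lp ℂ 2 (volume : Measure (Rd d)))
    (f g : Rd d → ℂ) : Prop :=
  AEStronglyMeasurable g volume ∧
  ∀ (u : ℕ → Rd d → ℂ) (hu : ∀ n, MemLp (u n) 2 volume), (∀ n, Integrable (u n) volume) →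
    Tendsto (fun n => eLpNorm (u n - f) 1 volume) atTop (𝓝 0) →
    TendstoInMeasure volume (fun n x => T ((hu n).toLp (u n)) x) atTop g

/-- `F = (T ⊗ I_m) f`, where `T ⊗ I_m` is `T` acting on each of the `m` components. -/
def IsTensorValue {d m : ℕ}
    (T : Lp ℂ 2 (volume : Measure (Rd d)) →L[ℂ] Lp ℂ 2 (volume : Measure (Rd d)))
    (f F : Rd d → Fin m → ℂ) : Prop :=
  ∀ i, IsL1Value T (fun x => f x i) (fun x => F x i)

/-- `h = [M_B, T ⊗ I_m] f = B (T ⊗ I_m) f - (T ⊗ I_m) (B f)`. -/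
def IsCommutatorValue {d m : ℕ}
    (T : Lp ℂ 2 (volume : Measure (Rd d)) →L[ℂ] Lp ℂ 2 (volume : Measure (Rd d)))
    (B : Rd d → Matrix (Fin m) (Fin m) ℂ) (f h : Rd d → Fin m → ℂ) : Prop :=
  ∃ F G : Rd d → Fin m → ℂ,
    IsTensorValue T f F ∧ IsTensorValue T (fun x => (B x).mulVec (f x)) G ∧
    ∀ᵐ x, h x = (B x).mulVec (F x) - G x

/-- The function `x ↦ 𝟙_Q(x) ⨍_Q k(x, y) (B(x) - B(y)) f(y) dy`. -/
noncomputable def sparseTerm {d m : ℕ} (k : Rd d → Rd d → ℂ)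
    (B : Rd d → Matrix (Fin m) (Fin m) ℂ) (f : Rd d → Fin m → ℂ) (Q : Set (Rd d)) :
    Rd d → Fin m → ℂ :=
  Q.indicator fun x => ⨍ y in Q, k x y • (B x - B y).mulVec (f y)

/-! The commutator is a linear image of a single application of `T`. Let `F = (f, Bf)`, with values
in `ℂ^(2m)`. For fixed `x` the linear map `(u, v) ↦ B(x) u - v` sends `TF(x)`, taken componentwise,
to the commutator at `x`, and sends `F(y)` to `(B(x) - B(y)) f(y)`. Hence it suffices to write
`TF(x)` as a sum of sparse averages `|Q|⁻¹ ∫_Q k_Q(x, y) F(y) dy` with bounded scalar kernels. This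
is a convex body domination of `T`, in which `B` enters only through the integrability of `Bf`.

The stopping step (`IsLocallyControlled.exists_step`) starts from the body of averages `|Q|⁻¹ ∫ φF`
with `|φ| ≤ 1`, taken over a dilate `Q*` of a cube `Q`. By `exists_near_auerbach` it contains
vectors `v_i`, at most as many as the dimension, with functionals `c_i` that are bounded by `2` on
the body and satisfy `w = ∑ c_i(w) v_i` there. So `∫_{Q*} |c_i(F)| ≤ 2|Q|`, and scalar weak type
bounds apply to `c_i(F)`: `|c_i(T(F 1_{Q*}))| ≤ C` off a small subset of `Q`, and `|c_i(T(F 1_{Q*})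
- T(F 1_{P*}))| ≤ C` on the stopping cubes `P` that cover this subset. Since `v_i = |Q|⁻¹ ∫ φ_i F`,
expanding in the `v_i` gives one average with kernel `∑ a_i(x) φ_i(y)`; what remains is `T(F
1_{P*})` on each `P`, and the step is iterated. The estimate on `P`
(`IsWeakCZ.norm_sub_le_of_subcube`) needs no maximal truncation: the difference is `T` of a function
that vanishes near `P`, so it oscillates boundedly on `P`, and the weak type bounds control it at
one point.

These averages are over `Q*`. Each `Q*` lies in a comparable cube of one of `2^d` shifted grids. The
terms are grouped by grid, and the same stopping machinery is applied to these sums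
(`exists_isLocallyControlled_aggregate`); this yields averages over the cubes themselves. It settles
the points of one large cube. At the other points the size of the kernel alone gives one more
family, made of cubes around the origin (`IsWeakCZ.exists_sparse_far`), and `2^d + 1 ≤ 3^d`.

The weak type `(1, 1)` bound (`IsCZO.exists_weakType`) comes from the Calderón–Zygmund decomposition
and also defines `T` on `L¹`. If `T` is real, everything is done over `ℝ` with real and imaginary
parts as components, so that the kernels are real. -/

/-! ### Shifted dyadic grids and the one-third trick. -/

/-- The offset, in units of the side length, of the grid `t` at level `k`. -/
noncomputable def gridShift {d : ℕ} (t : Fin d → ℤˣ) (k : ℤ) (i : Fin d) : ℝ :=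
  (((t i * k.negOnePow : ℤˣ) : ℤ) : ℝ) / 3

/-- The integer coordinates of the cube of level `k` of the grid `t` that contains `x`. -/
noncomputable def gridIdx {d : ℕ} (t : Fin d → ℤˣ) (k : ℤ) (x : Rd d) (i : Fin d) : ℤ :=
  ⌊x i / 2 ^ k - gridShift t k i⌋

/-- Labels (level and position) of the cubes of a grid. -/
abbrev CubeLabel (d : ℕ) : Type := ℤ × (Fin d → ℤ)

def gridCube {d : ℕ} (t : Fin d → ℤˣ) (Q : CubeLabel d) : Set (Rd d) :=
  {x | gridIdx t Q.1 x = Q.2}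

noncomputable def cubeAt {d : ℕ} (t : Fin d → ℤˣ) (k : ℤ) (x : Rd d) : CubeLabel d :=
  (k, gridIdx t k x)

noncomputable def cubeCorner {d : ℕ} (t : Fin d → ℤˣ) (Q : CubeLabel d) : Rd d :=
  WithLp.toLp 2 fun i => 2 ^ Q.1 * (Q.2 i + gridShift t Q.1 i)

section Grid
variable {d : ℕ} (t : Fin d → ℤˣ)

theorem mem_gridCube {Q : CubeLabel d} {x : Rd d} : x ∈ gridCube t Q ↔ cubeAt t Q.1 x = Q := by
  simp [gridCube, cubeAt, Prod.ext_iff]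

theorem mem_cubeAt (k : ℤ) (x : Rd d) : x ∈ gridCube t (cubeAt t k x) := rfl

theorem two_zpow_pos (k : ℤ) : (0 : ℝ) < 2 ^ k := zpow_pos (by norm_num) k

theorem cubeCorner_mem (Q : CubeLabel d) : cubeCorner t Q ∈ gridCube t Q := by
  funext i
  have h := (two_zpow_pos Q.1).ne'
  simp only [gridIdx, cubeCorner]
  rw [mul_div_cancel_left₀ _ h, add_sub_cancel_right, Int.floor_intCast]

theorem gridCube_eq_halfOpenCube (Q : CubeLabel d) :
    gridCube t Q = halfOpenCube (cubeCorner t Q) ((2 : ℝ) ^ Q.1) := by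
  ext x
  have h := two_zpow_pos Q.1
  simp only [gridCube, halfOpenCube, Set.mem_ofPred_eq, funext_iff]
  refine forall_congr' fun i => ?_
  simp only [gridIdx, cubeCorner, Int.floor_eq_iff]
  rw [le_sub_iff_add_le, le_div_iff₀ h, sub_lt_iff_lt_add, div_lt_iff₀ h]
  constructor
  · rintro ⟨h1, h2⟩; constructor <;> nlinarith
  · rintro ⟨h1, h2⟩; constructor <;> nlinarith

theorem gridShift_succ (k : ℤ) (i : Fin d) : gridShift t (k + 1) i = - gridShift t k i := by
  simp [gridShift, Int.negOnePow_succ, neg_div]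

/-- The shift changes sign from one level to the next, so a scaled coordinate `u` with shift `s`
becomes `(u + 3s) / 2`. As `3s = ±1` is an integer, the index at level `k` determines the index at
level `k + 1`, which is why the grid is nested. -/
theorem gridIdx_succ (k : ℤ) (x : Rd d) (i : Fin d) :
    gridIdx t (k + 1) x i = (gridIdx t k x i + ((t i * k.negOnePow : ℤˣ) : ℤ)) / 2 := by
  have h := (two_zpow_pos k).ne'
  have e : x i / 2 ^ (k + 1) - gridShift t (k + 1) i =
      (x i / 2 ^ k - gridShift t k i + (((t i * k.negOnePow : ℤˣ) : ℤ) : ℝ)) / (2 : ℕ) := by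
    rw [gridShift_succ, zpow_add_one₀ (by norm_num)]
    simp only [gridShift]
    push_cast
    field_simp
    ring
  rw [gridIdx, e, Int.floor_div_natCast, Int.floor_add_intCast]
  rfl

theorem gridIdx_congr_of_le {k l : ℤ} (hkl : k ≤ l) {x y : Rd d}
    (h : gridIdx t k x = gridIdx t k y) : gridIdx t l x = gridIdx t l y := by
  induction l, hkl using Int.leInduction with
  | base => exact h
  | succ n _ ih => funext i; rw [gridIdx_succ, gridIdx_succ, ih]

theorem gridCube_subset_of_le {P Q : CubeLabel d} (hl : P.1 ≤ Q.1) {x : Rd d}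
    (hP : x ∈ gridCube t P) (hQ : x ∈ gridCube t Q) : gridCube t P ⊆ gridCube t Q := by
  intro y hy
  have : gridIdx t P.1 y = gridIdx t P.1 x := hy.trans hP.symm
  exact (gridIdx_congr_of_le t hl this).trans hQ

theorem eq_of_mem_of_level_eq {P Q : CubeLabel d} (hl : P.1 = Q.1) {x : Rd d}
    (hP : x ∈ gridCube t P) (hQ : x ∈ gridCube t Q) : P = Q := by
  rw [mem_gridCube] at hP hQ
  rw [← hP, ← hQ, hl]

theorem gridCube_nested (P Q : CubeLabel d) : gridCube t P ⊆ gridCube t Q ∨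
    gridCube t Q ⊆ gridCube t P ∨ Disjoint (gridCube t P) (gridCube t Q) := by
  by_cases h : Disjoint (gridCube t P) (gridCube t Q)
  · exact Or.inr (Or.inr h)
  · obtain ⟨x, hP, hQ⟩ := Set.not_disjoint_iff.1 h
    rcases le_total P.1 Q.1 with hl | hl
    · exact Or.inl (gridCube_subset_of_le t hl hP hQ)
    · exact Or.inr (Or.inl (gridCube_subset_of_le t hl hQ hP))

theorem gridIdx_measurable (k : ℤ) : Measurable (gridIdx t k) := by
  refine measurable_pi_lambda _ fun i => ?_
  unfold gridIdx
  fun_prop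

theorem measurableSet_gridCube (Q : CubeLabel d) : MeasurableSet (gridCube t Q) :=
  gridIdx_measurable t Q.1 (measurableSet_singleton Q.2)

/-- The volume of the cubes of level `k`. -/
noncomputable def cubeVol (d : ℕ) (k : ℤ) : ℝ := ((2 : ℝ) ^ k) ^ d

theorem cubeVol_pos (k : ℤ) : 0 < cubeVol d k := pow_pos (two_zpow_pos k) d

theorem volume_halfOpenCube (a : Rd d) (l : ℝ) :
    volume (halfOpenCube a l) = ENNReal.ofReal l ^ d := by
  have h := EuclideanSpace.volume_preserving_symm_measurableEquiv_toLp (Fin d)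
  have e : halfOpenCube a l = (MeasurableEquiv.toLp 2 (Fin d → ℝ)).symm ⁻¹'
      (Set.pi Set.univ fun i => Set.Ico (a i) (a i + l)) := by
    ext x
    simp [halfOpenCube, Set.mem_pi]
  rw [e, h.measure_preimage (MeasurableSet.univ_pi fun i => measurableSet_Ico).nullMeasurableSet,
    Real.volume_pi_Ico]
  simp

theorem volume_gridCube (Q : CubeLabel d) :
    volume (gridCube t Q) = ENNReal.ofReal (cubeVol d Q.1) := by
  rw [gridCube_eq_halfOpenCube, volume_halfOpenCube, cubeVol,
    ENNReal.ofReal_pow (two_zpow_pos _).le]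

theorem volume_gridCube_ne_top (Q : CubeLabel d) : volume (gridCube t Q) ≠ ⊤ := by
  rw [volume_gridCube]; exact ENNReal.ofReal_ne_top

theorem volume_gridCube_ne_zero (Q : CubeLabel d) : volume (gridCube t Q) ≠ 0 := by
  rw [volume_gridCube]; simpa using cubeVol_pos Q.1

theorem measureReal_gridCube (Q : CubeLabel d) :
    volume.real (gridCube t Q) = cubeVol d Q.1 := by
  rw [measureReal_def, volume_gridCube, ENNReal.toReal_ofReal (cubeVol_pos _).le]

theorem cubeVol_add_nat (k : ℤ) (n : ℕ) : cubeVol d (k + n) = 2 ^ (n * d) * cubeVol d k := by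
  rw [cubeVol, cubeVol, zpow_add₀ (by norm_num), mul_pow, zpow_natCast, pow_mul]
  ring

theorem level_le_of_subset (hd : 0 < d) {P Q : CubeLabel d}
    (h : gridCube t P ⊆ gridCube t Q) : P.1 ≤ Q.1 := by
  have := measure_mono (μ := volume) h
  rw [volume_gridCube, volume_gridCube, ENNReal.ofReal_le_ofReal_iff (cubeVol_pos _).le] at this
  by_contra! hl
  refine absurd this (not_le.2 ?_)
  exact pow_lt_pow_left₀ (zpow_lt_zpow_right₀ (by norm_num) hl) (two_zpow_pos _).le hd.ne'

theorem gridCube_injective (hd : 0 < d) : Function.Injective (gridCube t) := fun P _ h =>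
  eq_of_mem_of_level_eq t
    (le_antisymm (level_le_of_subset t hd h.subset) (level_le_of_subset t hd h.symm.subset))
    (cubeCorner_mem t P) (h ▸ cubeCorner_mem t P)

theorem norm_le_of_forall_abs_le {x : Rd d} {r : ℝ} (hr : 0 ≤ r) (h : ∀ i, |x i| ≤ r) :
    ‖x‖ ≤ d * r := by
  rw [EuclideanSpace.norm_eq]
  refine Real.sqrt_le_iff.2 ⟨by positivity, ?_⟩
  calc ∑ i, ‖x i‖ ^ 2 ≤ ∑ _i : Fin d, r ^ 2 := by
        refine Finset.sum_le_sum fun i _ => ?_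
        exact pow_le_pow_left₀ (norm_nonneg _) (h i) 2
    _ = d * r ^ 2 := by simp
    _ ≤ (d * r) ^ 2 := by
        rw [mul_pow]
        refine mul_le_mul_of_nonneg_right ?_ (by positivity)
        rcases Nat.eq_zero_or_pos d with h0 | h0
        · simp [h0]
        · have : (1 : ℝ) ≤ d := by exact_mod_cast h0
          nlinarith

theorem norm_sub_le_of_mem {Q : CubeLabel d} {x y : Rd d} (hx : x ∈ gridCube t Q)
    (hy : y ∈ gridCube t Q) : ‖x - y‖ ≤ d * 2 ^ Q.1 := by
  rw [gridCube_eq_halfOpenCube] at hx hy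
  refine norm_le_of_forall_abs_le (two_zpow_pos _).le fun i => ?_
  have h1 := hx i
  have h2 := hy i
  simp only [PiLp.sub_apply]
  rw [abs_le]; constructor <;> linarith

theorem abs_apply_le_norm (x : Rd d) (i : Fin d) : |x i| ≤ ‖x‖ := by
  simpa using PiLp.norm_apply_le x i

theorem units_int_cast (u : ℤˣ) : ((u : ℤ) : ℝ) = 1 ∨ ((u : ℤ) : ℝ) = -1 := by
  rcases Int.units_eq_one_or u with h | h <;> simp [h]

/-- The faces at level `k` lie on hyperplanes `x_i = 2^k (n ± 1/3)`, at distance at least `2^k / 3`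
from the origin. So in every grid the cubes around the origin exhaust the space. -/
theorem gridIdx_eq_zero_of_norm_lt {k : ℤ} {x : Rd d} (hx : ‖x‖ < 2 ^ k / 3) :
    gridIdx t k x = gridIdx t k 0 := by
  funext i
  have hp := two_zpow_pos k
  have h1 : |x i / 2 ^ k| < 1 / 3 := by
    rw [abs_div, abs_of_pos hp, div_lt_iff₀ hp]
    linarith [abs_apply_le_norm x i]
  rw [abs_lt] at h1
  simp only [gridIdx, gridShift, PiLp.zero_apply, zero_div]
  rcases units_int_cast (t i * k.negOnePow) with h | h <;> rw [h]
  · rw [Int.floor_eq_iff.2 (⟨by push_cast; linarith, by push_cast; linarith⟩ :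
      ((-1 : ℤ) : ℝ) ≤ x i / 2 ^ k - 1 / 3 ∧ x i / 2 ^ k - 1 / 3 < ((-1 : ℤ) : ℝ) + 1)]
    rw [eq_comm, Int.floor_eq_iff]; norm_num
  · rw [Int.floor_eq_iff.2 (⟨by push_cast; linarith, by push_cast; linarith⟩ :
      ((0 : ℤ) : ℝ) ≤ x i / 2 ^ k - -1 / 3 ∧ x i / 2 ^ k - -1 / 3 < ((0 : ℤ) : ℝ) + 1)]
    rw [eq_comm, Int.floor_eq_iff]; norm_num

/-- The sets `ℤ + 1/3` and `ℤ - 1/3` are at distance `1/3 > 2/7`, so `a` cannot be within `1/7` of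
both. The sign `u` of the level is absorbed by taking `s = ±u`. -/
theorem exists_floor_eq (u : ℤˣ) (a : ℝ) : ∃ s : ℤˣ, ∀ b : ℝ, |b - a| < 1 / 7 →
    ⌊b - (((s * u : ℤˣ) : ℤ) : ℝ) / 3⌋ = ⌊a - (((s * u : ℤˣ) : ℤ) : ℝ) / 3⌋ := by
  have key : ∀ c : ℝ, (∀ n : ℤ, 1 / 7 ≤ |a - c - n|) → ∀ b : ℝ, |b - a| < 1 / 7 →
      ⌊b - c⌋ = ⌊a - c⌋ := by
    intro c hc b hb
    have h0 := hc ⌊a - c⌋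
    have h1 := hc (⌊a - c⌋ + 1)
    have h2 := Int.floor_le (a - c)
    have h3 := Int.lt_floor_add_one (a - c)
    push_cast at h1
    rw [abs_of_nonneg (by linarith)] at h0
    rw [abs_of_neg (by linarith)] at h1
    rw [abs_lt] at hb
    rw [Int.floor_eq_iff]
    constructor <;> linarith
  by_cases h : ∀ n : ℤ, 1 / 7 ≤ |a - 1 / 3 - n|
  · refine ⟨u, fun b hb => ?_⟩
    rw [Int.units_mul_self]
    simpa using key _ h b hb
  · push Not at h
    obtain ⟨n, hn⟩ := h
    refine ⟨-u, fun b hb => ?_⟩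
    rw [neg_mul, Int.units_mul_self]
    refine key _ (fun m => ?_) b hb
    push_cast
    rw [abs_lt] at hn
    rw [le_abs]
    rcases lt_trichotomy m n with hm | hm | hm
    · have : (m : ℝ) + 1 ≤ n := by exact_mod_cast hm
      left; linarith
    · subst hm; left; linarith
    · have : (n : ℝ) + 1 ≤ m := by exact_mod_cast hm
      right; linarith

theorem exists_ball_subset_gridCube (k : ℤ) (x : Rd d) :
    ∃ t : Fin d → ℤˣ, Metric.ball x (2 ^ k / 7) ⊆ gridCube t (cubeAt t k x) := by
  choose s hs using fun i => exists_floor_eq k.negOnePow (x i / 2 ^ k)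
  refine ⟨s, fun y hy => funext fun i => hs i _ ?_⟩
  have hp := two_zpow_pos k
  change |y i / 2 ^ k - x i / 2 ^ k| < 1 / 7
  rw [← sub_div, abs_div, abs_of_pos hp, div_lt_iff₀ hp]
  rw [Metric.mem_ball, dist_eq_norm] at hy
  have := abs_apply_le_norm (y - x) i
  simp only [PiLp.sub_apply] at this
  linarith

theorem exists_cubeAt_subset_of_isOpen {O : Set (Rd d)} (hO : IsOpen O) {x : Rd d} (hx : x ∈ O) :
    ∃ k : ℤ, gridCube t (cubeAt t k x) ⊆ O := by
  obtain ⟨ε, hε, hb⟩ := Metric.isOpen_iff.1 hO x hx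
  obtain ⟨n, hn⟩ := exists_pow_lt_of_lt_one (show 0 < ε / (d + 1) by positivity)
    (show (1 / 2 : ℝ) < 1 by norm_num)
  refine ⟨-n, fun y hy => hb ?_⟩
  rw [Metric.mem_ball, dist_eq_norm]
  have h1 := norm_sub_le_of_mem t hy (mem_cubeAt t _ x)
  have h2 : (2 : ℝ) ^ (-(n : ℤ)) = (1 / 2) ^ n := by
    rw [zpow_neg, zpow_natCast, one_div, inv_pow]
  simp only [cubeAt] at h1
  rw [h2] at h1
  rw [lt_div_iff₀ (by positivity)] at hn
  have : (0 : ℝ) < (1 / 2) ^ n := by positivity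
  nlinarith

theorem isDyadicGrid_range : IsDyadicGrid (Set.range (gridCube t)) where
  isCube := by
    rintro _ ⟨Q, rfl⟩
    exact ⟨_, _, gridCube_eq_halfOpenCube t Q⟩
  nested := by
    rintro _ ⟨P, rfl⟩ _ ⟨Q, rfl⟩
    exact gridCube_nested t P Q
  covers := fun k x => by
    have := gridCube_eq_halfOpenCube t (cubeAt t k x)
    exact ⟨_, ⟨_, this⟩, this ▸ mem_cubeAt t k x⟩

/-- The parent cube. -/
noncomputable def cubeParent (Q : CubeLabel d) : CubeLabel d :=
  cubeAt t (Q.1 + 1) (cubeCorner t Q)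

theorem gridCube_subset_cubeParent (Q : CubeLabel d) :
    gridCube t Q ⊆ gridCube t (cubeParent t Q) :=
  gridCube_subset_of_le t (by simp [cubeParent, cubeAt]) (cubeCorner_mem t Q) (mem_cubeAt t _ _)

theorem exists_norm_lt_two_zpow (r : ℝ) : ∃ k : ℤ, r < 2 ^ k / 3 := by
  obtain ⟨n, hn⟩ := pow_unbounded_of_one_lt (3 * r) (one_lt_two)
  refine ⟨n, ?_⟩
  rw [zpow_natCast]; linarith

end Grid

/-! ### Stopping cubes of an open set. -/

section Stopping
variable {d : ℕ} (t : Fin d → ℤˣ)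

/-- The cube `P` contains a portion of `O` larger than `2 ^ (-d-1) |P|`. -/
def IsHeavy (O : Set (Rd d)) (P : CubeLabel d) : Prop :=
  volume (gridCube t P) < 2 ^ (d + 1) * volume (gridCube t P ∩ O)

/-- The maximal heavy cubes. -/
def stopCubes (O : Set (Rd d)) : Set (CubeLabel d) :=
  {P | IsHeavy t O P ∧ ∀ k > P.1, ¬ IsHeavy t O (cubeAt t k (cubeCorner t P))}

theorem eq_of_mem_stopCubes {O : Set (Rd d)} {P Q : CubeLabel d} (hP : P ∈ stopCubes t O)
    (hQ : Q ∈ stopCubes t O) {x : Rd d} (hxP : x ∈ gridCube t P) (hxQ : x ∈ gridCube t Q) :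
    P = Q := by
  have key : ∀ {P Q : CubeLabel d}, P ∈ stopCubes t O → Q ∈ stopCubes t O →
      x ∈ gridCube t P → x ∈ gridCube t Q → ¬ P.1 < Q.1 := by
    intro P Q hP hQ hxP hxQ hlt
    have h1 := gridCube_subset_of_le t hlt.le hxP hxQ (cubeCorner_mem t P)
    rw [mem_gridCube] at h1
    exact hP.2 _ hlt (h1 ▸ hQ.1)
  rcases lt_trichotomy P.1 Q.1 with h | h | h
  · exact absurd h (key hP hQ hxP hxQ)
  · exact eq_of_mem_of_level_eq t h hxP hxQ
  · exact absurd h (key hQ hP hxQ hxP)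

/-- Small cubes around `x` lie in `O` and are heavy; large ones are not, because `O` has finite
volume. The heavy cube of greatest level is the stopping cube. -/
theorem exists_mem_stopCubes (hd : 0 < d) {O : Set (Rd d)} (hO : IsOpen O)
    (hfin : volume O ≠ ⊤) {x : Rd d} (hx : x ∈ O) : ∃ P ∈ stopCubes t O, x ∈ gridCube t P := by
  have hbdd : ∃ b : ℤ, ∀ k : ℤ, IsHeavy t O (cubeAt t k x) → k ≤ b := by
    obtain ⟨n, hn⟩ := pow_unbounded_of_one_lt (2 ^ (d + 1) * (volume O).toReal) one_lt_two
    refine ⟨n, fun k hk => ?_⟩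
    by_contra! hlt
    have h1 : ENNReal.ofReal (cubeVol d k) < 2 ^ (d + 1) * volume O := by
      have := hk.trans_le (mul_le_mul_right (measure_mono (μ := volume)
        (Set.inter_subset_right : gridCube t (cubeAt t k x) ∩ O ⊆ O)) _)
      rwa [volume_gridCube] at this
    rw [← ENNReal.ofReal_toReal hfin, show (2 : ENNReal) ^ (d + 1) = ENNReal.ofReal (2 ^ (d + 1)) by
      rw [ENNReal.ofReal_pow (by norm_num)]; simp, ← ENNReal.ofReal_mul (by positivity),
      ENNReal.ofReal_lt_ofReal_iff_of_nonneg (cubeVol_pos k).le] at h1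
    have h2 : (2 : ℝ) ^ n ≤ 2 ^ k := by
      rw [← zpow_natCast]; exact zpow_le_zpow_right₀ (by norm_num) hlt.le
    have h3 : (1 : ℝ) ≤ 2 ^ n := one_le_pow₀ (by norm_num)
    have h4 : (2 : ℝ) ^ k ≤ cubeVol d k := le_self_pow₀ (h3.trans h2) hd.ne'
    linarith
  have hex : ∃ k : ℤ, IsHeavy t O (cubeAt t k x) := by
    obtain ⟨k, hk⟩ := exists_cubeAt_subset_of_isOpen t hO hx
    refine ⟨k, ?_⟩
    rw [IsHeavy, Set.inter_eq_left.2 hk]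
    conv_lhs => rw [← one_mul (volume _)]
    refine ENNReal.mul_lt_mul_left (volume_gridCube_ne_zero t _) (volume_gridCube_ne_top t _) ?_
    exact one_lt_pow₀ (by norm_num) (by omega)
  obtain ⟨k, hk, hmax⟩ := Int.exists_greatest_of_bdd hbdd hex
  refine ⟨cubeAt t k x, ⟨hk, fun l hl hheavy => ?_⟩, mem_cubeAt t k x⟩
  have : cubeAt t l (cubeCorner t (cubeAt t k x)) = cubeAt t l x := by
    refine Prod.ext rfl (gridIdx_congr_of_le t (k := k) hl.le ?_)
    exact cubeCorner_mem t (cubeAt t k x)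
  rw [this] at hheavy
  exact absurd (hmax l hheavy) (not_le.2 hl)

/-- The parent is not heavy and has `2^d` times the volume; the threshold `2^(-d-1)` is chosen so
that the fraction `1/2` remains. Stopping cubes therefore contain points outside `O`. -/
theorem two_mul_volume_inter_le_of_mem_stopCubes {O : Set (Rd d)} {P : CubeLabel d}
    (hP : P ∈ stopCubes t O) : 2 * volume (gridCube t P ∩ O) ≤ volume (gridCube t P) := by
  have h1 := hP.2 (P.1 + 1) (by omega)
  rw [IsHeavy, not_lt] at h1
  have h2 : volume (gridCube t (cubeAt t (P.1 + 1) (cubeCorner t P))) =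
      2 ^ d * volume (gridCube t P) := by
    rw [volume_gridCube, volume_gridCube]
    have := cubeVol_add_nat (d := d) P.1 1
    simp only [cubeAt]
    push_cast at this
    rw [this, ENNReal.ofReal_mul (by positivity), ENNReal.ofReal_pow (by norm_num)]
    simp
  have h3 := mul_le_mul_right (measure_mono (μ := volume)
    (Set.inter_subset_inter_left O (gridCube_subset_cubeParent t P))) ((2 : ENNReal) ^ (d + 1))
  have h4 := h3.trans (h1.trans_eq h2)
  rw [pow_succ, mul_assoc] at h4
  exact (ENNReal.mul_le_mul_iff_right (by positivity) (by finiteness)).1 h4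

theorem tsum_measure_gridCube_inter_le (μ : Measure (Rd d)) {S : Set (CubeLabel d)}
    (hS : S.PairwiseDisjoint (gridCube t)) {O : Set (Rd d)} (hO : MeasurableSet O) :
    ∑' P : S, μ (gridCube t P ∩ O) ≤ μ O := by
  refine (tsum_meas_le_meas_iUnion_of_disjoint μ (As := fun P : S => gridCube t P ∩ O)
    (fun P => (measurableSet_gridCube t _).inter hO) ?_).trans (measure_mono ?_)
  · intro P Q hPQ
    exact (hS P.2 Q.2 (fun h => hPQ (Subtype.ext h))).mono Set.inter_subset_left
      Set.inter_subset_left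
  · exact Set.iUnion_subset fun _ => Set.inter_subset_right

theorem pairwiseDisjoint_stopCubes (O : Set (Rd d)) :
    (stopCubes t O).PairwiseDisjoint (gridCube t) := fun _ hP _ hQ hne =>
  Set.disjoint_left.2 fun _ hxP hxQ => hne (eq_of_mem_stopCubes t hP hQ hxP hxQ)

theorem tsum_volume_stopCubes_le {O : Set (Rd d)} (hO : MeasurableSet O) :
    ∑' P : stopCubes t O, volume (gridCube t P) ≤ 2 ^ (d + 1) * volume O := by
  calc ∑' P : stopCubes t O, volume (gridCube t P)
      ≤ ∑' P : stopCubes t O, 2 ^ (d + 1) * volume (gridCube t P ∩ O) :=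
        ENNReal.tsum_le_tsum fun P => P.2.1.le
    _ = 2 ^ (d + 1) * ∑' P : stopCubes t O, volume (gridCube t P ∩ O) := ENNReal.tsum_mul_left
    _ ≤ _ := by
        gcongr
        exact tsum_measure_gridCube_inter_le t volume (pairwiseDisjoint_stopCubes t O) hO

end Stopping

/-! ### The maximal function of a measure, and tail integrals. -/

section Maximal
variable {d : ℕ}

/-- The points at which the maximal function of the measure `ν` exceeds `A`. -/
def maximalSet (ν : Measure (Rd d)) (A : ℝ) : Set (Rd d) :=
  {x | ∃ r > 0, ENNReal.ofReal (A * r ^ d) < ν (Metric.closedBall x r)}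

theorem volume_closedBall_eq (x : Rd d) {r : ℝ} (hr : 0 ≤ r) :
    volume (Metric.closedBall x r) =
      ENNReal.ofReal (r ^ d) * volume (Metric.ball (0 : Rd d) 1) := by
  rw [Measure.addHaar_closedBall _ _ hr, finrank_euclideanSpace_fin]

/-- Vitali's lemma extracts disjoint balls whose fivefold dilates cover the set; the volume of each
is controlled by its `ν`-mass, and disjointness sums these masses. -/
theorem volume_maximalSet_le (hd : 0 < d) (ν : Measure (Rd d)) [IsFiniteMeasure ν] {A : ℝ}
    (hA : 0 < A) : volume (maximalSet ν A) ≤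
      5 ^ d * volume (Metric.ball (0 : Rd d) 1) * ν Set.univ / ENNReal.ofReal A := by
  have hpos : ∀ x : maximalSet ν A, ∃ r > 0, ENNReal.ofReal (A * r ^ d) <
    ν (Metric.closedBall (x : Rd d) r) := fun x => x.2
  choose r hr0 hr using hpos
  -- For `r ≥ 1` one has `A r ≤ A r^d < ν(ℝ^d)`, which bounds the radii as Vitali's lemma requires.
  have hbound : ∀ x, r x ≤ max 1 (ν.real Set.univ / A) := by
    intro x
    by_contra! h
    have h1 : 1 ≤ r x := ((le_max_left _ _).trans_lt h).le
    have h2 : ν.real Set.univ / A < r x := (le_max_right _ _).trans_lt h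
    have h3 : r x ≤ r x ^ d := le_self_pow₀ h1 hd.ne'
    have h4 := (hr x).trans_le (measure_mono (Set.subset_univ _))
    rw [← ENNReal.ofReal_toReal (measure_ne_top ν Set.univ),
      ENNReal.ofReal_lt_ofReal_iff_of_nonneg (by have := hr0 x; positivity)] at h4
    rw [div_lt_iff₀ hA] at h2
    change _ < ν.real Set.univ at h4
    nlinarith
  obtain ⟨u, -, hdisj, hcov⟩ := Vitali.exists_disjoint_subfamily_covering_enlargement_closedBall
    Set.univ (fun x : maximalSet ν A => (x : Rd d)) r _ (fun x _ => hbound x) 5 (by norm_num)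
  have hcount : u.Countable := by
    refine hdisj.countable_of_nonempty_interior fun x _ => ?_
    exact ⟨x, Metric.ball_subset_interior_closedBall (Metric.mem_ball_self (hr0 x))⟩
  have : Countable u := hcount
  have hsub : maximalSet ν A ⊆ ⋃ x : u, Metric.closedBall (x : Rd d) (5 * r x) := by
    intro x hx
    obtain ⟨b, hb, hsub⟩ := hcov ⟨x, hx⟩ (Set.mem_univ _)
    exact Set.mem_iUnion.2 ⟨⟨b, hb⟩, hsub (Metric.mem_closedBall_self (hr0 _).le)⟩
  have hdd : Pairwise (Function.onFun Disjoint fun x : u => Metric.closedBall (x : Rd d) (r x)) :=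
    fun x y hxy => hdisj x.2 y.2 (fun h => hxy (Subtype.ext h))
  set w := volume (Metric.ball (0 : Rd d) 1)
  calc volume (maximalSet ν A) ≤ ∑' x : u, volume (Metric.closedBall (x : Rd d) (5 * r x)) :=
        (measure_mono hsub).trans (measure_iUnion_le _)
    _ ≤ ∑' x : u, 5 ^ d * w / ENNReal.ofReal A * ν (Metric.closedBall (x : Rd d) (r x)) := by
        refine ENNReal.tsum_le_tsum fun x => ?_
        have h0 := hr0 (x : maximalSet ν A)
        rw [volume_closedBall_eq _ (by positivity), mul_pow, ENNReal.ofReal_mul (by positivity),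
          ENNReal.ofReal_pow (by norm_num : (0 : ℝ) ≤ 5)]
        have hx := (hr x).le
        rw [ENNReal.ofReal_mul hA.le, mul_comm, ← ENNReal.le_div_iff_mul_le
          (Or.inl (by simpa using hA)) (Or.inl ENNReal.ofReal_ne_top)] at hx
        calc _ ≤ ENNReal.ofReal 5 ^ d * (ν (Metric.closedBall (x : Rd d) (r x)) /
              ENNReal.ofReal A) * w := by gcongr
          _ = _ := by
              simp only [div_eq_mul_inv, ENNReal.ofReal_ofNat]
              ring
    _ = 5 ^ d * w / ENNReal.ofReal A * ∑' x : u, ν (Metric.closedBall (x : Rd d) (r x)) :=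
        ENNReal.tsum_mul_left
    _ ≤ 5 ^ d * w / ENNReal.ofReal A * ν Set.univ := by
        gcongr
        exact tsum_meas_le_meas_iUnion_of_disjoint ν (fun _ => measurableSet_closedBall) hdd
          |>.trans (measure_mono (Set.subset_univ _))
    _ = _ := by rw [div_eq_mul_inv, div_eq_mul_inv]; ring

/-- Tail integrals of `|x - y| ^ (-d-δ)` against a measure of growth at most `M r ^ d`. -/
theorem lintegral_tail_le (ν : Measure (Rd d)) {δ : ℝ} (hδ : 0 < δ) (x : Rd d) {ρ M : ℝ}
    (hρ : 0 < ρ) (hM : 0 ≤ M)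
    (hν : ∀ r ≥ ρ, ν (Metric.closedBall x r) ≤ ENNReal.ofReal (M * r ^ d)) :
    ∫⁻ y in {y | ρ ≤ ‖x - y‖}, ENNReal.ofReal (1 / ‖x - y‖ ^ ((d : ℝ) + δ)) ∂ν ≤
      ENNReal.ofReal (2 ^ d / (1 - 2 ^ (-δ)) * M / ρ ^ δ) := by
  -- On the `n`-th dyadic annulus the integrand is at most `(2^n ρ)^(-d-δ)` and the mass at most `M
  -- (2^(n+1) ρ)^d`; the products form a geometric series of ratio `2^(-δ)`.
  set a : ℕ → Set (Rd d) := fun n => {y | 2 ^ n * ρ ≤ ‖x - y‖ ∧ ‖x - y‖ < 2 ^ (n + 1) * ρ}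
  have hsub : {y | ρ ≤ ‖x - y‖} ⊆ ⋃ n, a n := by
    intro y hy
    have h1 : 1 ≤ ‖x - y‖ / ρ := by rw [le_div_iff₀ hρ]; simpa using hy
    obtain ⟨n, hn1, hn2⟩ := exists_nat_pow_near h1 one_lt_two
    refine Set.mem_iUnion.2 ⟨n, ?_, ?_⟩
    · rwa [le_div_iff₀ hρ] at hn1
    · rwa [div_lt_iff₀ hρ] at hn2
  have hq0 : (0 : ℝ) ≤ 2 ^ (-δ) := by positivity
  have hq1 : (2 : ℝ) ^ (-δ) < 1 := Real.rpow_lt_one_of_one_lt_of_neg (by norm_num) (by linarith)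
  have hterm : ∀ n, ∫⁻ y in a n, ENNReal.ofReal (1 / ‖x - y‖ ^ ((d : ℝ) + δ)) ∂ν ≤
      ENNReal.ofReal (2 ^ d * M / ρ ^ δ * (2 ^ (-δ)) ^ n) := by
    intro n
    have hR : 0 < 2 ^ n * ρ := by positivity
    have hm : MeasurableSet (a n) := by
      have h1 : MeasurableSet {y | 2 ^ n * ρ ≤ ‖x - y‖} :=
        measurableSet_le measurable_const (by fun_prop)
      have h2 : MeasurableSet {y | ‖x - y‖ < 2 ^ (n + 1) * ρ} :=
        measurableSet_lt (by fun_prop) measurable_const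
      exact h1.inter h2
    calc ∫⁻ y in a n, ENNReal.ofReal (1 / ‖x - y‖ ^ ((d : ℝ) + δ)) ∂ν
        ≤ ∫⁻ y in a n, ENNReal.ofReal (1 / (2 ^ n * ρ) ^ ((d : ℝ) + δ)) ∂ν := by
          refine setLIntegral_mono' hm fun y hy => ?_
          gcongr
          exact hy.1
      _ = ENNReal.ofReal (1 / (2 ^ n * ρ) ^ ((d : ℝ) + δ)) * ν (a n) := by
          rw [setLIntegral_const]
      _ ≤ ENNReal.ofReal (1 / (2 ^ n * ρ) ^ ((d : ℝ) + δ)) *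
            ENNReal.ofReal (M * (2 ^ (n + 1) * ρ) ^ d) := by
          gcongr
          refine (measure_mono fun y hy => ?_).trans (hν _ ?_)
          · rw [Metric.mem_closedBall, dist_comm, dist_eq_norm]; exact hy.2.le
          · have : (1 : ℝ) ≤ 2 ^ (n + 1) := one_le_pow₀ (by norm_num)
            nlinarith
      _ = _ := by
          rw [← ENNReal.ofReal_mul (by positivity)]
          congr 1
          rw [Real.rpow_add hR, Real.rpow_natCast, Real.mul_rpow (by positivity) hρ.le,
            pow_succ, ← Real.rpow_natCast (2 ^ (-δ)) n, ← Real.rpow_mul (by norm_num), neg_mul,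
            mul_comm δ, Real.rpow_neg (by norm_num), Real.rpow_mul (by norm_num), Real.rpow_natCast]
          have : (2 ^ n * 2 * ρ : ℝ) ^ d = 2 ^ d * (2 ^ n * ρ) ^ d := by
            rw [← mul_pow]; ring
          rw [this]
          field_simp
  calc ∫⁻ y in {y | ρ ≤ ‖x - y‖}, ENNReal.ofReal (1 / ‖x - y‖ ^ ((d : ℝ) + δ)) ∂ν
      ≤ ∑' n, ∫⁻ y in a n, ENNReal.ofReal (1 / ‖x - y‖ ^ ((d : ℝ) + δ)) ∂ν :=
        (lintegral_mono_set hsub).trans (lintegral_iUnion_le _ _)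
    _ ≤ ∑' n : ℕ, ENNReal.ofReal (2 ^ d * M / ρ ^ δ * (2 ^ (-δ)) ^ n) :=
        ENNReal.tsum_le_tsum hterm
    _ = _ := by
        rw [← ENNReal.ofReal_tsum_of_nonneg (fun n => by positivity)
          ((summable_geometric_of_lt_one hq0 hq1).mul_left _), tsum_mul_left,
          tsum_geometric_of_lt_one hq0 hq1]
        congr 1
        field_simp

end Maximal

/-! ### The Calderón–Zygmund decomposition and weak type `(1, 1)`. -/

section WeakType
variable {d : ℕ}

/-- The volume of the unit ball of `ℝ^d`. -/
noncomputable def unitBallVol (d : ℕ) : ENNReal := volume (Metric.ball (0 : Rd d) 1)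

theorem unitBallVol_ne_top : unitBallVol d ≠ ⊤ := measure_ball_lt_top.ne

theorem unitBallVol_ne_zero : unitBallVol d ≠ 0 :=
  (Metric.measure_ball_pos volume _ one_pos).ne'

/-- The measure with density `‖f‖`. -/
noncomputable def massMeasure {G : Type*} [NormedAddCommGroup G] (f : Rd d → G) :
    Measure (Rd d) := volume.withDensity fun x => ‖f x‖ₑ

theorem massMeasure_apply {G : Type*} [NormedAddCommGroup G] (f : Rd d → G) {s : Set (Rd d)}
    (hs : MeasurableSet s) : massMeasure f s = ∫⁻ x in s, ‖f x‖ₑ := withDensity_apply _ hs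

theorem isFiniteMeasure_massMeasure {G : Type*} [NormedAddCommGroup G] {f : Rd d → G}
    (hf : Integrable f volume) : IsFiniteMeasure (massMeasure f) :=
  isFiniteMeasure_withDensity hf.2.ne

theorem volume_maximalSet_massMeasure_le {G : Type*} [NormedAddCommGroup G] (hd : 0 < d)
    {f : Rd d → G} (hf : Integrable f volume) {A : ℝ} (hA : 0 < A) :
    volume (maximalSet (massMeasure f) A) ≤
      5 ^ d * unitBallVol d * (∫⁻ x, ‖f x‖ₑ) / ENNReal.ofReal A := by
  have := isFiniteMeasure_massMeasure hf
  have h := volume_maximalSet_le hd (massMeasure f) hA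
  rwa [massMeasure_apply f MeasurableSet.univ, setLIntegral_univ] at h

theorem lintegral_closedBall_le_of_notMem {G : Type*} [NormedAddCommGroup G] {f : Rd d → G}
    {A : ℝ} {x : Rd d} (hx : x ∉ maximalSet (massMeasure f) A) {r : ℝ} (hr : 0 < r) :
    ∫⁻ y in Metric.closedBall x r, ‖f y‖ₑ ≤ ENNReal.ofReal (A * r ^ d) := by
  rw [← massMeasure_apply f measurableSet_closedBall]
  by_contra! h
  exact hx ⟨r, hr, h⟩

/-- Lebesgue differentiation along balls centred at `x`. The volume of the unit ball appears because
`maximalSet` compares masses with `r^d`. -/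
theorem ae_enorm_le_of_notMem_maximalSet {G : Type*} [NormedAddCommGroup G] {f : Rd d → G}
    (hf : Integrable f volume) {A : ℝ} (hA : 0 ≤ A) :
    ∀ᵐ x, x ∉ maximalSet (massMeasure f) A → ‖f x‖ₑ ≤ ENNReal.ofReal A / unitBallVol d := by
  have h := IsUnifLocDoublingMeasure.ae_tendsto_average (volume : Measure (Rd d))
    (f := fun x => ‖f x‖) hf.norm.locallyIntegrable 1
  filter_upwards [h] with x hx hmem
  have hlim : Tendsto (fun n : ℕ => 1 / ((n : ℝ) + 1)) atTop (𝓝[>] 0) :=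
    tendsto_nhdsWithin_iff.2 ⟨tendsto_one_div_add_atTop_nhds_zero_nat,
      Eventually.of_forall fun n => by simp only [Set.mem_Ioi]; positivity⟩
  have h1 := hx (fun _ : ℕ => x) _ hlim (Eventually.of_forall fun n =>
    Metric.mem_closedBall_self (by positivity))
  have hω : 0 < (unitBallVol d).toReal :=
    ENNReal.toReal_pos unitBallVol_ne_zero unitBallVol_ne_top
  have h2 : ‖f x‖ ≤ A / (unitBallVol d).toReal := by
    refine le_of_tendsto' h1 fun n => ?_
    have hr : (0 : ℝ) < 1 / ((n : ℝ) + 1) := by positivity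
    set r : ℝ := 1 / ((n : ℝ) + 1)
    have h3 := lintegral_closedBall_le_of_notMem hmem hr
    have h4 : ∫ y in Metric.closedBall x r, ‖f y‖ ≤ A * r ^ d := by
      rw [integral_norm_eq_lintegral_enorm hf.1.restrict]
      exact ENNReal.toReal_le_of_le_ofReal (by positivity) h3
    have h5 : volume.real (Metric.closedBall x r) = r ^ d * (unitBallVol d).toReal := by
      rw [measureReal_def, volume_closedBall_eq _ hr.le, ENNReal.toReal_mul,
        ENNReal.toReal_ofReal (by positivity)]
      rfl
    rw [setAverage_eq, h5, smul_eq_mul, ← div_eq_inv_mul, div_le_div_iff₀ (by positivity) hω]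
    calc _ ≤ A * r ^ d * (unitBallVol d).toReal := by gcongr
      _ = _ := by ring
  rw [← ofReal_norm, ← ENNReal.ofReal_toReal (unitBallVol_ne_top (d := d)),
    ← ENNReal.ofReal_div_of_pos hω]
  exact ENNReal.ofReal_le_ofReal h2

theorem IsCZKernel.exists_nonneg {K : Rd d → Rd d → ℂ} (hK : IsCZKernel K) :
    ∃ C δ : ℝ, 0 ≤ C ∧ 0 < δ ∧
      (∀ x y, x ≠ y → ‖K x y‖ ≤ C / ‖x - y‖ ^ d) ∧
      (∀ x x' y, x ≠ y → 2 * ‖x - x'‖ ≤ ‖x - y‖ →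
        ‖K x y - K x' y‖ ≤ C * ‖x - x'‖ ^ δ / ‖x - y‖ ^ ((d : ℝ) + δ) ∧
        ‖K y x - K y x'‖ ≤ C * ‖x - x'‖ ^ δ / ‖x - y‖ ^ ((d : ℝ) + δ)) := by
  obtain ⟨C, δ, hδ, -, h1, h2⟩ := hK
  refine ⟨|C|, δ, abs_nonneg _, hδ, fun x y hxy => (h1 x y hxy).trans ?_,
    fun x x' y hxy hle => ?_⟩
  · gcongr; exact le_abs_self C
  · have h3 := h2 x x' y hxy hle
    have h4 : C * ‖x - x'‖ ^ δ / ‖x - y‖ ^ ((d : ℝ) + δ) ≤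
        |C| * ‖x - x'‖ ^ δ / ‖x - y‖ ^ ((d : ℝ) + δ) := by
      gcongr; exact le_abs_self C
    constructor
    · linarith [norm_nonneg (K y x - K y x')]
    · linarith [norm_nonneg (K x y - K x' y)]

variable {T : Lp ℂ 2 (volume : Measure (Rd d)) →L[ℂ] Lp ℂ 2 (volume : Measure (Rd d))}

/-- As `b` has mean zero, `K(x, a)` may be subtracted from `K(x, y)`. Regularity in the second
variable then gives the integrable decay `R^δ |a - x|^(-d-δ)` away from the support. -/
theorem lintegral_operator_cancel_le {K : Rd d → Rd d → ℂ} {C δ : ℝ} (hC : 0 ≤ C) (hδ : 0 < δ)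
    (hreg : ∀ x x' y, x ≠ y → 2 * ‖x - x'‖ ≤ ‖x - y‖ →
      ‖K y x - K y x'‖ ≤ C * ‖x - x'‖ ^ δ / ‖x - y‖ ^ ((d : ℝ) + δ))
    (hrep : ∀ (f : Rd d → ℂ) (hf : MemLp f 2 volume), HasCompactSupport f →
      ∀ᵐ x, x ∉ tsupport f → T (hf.toLp f) x = ∫ y, K x y * f y)
    {b : Rd d → ℂ} (hb : MemLp b 2 volume) (hbi : Integrable b volume) {a : Rd d} {R : ℝ}
    (hR : 0 < R) (hsupp : ∀ y, b y ≠ 0 → ‖y - a‖ ≤ R) (hint : ∫ y, b y = 0) :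
    ∫⁻ x in {x | 3 * R ≤ ‖a - x‖}, ‖T (hb.toLp b) x‖ₑ ≤
      ENNReal.ofReal (C * (2 ^ d / (1 - 2 ^ (-δ)) * (unitBallVol d).toReal)) *
        ∫⁻ x, ‖b x‖ₑ := by
  have hcs : HasCompactSupport b := by
    refine HasCompactSupport.intro (isCompact_closedBall a R) fun y hy => ?_
    by_contra h
    exact hy (by rw [Metric.mem_closedBall, dist_eq_norm]; exact hsupp y h)
  have hts : tsupport b ⊆ Metric.closedBall a R := by
    refine closure_minimal (fun y hy => ?_) Metric.isClosed_closedBall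
    rw [Metric.mem_closedBall, dist_eq_norm]; exact hsupp y hy
  set I := ∫ y, ‖b y‖ with hI
  have hI0 : 0 ≤ I := integral_nonneg fun _ => norm_nonneg _
  have hpt : ∀ᵐ x, 3 * R ≤ ‖a - x‖ →
      ‖T (hb.toLp b) x‖ ≤ C * R ^ δ / ‖a - x‖ ^ ((d : ℝ) + δ) * I := by
    filter_upwards [hrep b hb hcs] with x hx h3
    have hax : a ≠ x := by
      rintro rfl; simp at h3; linarith
    have hxt : x ∉ tsupport b := fun h => by
      have := hts h
      rw [Metric.mem_closedBall, dist_comm, dist_eq_norm] at this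
      linarith
    rw [hx hxt]
    -- Measurability of `K` is not available here; a non-integrable product has Bochner integral
    -- `0`, for which the bound is trivial.
    by_cases hi : Integrable (fun y => K x y * b y) volume
    · have h0 : ∫ y, K x y * b y = ∫ y, (K x y - K x a) * b y := by
        simp only [sub_mul]
        rw [integral_sub hi (hbi.const_mul _), integral_const_mul, hint, mul_zero, sub_zero]
      rw [h0, hI, ← integral_const_mul]
      refine norm_integral_le_of_norm_le (hbi.norm.const_mul _)
        (Eventually.of_forall fun y => ?_)
      rw [norm_mul]
      by_cases hy : b y = 0
      · simp [hy]
      · have h4 := hsupp y hy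
        have h5 := hreg a y x hax (by rw [norm_sub_rev a y]; linarith)
        rw [norm_sub_rev (K x y)]
        refine mul_le_mul_of_nonneg_right (h5.trans ?_) (norm_nonneg _)
        rw [norm_sub_rev a y]
        gcongr
    · rw [integral_undef hi, norm_zero]; positivity
  have hm : MeasurableSet {x : Rd d | 3 * R ≤ ‖a - x‖} :=
    measurableSet_le measurable_const (by fun_prop)
  have hq1 : (2 : ℝ) ^ (-δ) < 1 := Real.rpow_lt_one_of_one_lt_of_neg (by norm_num) (by linarith)
  have hq2 : 0 < 1 - (2 : ℝ) ^ (-δ) := by linarith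
  calc ∫⁻ x in {x | 3 * R ≤ ‖a - x‖}, ‖T (hb.toLp b) x‖ₑ
      ≤ ∫⁻ x in {x | 3 * R ≤ ‖a - x‖}, ENNReal.ofReal (C * R ^ δ * I) *
          ENNReal.ofReal (1 / ‖a - x‖ ^ ((d : ℝ) + δ)) := by
        refine lintegral_mono_ae ?_
        rw [ae_restrict_iff' hm]
        filter_upwards [hpt] with x hx h3
        rw [← ENNReal.ofReal_mul (by positivity), ← ofReal_norm]
        refine ENNReal.ofReal_le_ofReal ((hx h3).trans_eq ?_)
        ring
    _ = ENNReal.ofReal (C * R ^ δ * I) *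
          ∫⁻ x in {x | 3 * R ≤ ‖a - x‖}, ENNReal.ofReal (1 / ‖a - x‖ ^ ((d : ℝ) + δ)) :=
        lintegral_const_mul' _ _ ENNReal.ofReal_ne_top
    _ ≤ ENNReal.ofReal (C * R ^ δ * I) *
          ENNReal.ofReal (2 ^ d / (1 - 2 ^ (-δ)) * (unitBallVol d).toReal / (3 * R) ^ δ) := by
        gcongr
        refine lintegral_tail_le volume hδ a (by positivity) ENNReal.toReal_nonneg fun r hr => ?_
        have hr0 : 0 ≤ r := by linarith
        rw [volume_closedBall_eq _ hr0, mul_comm (unitBallVol d).toReal,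
          ENNReal.ofReal_mul (by positivity), ENNReal.ofReal_toReal unitBallVol_ne_top]
        rfl
    _ ≤ ENNReal.ofReal (C * (2 ^ d / (1 - 2 ^ (-δ)) * (unitBallVol d).toReal)) *
          ENNReal.ofReal I := by
        rw [← ENNReal.ofReal_mul (by positivity), ← ENNReal.ofReal_mul (by positivity)]
        refine ENNReal.ofReal_le_ofReal ?_
        have h1 : R ^ δ / (3 * R) ^ δ ≤ 1 := by
          rw [div_le_one (by positivity)]
          exact Real.rpow_le_rpow hR.le (by linarith) hδ.le
        calc _ = C * (2 ^ d / (1 - 2 ^ (-δ)) * (unitBallVol d).toReal) * I *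
              (R ^ δ / (3 * R) ^ δ) := by ring
          _ ≤ C * (2 ^ d / (1 - 2 ^ (-δ)) * (unitBallVol d).toReal) * I * 1 := by
              gcongr
          _ = _ := mul_one _
    _ = _ := by rw [hI, ofReal_integral_norm_eq_lintegral_enorm hbi]

theorem enorm_setAverage_mul_le {f : Rd d → ℂ} {s : Set (Rd d)} (h0 : volume s ≠ 0)
    (ht : volume s ≠ ⊤) : ‖⨍ x in s, f x‖ₑ * volume s ≤ ∫⁻ x in s, ‖f x‖ₑ := by
  rw [setAverage_eq, enorm_smul, measureReal_def, ← ENNReal.toReal_inv,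
    Real.enorm_of_nonneg ENNReal.toReal_nonneg, ENNReal.ofReal_toReal (by simpa using h0),
    mul_right_comm, ENNReal.inv_mul_cancel h0 ht, one_mul]
  exact enorm_integral_le_lintegral_enorm _

end WeakType

section WeakType
variable {d : ℕ}

/-- The cubes and the bad parts of the Calderón–Zygmund decomposition. -/
noncomputable def badPart (t : Fin d → ℤˣ) (f : Rd d → ℂ) (P : CubeLabel d) : Rd d → ℂ :=
  (gridCube t P).indicator fun x => f x - ⨍ y in gridCube t P, f y

variable (t : Fin d → ℤˣ)

theorem memLp_badPart {f : Rd d → ℂ} {p : ENNReal} (hf : MemLp f p volume) (P : CubeLabel d) :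
    MemLp (badPart t f P) p volume := by
  have h1 := hf.indicator (measurableSet_gridCube t P)
  have h2 := memLp_indicator_const p (measurableSet_gridCube t P) (⨍ y in gridCube t P, f y)
    (Or.inr (volume_gridCube_ne_top t P))
  have h3 : badPart t f P = (gridCube t P).indicator f -
      (gridCube t P).indicator fun _ => ⨍ y in gridCube t P, f y := by
    funext x
    by_cases hx : x ∈ gridCube t P <;> simp [badPart, hx]
  rw [h3]
  exact h1.sub h2

theorem integral_badPart (f : Rd d → ℂ) (P : CubeLabel d) : ∫ x, badPart t f P x = 0 := by
  have : IsFiniteMeasure (volume.restrict (gridCube t P)) :=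
    isFiniteMeasure_restrict.2 (volume_gridCube_ne_top t P)
  rw [badPart, integral_indicator (measurableSet_gridCube t P)]
  exact integral_sub_average _ f

theorem lintegral_badPart_le (f : Rd d → ℂ) (P : CubeLabel d) :
    ∫⁻ x, ‖badPart t f P x‖ₑ ≤ 2 * ∫⁻ x in gridCube t P, ‖f x‖ₑ := by
  have h : ∀ x, ‖badPart t f P x‖ₑ = (gridCube t P).indicator
      (fun x => ‖f x - ⨍ y in gridCube t P, f y‖ₑ) x := fun x => by
    rw [badPart, enorm_indicator_eq_indicator_enorm]
  simp_rw [h]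
  rw [lintegral_indicator (measurableSet_gridCube t P), two_mul]
  calc ∫⁻ x in gridCube t P, ‖f x - ⨍ y in gridCube t P, f y‖ₑ
      ≤ ∫⁻ x in gridCube t P, (‖f x‖ₑ + ‖⨍ y in gridCube t P, f y‖ₑ) :=
        lintegral_mono fun x => enorm_sub_le
    _ = (∫⁻ x in gridCube t P, ‖f x‖ₑ) +
          ‖⨍ y in gridCube t P, f y‖ₑ * volume (gridCube t P) := by
        rw [lintegral_add_right _ measurable_const, setLIntegral_const]
    _ ≤ _ := by
        gcongr
        exact enorm_setAverage_mul_le (volume_gridCube_ne_zero t P) (volume_gridCube_ne_top t P)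

theorem sum_badPart_apply_of_mem {f : Rd d → ℂ} {O : Set (Rd d)} (F : Finset (stopCubes t O))
    (P : stopCubes t O) {x : Rd d} (hx : x ∈ gridCube t P) :
    ∑ Q ∈ F, badPart t f Q x = by classical exact if P ∈ F then badPart t f P x else 0 := by
  classical
  have h : ∀ Q ∈ F, badPart t f Q x = if Q = P then badPart t f P x else 0 := by
    intro Q _
    by_cases hQ : Q = P
    · simp [hQ]
    · rw [if_neg hQ, badPart, Set.indicator_of_notMem]
      exact fun hxQ => hQ (Subtype.ext (eq_of_mem_stopCubes t Q.2 P.2 hxQ hx))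
  rw [Finset.sum_congr rfl h, Finset.sum_ite_eq']

/-- A stopping cube contains a point outside `O`, where the maximal function is at most `A`, and the
ball of radius `d 2^k` about this point contains the cube. -/
theorem setLIntegral_enorm_le_of_mem_stopCubes (hd : 0 < d) {f : Rd d → ℂ} {A : ℝ} (hA : 0 ≤ A)
    {O : Set (Rd d)} (hO : maximalSet (massMeasure f) A ⊆ O) {P : CubeLabel d}
    (hP : P ∈ stopCubes t O) :
    ∫⁻ x in gridCube t P, ‖f x‖ₑ ≤ ENNReal.ofReal A * d ^ d * volume (gridCube t P) := by
  have hex : ∃ x ∈ gridCube t P, x ∉ O := by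
    by_contra! h
    have h1 := two_mul_volume_inter_le_of_mem_stopCubes t hP
    rw [Set.inter_eq_left.2 h] at h1
    have h2 : volume (gridCube t P) < 2 * volume (gridCube t P) := by
      conv_lhs => rw [← one_mul (volume _)]
      exact ENNReal.mul_lt_mul_left (volume_gridCube_ne_zero t _) (volume_gridCube_ne_top t _)
        (by norm_num)
    exact absurd h1 (not_le.2 h2)
  obtain ⟨x, hx, hxO⟩ := hex
  have hr : (0 : ℝ) < d * 2 ^ P.1 := by have := two_zpow_pos P.1; positivity
  have h1 := lintegral_closedBall_le_of_notMem (fun h => hxO (hO h)) hr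
  calc ∫⁻ x in gridCube t P, ‖f x‖ₑ ≤ ∫⁻ y in Metric.closedBall x (d * 2 ^ P.1), ‖f y‖ₑ := by
        refine lintegral_mono_set fun y hy => ?_
        rw [Metric.mem_closedBall, dist_eq_norm]
        exact norm_sub_le_of_mem t hy hx
    _ ≤ _ := h1
    _ = _ := by
        rw [volume_gridCube, mul_pow, cubeVol, ENNReal.ofReal_mul hA,
          ENNReal.ofReal_mul (by positivity), ENNReal.ofReal_pow (by positivity),
          ENNReal.ofReal_natCast, mul_assoc]

/-- Only finitely many bad parts are subtracted. The remainder is bounded by a multiple of `A` off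
the stopping cubes and is an average of `f` on the cubes of `F`; on the other cubes it is still `f`,
which accounts for the last sum. -/
theorem lintegral_good_sq_le (hd : 0 < d) {f : Rd d → ℂ} (hf : Integrable f volume) {A : ℝ}
    (hA : 0 ≤ A) {O : Set (Rd d)} (hOo : IsOpen O) (hOf : volume O ≠ ⊤)
    (hO : maximalSet (massMeasure f) A ⊆ O) (F : Finset (stopCubes t O)) :
    ∫⁻ x, ‖f x - ∑ P ∈ F, badPart t f P x‖ₑ ^ 2 ≤
      ENNReal.ofReal A * ((unitBallVol d)⁻¹ + d ^ d) * (∫⁻ x, ‖f x‖ₑ) +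
        ∑' P : {P // P ∉ F}, ∫⁻ x in gridCube t (P : stopCubes t O), ‖f x‖ₑ ^ 2 := by
  classical
  set U := ⋃ P : stopCubes t O, gridCube t P with hU
  have hUm : MeasurableSet U := MeasurableSet.iUnion fun P => measurableSet_gridCube t _
  have hOU : O ⊆ U := fun x hx => by
    obtain ⟨P, hP, hxP⟩ := exists_mem_stopCubes t hd hOo hOf hx
    exact Set.mem_iUnion.2 ⟨⟨P, hP⟩, hxP⟩
  set g : Rd d → ℂ := fun x => f x - ∑ P ∈ F, badPart t f P x
  have h1 : ∫⁻ x in Uᶜ, ‖g x‖ₑ ^ 2 ≤ ENNReal.ofReal A * (unitBallVol d)⁻¹ * ∫⁻ x, ‖f x‖ₑ := by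
    calc ∫⁻ x in Uᶜ, ‖g x‖ₑ ^ 2
        ≤ ∫⁻ x in Uᶜ, ENNReal.ofReal A * (unitBallVol d)⁻¹ * ‖f x‖ₑ := by
          refine lintegral_mono_ae ?_
          rw [ae_restrict_iff' hUm.compl]
          filter_upwards [ae_enorm_le_of_notMem_maximalSet hf hA] with x hx hxU
          have hg : g x = f x := by
            simp only [g, sub_eq_self]
            refine Finset.sum_eq_zero fun P _ => ?_
            rw [badPart, Set.indicator_of_notMem]
            exact fun h => hxU (Set.mem_iUnion.2 ⟨P, h⟩)
          rw [hg, sq]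
          gcongr
          exact hx fun h => hxU (hOU (hO h))
      _ ≤ _ := by
          rw [lintegral_const_mul' _ _
            (ENNReal.mul_ne_top ENNReal.ofReal_ne_top (by simpa using unitBallVol_ne_zero))]
          gcongr
          exact Measure.restrict_le_self
  have h2 : ∀ P : stopCubes t O, ∫⁻ x in gridCube t P, ‖g x‖ₑ ^ 2 ≤
      ENNReal.ofReal A * d ^ d * (∫⁻ x in gridCube t P, ‖f x‖ₑ) +
        if P ∉ F then ∫⁻ x in gridCube t P, ‖f x‖ₑ ^ 2 else 0 := by
    intro P
    have hm := measurableSet_gridCube t (P : CubeLabel d)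
    by_cases hPF : P ∈ F
    · simp only [hPF, not_true_eq_false, if_false, add_zero]
      set a := ⨍ y in gridCube t (P : CubeLabel d), f y
      have hga : ∀ x ∈ gridCube t (P : CubeLabel d), g x = a := fun x hx => by
        simp only [g]
        rw [sum_badPart_apply_of_mem t F P hx, if_pos hPF, badPart, Set.indicator_of_mem hx]
        ring
      have hav := enorm_setAverage_mul_le (f := f) (volume_gridCube_ne_zero t (P : CubeLabel d))
        (volume_gridCube_ne_top t P)
      have hA' : ‖a‖ₑ ≤ ENNReal.ofReal A * d ^ d := by
        have := hav.trans (setLIntegral_enorm_le_of_mem_stopCubes t hd hA hO P.2)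
        exact (ENNReal.mul_le_mul_iff_left (volume_gridCube_ne_zero t _)
          (volume_gridCube_ne_top t _)).1 this
      calc ∫⁻ x in gridCube t P, ‖g x‖ₑ ^ 2 = ∫⁻ x in gridCube t P, ‖a‖ₑ ^ 2 :=
            setLIntegral_congr_fun hm fun x hx => by simp only [hga x hx]
        _ = ‖a‖ₑ * (‖a‖ₑ * volume (gridCube t (P : CubeLabel d))) := by
            rw [setLIntegral_const, sq, mul_assoc]
        _ ≤ _ := by gcongr
    · simp only [hPF, not_false_eq_true, if_true]
      refine le_add_left (le_of_eq (setLIntegral_congr_fun hm fun x hx => ?_))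
      simp only [g]
      rw [sum_badPart_apply_of_mem t F P hx, if_neg hPF, sub_zero]
  have h3 : ∫⁻ x in U, ‖g x‖ₑ ^ 2 ≤ ENNReal.ofReal A * d ^ d * (∫⁻ x, ‖f x‖ₑ) +
        ∑' P : {P // P ∉ F}, ∫⁻ x in gridCube t (P : stopCubes t O), ‖f x‖ₑ ^ 2 := by
    refine (lintegral_iUnion_le _ _).trans ((ENNReal.tsum_le_tsum h2).trans ?_)
    rw [ENNReal.tsum_add, ENNReal.tsum_mul_left]
    gcongr
    · have := tsum_measure_gridCube_inter_le t (massMeasure f) (pairwiseDisjoint_stopCubes t O)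
        MeasurableSet.univ
      simp only [Set.inter_univ] at this
      rw [massMeasure_apply f MeasurableSet.univ, setLIntegral_univ] at this
      refine le_of_eq_of_le (tsum_congr fun P => ?_) this
      rw [massMeasure_apply f (measurableSet_gridCube t _)]
    · refine le_of_eq ?_
      refine Eq.trans ?_ (tsum_subtype {P : stopCubes t O | P ∉ F}
        fun P => ∫⁻ x in gridCube t P, ‖f x‖ₑ ^ 2).symm
      refine tsum_congr fun P => ?_
      simp [Set.indicator_apply]
  rw [← lintegral_add_compl _ hUm, add_comm]
  calc _ ≤ _ := add_le_add h1 h3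
    _ = _ := by ring

end WeakType

section WeakType
variable {d : ℕ}
  {T : Lp ℂ 2 (volume : Measure (Rd d)) →L[ℂ] Lp ℂ 2 (volume : Measure (Rd d))}

/-- Outer regularity needs a strict inequality. The summand `+ 1` provides it when the mass of `f`
is nonzero. -/
theorem exists_isOpen_maximalSet_subset (hd : 0 < d) {f : Rd d → ℂ} (hf : Integrable f volume)
    (hf0 : ∫⁻ x, ‖f x‖ₑ ≠ 0) {A : ℝ} (hA : 0 < A) :
    ∃ O : Set (Rd d), IsOpen O ∧ maximalSet (massMeasure f) A ⊆ O ∧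
      volume O ≤ (5 ^ d * unitBallVol d + 1) * (∫⁻ x, ‖f x‖ₑ) / ENNReal.ofReal A ∧
      volume O ≠ ⊤ := by
  have h1 := volume_maximalSet_massMeasure_le hd hf hA
  have hA' : ENNReal.ofReal A ≠ 0 := by simpa using hA
  have hI := hf.2.ne
  have hu := unitBallVol_ne_top (d := d)
  have h2 : volume (maximalSet (massMeasure f) A) <
      (5 ^ d * unitBallVol d + 1) * (∫⁻ x, ‖f x‖ₑ) / ENNReal.ofReal A := by
    refine h1.trans_lt ?_
    refine ENNReal.div_lt_div_right hA' ENNReal.ofReal_ne_top ?_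
    rw [add_mul, one_mul]
    refine ENNReal.lt_add_right (ENNReal.mul_ne_top (by finiteness) hI) hf0
  obtain ⟨O, hO, hOo, hlt⟩ := Set.exists_isOpen_lt_of_lt _ _ h2
  exact ⟨O, hOo, hO, hlt.le, hlt.ne_top⟩

theorem measure_le_of_lintegral_sq_le (g : Lp ℂ 2 (volume : Measure (Rd d))) {a : ENNReal}
    (ha : a ≠ 0) (hat : a ≠ ⊤) :
    volume {x | a ≤ ‖T g x‖ₑ} ≤ a⁻¹ ^ 2 * (‖T‖ₑ ^ 2 * ∫⁻ x, ‖g x‖ₑ ^ 2) := by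
  have h1 := meas_ge_le_mul_pow_eLpNorm_enorm (p := 2) (volume : Measure (Rd d)) (by norm_num)
    (by norm_num) (Lp.aestronglyMeasurable (T g)) ha (fun h => absurd h hat)
  have h2 : ‖T g‖ₑ ≤ ‖T‖ₑ * ‖g‖ₑ := by
    rw [← ofReal_norm, ← ofReal_norm, ← ofReal_norm, ← ENNReal.ofReal_mul (norm_nonneg _)]
    exact ENNReal.ofReal_le_ofReal (T.le_opNorm g)
  rw [Lp.enorm_def, Lp.enorm_def] at h2
  have h3 : eLpNorm g 2 volume ^ 2 = ∫⁻ x, ‖g x‖ₑ ^ 2 := by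
    have := eLpNorm_nnreal_pow_eq_lintegral (f := g) (μ := (volume : Measure (Rd d)))
      (p := 2) (by norm_num)
    simpa using this
  refine h1.trans ?_
  simp only [ENNReal.toReal_ofNat, ENNReal.rpow_ofNat]
  gcongr
  rw [← h3, ← mul_pow]
  gcongr

set_option maxHeartbeats 1000000 in
/-- The Calderón–Zygmund theorem: weak type `(1, 1)`. -/
theorem IsCZO.exists_weakType (hd : 0 < d) (hT : IsCZO T) :
    ∃ W : NNReal, ∀ (f : Rd d → ℂ) (hf : MemLp f 2 volume), Integrable f volume →
      ∀ A : ℝ, 0 < A → volume {x | ENNReal.ofReal A ≤ ‖T (hf.toLp f) x‖ₑ} ≤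
        W * (∫⁻ x, ‖f x‖ₑ) / ENNReal.ofReal A := by
  classical
  obtain ⟨K, hK, hrep⟩ := hT
  obtain ⟨C, δ, hC, hδ, -, hreg⟩ := hK.exists_nonneg
  set ω := unitBallVol d
  have hωt : ω ≠ ⊤ := unitBallVol_ne_top
  have hω0 : ω ≠ 0 := unitBallVol_ne_zero
  set C₁ : ENNReal := ENNReal.ofReal (C * (2 ^ d / (1 - 2 ^ (-δ)) * ω.toReal))
  set t : Fin d → ℤˣ := 1
  -- The three terms account for the neighbourhood `N` of the stopping cubes, for the bad parts off
  -- `N`, and for the good part in `L²`.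
  set W : ENNReal := ω * (3 * d) ^ d * 2 ^ (d + 1) * (5 ^ d * ω + 1) + 4 * C₁ +
    4 * ‖T‖ₑ ^ 2 * (ω⁻¹ + d ^ d) with hW
  have hWt : W ≠ ⊤ := by
    have : ω⁻¹ ≠ ⊤ := by simpa using hω0
    have : ‖T‖ₑ ≠ ⊤ := enorm_ne_top
    finiteness
  refine ⟨W.toNNReal, fun f hf hfi A hA => ?_⟩
  rw [ENNReal.coe_toNNReal hWt]
  set a := ENNReal.ofReal A with ha
  have ha0 : a ≠ 0 := by simpa [ha] using hA
  have hat : a ≠ ⊤ := ENNReal.ofReal_ne_top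
  set I := ∫⁻ x, ‖f x‖ₑ with hI
  by_cases hI0 : I = 0
  · have hf0 : f =ᵐ[volume] 0 := by
      have := (lintegral_eq_zero_iff' hfi.1.enorm).1 hI0
      filter_upwards [this] with x hx
      simpa using hx
    have h1 : hf.toLp f = 0 := (MemLp.toLp_eq_toLp_iff hf (MemLp.zero)).2 hf0
    have h2 : volume {x | a ≤ ‖T (hf.toLp f) x‖ₑ} = 0 := by
      rw [h1, map_zero]
      have := Lp.coeFn_zero ℂ 2 (volume : Measure (Rd d))
      rw [← compl_mem_ae_iff]
      filter_upwards [this] with x hx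
      simp only [Set.mem_compl_iff, Set.mem_ofPred_eq, hx]
      simpa using ha0
    rw [h2]; exact zero_le
  obtain ⟨O, hOo, hmax, hOle, hOt⟩ := exists_isOpen_maximalSet_subset hd hfi hI0 hA
  set 𝒬 := stopCubes t O
  set far : 𝒬 → Set (Rd d) := fun P =>
    {x | 3 * (d * (2 : ℝ) ^ (P : CubeLabel d).1) ≤ ‖cubeCorner t (P : CubeLabel d) - x‖} with hfar
  have hfarm : ∀ P, MeasurableSet (far P) := fun P =>
    measurableSet_le measurable_const (by fun_prop)
  set N := ⋃ P, (far P)ᶜ with hN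
  have hNm : MeasurableSet N := MeasurableSet.iUnion fun P => (hfarm P).compl
  have hNle : volume N ≤ ω * (3 * d) ^ d * 2 ^ (d + 1) * (5 ^ d * ω + 1) * I / a := by
    calc volume N ≤ ∑' P, volume (far P)ᶜ := measure_iUnion_le _
      _ ≤ ∑' P : 𝒬, ω * (3 * d) ^ d * volume (gridCube t P) := by
          refine ENNReal.tsum_le_tsum fun P => ?_
          have hp := two_zpow_pos (P : CubeLabel d).1
          calc volume (far P)ᶜ ≤ volume (Metric.closedBall (cubeCorner t (P : CubeLabel d))
                (3 * d * 2 ^ (P : CubeLabel d).1)) := by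
                refine measure_mono fun x hx => ?_
                rw [Metric.mem_closedBall, dist_comm, dist_eq_norm]
                simp only [hfar, Set.mem_compl_iff, Set.mem_ofPred_eq, not_le] at hx
                linarith
            _ = _ := by
                rw [volume_closedBall_eq _ (by positivity), volume_gridCube, cubeVol, mul_pow,
                  ENNReal.ofReal_mul (by positivity), ENNReal.ofReal_pow (by positivity),
                  ENNReal.ofReal_mul (by positivity)]
                simp only [ENNReal.ofReal_natCast, ENNReal.ofReal_ofNat]
                rw [mul_comm, ← mul_assoc]
                rfl
      _ = ω * (3 * d) ^ d * ∑' P : 𝒬, volume (gridCube t P) := ENNReal.tsum_mul_left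
      _ ≤ ω * (3 * d) ^ d * (2 ^ (d + 1) * ((5 ^ d * ω + 1) * I / a)) := by
          gcongr
          refine (tsum_volume_stopCubes_le t hOo.measurableSet).trans ?_
          gcongr
      _ = _ := by simp only [div_eq_mul_inv]; ring
  set L2 : 𝒬 → ENNReal := fun P => ∫⁻ x in gridCube t P, ‖f x‖ₑ ^ 2
  have hsumI : ∑' P : 𝒬, ∫⁻ x in gridCube t P, ‖f x‖ₑ ≤ I := by
    have := tsum_measure_gridCube_inter_le t (massMeasure f) (pairwiseDisjoint_stopCubes t O)
      MeasurableSet.univ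
    simp only [Set.inter_univ] at this
    rw [massMeasure_apply f MeasurableSet.univ, setLIntegral_univ] at this
    refine le_of_eq_of_le (tsum_congr fun P => ?_) this
    rw [massMeasure_apply f (measurableSet_gridCube t _)]
  have hL2 : ∑' P, L2 P ≠ ⊤ := by
    have h1 : ∑' P, L2 P ≤ ∫⁻ x, ‖f x‖ₑ ^ 2 := by
      have := tsum_measure_gridCube_inter_le t (volume.withDensity fun x => ‖f x‖ₑ ^ 2)
        (pairwiseDisjoint_stopCubes t O) MeasurableSet.univ
      simp only [Set.inter_univ] at this
      rw [withDensity_apply _ MeasurableSet.univ, setLIntegral_univ] at this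
      refine le_of_eq_of_le (tsum_congr fun P => ?_) this
      rw [withDensity_apply _ (measurableSet_gridCube t _)]
    have h2 : ∫⁻ x, ‖f x‖ₑ ^ 2 < ⊤ := by
      have := eLpNorm_nnreal_pow_eq_lintegral (f := f) (μ := (volume : Measure (Rd d)))
        (p := 2) (by norm_num)
      have h3 : eLpNorm f 2 volume ^ 2 = ∫⁻ x, ‖f x‖ₑ ^ 2 := by simpa using this
      rw [← h3]
      exact ENNReal.pow_lt_top hf.2
    exact (h1.trans_lt h2).ne
  -- With finite `F` only finite additivity of `T` is used. The cubes outside `F` remain in the good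
  -- part at the cost of an `L²` tail, which vanishes in the limit over `F`.
  have hmain : ∀ F : Finset 𝒬, volume {x | a ≤ ‖T (hf.toLp f) x‖ₑ} ≤
      W * I / a + 4 * ‖T‖ₑ ^ 2 / a ^ 2 * ∑' P : {P // P ∉ F}, L2 P := by
    intro F
    set β : 𝒬 → Lp ℂ 2 (volume : Measure (Rd d)) := fun P => (memLp_badPart t hf P).toLp _ with hβ
    set γ := hf.toLp f - ∑ P ∈ F, β P with hγ
    have hγae : γ =ᵐ[volume] fun x => f x - ∑ P ∈ F, badPart t f P x := by
      have h1 := Lp.coeFn_sub (hf.toLp f) (∑ P ∈ F, β P)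
      have h2 := Lp.coeFn_finsetSum F β
      have h3 : ∀ᵐ x, ∀ P : 𝒬, β P x = badPart t f P x :=
        ae_all_iff.2 fun P => (memLp_badPart t hf P).coeFn_toLp
      filter_upwards [h1, h2, h3, hf.coeFn_toLp] with x h1 h2 h3 h4
      rw [hγ, h1, Pi.sub_apply, h4, h2, Finset.sum_apply]
      simp only [h3]
    have hγsq : ∫⁻ x, ‖γ x‖ₑ ^ 2 ≤ a * (ω⁻¹ + d ^ d) * I + ∑' P : {P // P ∉ F}, L2 P := by
      refine le_trans (le_of_eq (lintegral_congr_ae ?_))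
        (lintegral_good_sq_le t hd hfi hA.le hOo hOt hmax F)
      filter_upwards [hγae] with x hx
      simp only [hx]
      rfl
    have hTf : ∀ᵐ x, T (hf.toLp f) x = T γ x + ∑ P ∈ F, T (β P) x := by
      have h0 : T (hf.toLp f) = T γ + ∑ P ∈ F, T (β P) := by
        rw [hγ, map_sub, map_sum]; abel
      have h1 := Lp.coeFn_add (T γ) (∑ P ∈ F, T (β P))
      have h2 := Lp.coeFn_finsetSum F fun P => T (β P)
      filter_upwards [h1, h2] with x h1 h2
      rw [h0, h1, Pi.add_apply, h2, Finset.sum_apply]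
    have hbad : (a / 2) * volume ({x | a / 2 ≤ ∑ P ∈ F, ‖T (β P) x‖ₑ} ∩ Nᶜ) ≤ 2 * C₁ * I := by
      have hmeas : AEMeasurable (fun x => ∑ P ∈ F, ‖T (β P) x‖ₑ) (volume.restrict Nᶜ) :=
        Finset.aemeasurable_fun_sum F fun P _ =>
          (Lp.aestronglyMeasurable (T (β P))).enorm.restrict
      have h1 := mul_meas_ge_le_lintegral₀ hmeas (a / 2)
      rw [Measure.restrict_apply' hNm.compl] at h1
      refine h1.trans ?_
      rw [lintegral_finsetSum' F fun P _ => (Lp.aestronglyMeasurable (T (β P))).enorm.restrict]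
      calc ∑ P ∈ F, ∫⁻ x in Nᶜ, ‖T (β P) x‖ₑ
          ≤ ∑ P ∈ F, C₁ * (2 * ∫⁻ x in gridCube t P, ‖f x‖ₑ) := by
            refine Finset.sum_le_sum fun P _ => ?_
            have hp := two_zpow_pos (P : CubeLabel d).1
            calc ∫⁻ x in Nᶜ, ‖T (β P) x‖ₑ ≤ ∫⁻ x in far P, ‖T (β P) x‖ₑ := by
                  refine lintegral_mono_set fun x hx => ?_
                  by_contra h
                  exact hx (Set.mem_iUnion.2 ⟨P, h⟩)
              _ ≤ C₁ * ∫⁻ x, ‖badPart t f P x‖ₑ := by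
                  refine lintegral_operator_cancel_le hC hδ
                    (fun x x' y h1 h2 => (hreg x x' y h1 h2).2) hrep (memLp_badPart t hf P)
                    (memLp_one_iff_integrable.1 (memLp_badPart t
                      (memLp_one_iff_integrable.2 hfi) P)) (by positivity) (fun y hy => ?_)
                    (integral_badPart t f P)
                  have hyP : y ∈ gridCube t (P : CubeLabel d) := by
                    by_contra h
                    exact hy (Set.indicator_of_notMem h _)
                  exact norm_sub_le_of_mem t hyP (cubeCorner_mem t _)
              _ ≤ _ := by
                  gcongr
                  exact lintegral_badPart_le t f P
        _ = 2 * C₁ * ∑ P ∈ F, ∫⁻ x in gridCube t P, ‖f x‖ₑ := by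
            rw [Finset.mul_sum]
            exact Finset.sum_congr rfl fun _ _ => by ring
        _ ≤ 2 * C₁ * I := by
            gcongr
            exact (ENNReal.sum_le_tsum F).trans hsumI
    have ha2 : a / 2 ≠ 0 := by simpa using ha0
    have ha2t : a / 2 ≠ ⊤ := ENNReal.div_ne_top hat (by norm_num)
    have hbad' : volume ({x | a / 2 ≤ ∑ P ∈ F, ‖T (β P) x‖ₑ} ∩ Nᶜ) ≤ 4 * C₁ * I / a := by
      have h1 := (ENNReal.le_div_iff_mul_le (Or.inl ha2) (Or.inl ha2t)).2 (mul_comm _ (a / 2) ▸ hbad)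
      refine h1.trans_eq ?_
      rw [div_eq_mul_inv, div_eq_mul_inv, div_eq_mul_inv, ENNReal.mul_inv (Or.inr (by simp))
        (Or.inr (by simp)), inv_inv]
      ring
    have hgood := measure_le_of_lintegral_sq_le (T := T) γ ha2 ha2t
    have hcover : volume {x | a ≤ ‖T (hf.toLp f) x‖ₑ} ≤ volume N +
        (volume ({x | a / 2 ≤ ∑ P ∈ F, ‖T (β P) x‖ₑ} ∩ Nᶜ) +
          volume {x | a / 2 ≤ ‖T γ x‖ₑ}) := by
      refine le_trans (measure_mono_ae ?_) ((measure_union_le _ _).trans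
        (add_le_add le_rfl (measure_union_le _ _)))
      filter_upwards [hTf] with x hx hax
      by_cases hxN : x ∈ N
      · exact Or.inl hxN
      right
      by_contra hcon
      simp only [Set.mem_union, Set.mem_inter_iff, Set.mem_ofPred_eq, not_or, not_and,
        Set.mem_compl_iff, not_le] at hcon
      have h1 : ∑ P ∈ F, ‖T (β P) x‖ₑ < a / 2 := by
        by_contra! h
        exact hcon.1 h hxN
      have h2 : ‖T (hf.toLp f) x‖ₑ < a := by
        rw [hx]
        calc _ ≤ ‖T γ x‖ₑ + ‖∑ P ∈ F, T (β P) x‖ₑ := enorm_add_le _ _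
          _ ≤ ‖T γ x‖ₑ + ∑ P ∈ F, ‖T (β P) x‖ₑ := by gcongr; exact enorm_sum_le _ _
          _ < a / 2 + a / 2 := ENNReal.add_lt_add hcon.2 h1
          _ = a := ENNReal.add_halves a
      exact absurd hax (not_le.2 h2)
    refine hcover.trans ?_
    have hinv : (a / 2)⁻¹ ^ 2 = 4 / a ^ 2 := by
      rw [ENNReal.inv_div (by simp) (by simp), div_eq_mul_inv, mul_pow, div_eq_mul_inv,
        ENNReal.inv_pow]
      norm_num
    have hcancel : a / a ^ 2 = 1 / a := by
      rw [sq, div_eq_mul_inv, ENNReal.mul_inv (Or.inl ha0) (Or.inl hat), ← mul_assoc,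
        ENNReal.mul_inv_cancel ha0 hat, one_mul, one_div]
    calc _ ≤ ω * (3 * d) ^ d * 2 ^ (d + 1) * (5 ^ d * ω + 1) * I / a + (4 * C₁ * I / a +
          4 / a ^ 2 * (‖T‖ₑ ^ 2 * (a * (ω⁻¹ + d ^ d) * I + ∑' P : {P // P ∉ F}, L2 P))) := by
          rw [hinv] at hgood
          refine add_le_add hNle (add_le_add hbad' (hgood.trans ?_))
          gcongr
      _ = ω * (3 * d) ^ d * 2 ^ (d + 1) * (5 ^ d * ω + 1) * I / a + (4 * C₁ * I / a +
          (4 * ‖T‖ₑ ^ 2 * (ω⁻¹ + d ^ d) * I * (a / a ^ 2) +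
            4 * ‖T‖ₑ ^ 2 / a ^ 2 * ∑' P : {P // P ∉ F}, L2 P)) := by
          simp only [div_eq_mul_inv]; ring
      _ = _ := by
          rw [hcancel, hW]
          simp only [div_eq_mul_inv]; ring
  have hlim := ENNReal.tendsto_tsum_compl_atTop_zero hL2
  have hlim2 : Tendsto (fun F : Finset 𝒬 => W * I / a + 4 * ‖T‖ₑ ^ 2 / a ^ 2 *
      ∑' P : {P // P ∉ F}, L2 P) atTop (𝓝 (W * I / a + 4 * ‖T‖ₑ ^ 2 / a ^ 2 * 0)) := by
    refine tendsto_const_nhds.add (ENNReal.Tendsto.const_mul hlim (Or.inr ?_))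
    refine ENNReal.div_ne_top ?_ (by simpa using ha0)
    have : ‖T‖ₑ ≠ ⊤ := enorm_ne_top
    finiteness
  rw [mul_zero, add_zero] at hlim2
  exact ge_of_tendsto' hlim2 hmain

end WeakType

/-! ### Extension of the operator to `L¹`. -/

section Extension
variable {d : ℕ}
  {T : Lp ℂ 2 (volume : Measure (Rd d)) →L[ℂ] Lp ℂ 2 (volume : Measure (Rd d))}

/-- Weak type `(1, 1)` with constant `W` on `L¹ ∩ L²`. -/
def HasWeakType (T : Lp ℂ 2 (volume : Measure (Rd d)) →L[ℂ] Lp ℂ 2 (volume : Measure (Rd d)))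
    (W : NNReal) : Prop :=
  ∀ (f : Rd d → ℂ) (hf : MemLp f 2 volume), Integrable f volume →
      ∀ A : ℝ, 0 < A → volume {x | ENNReal.ofReal A ≤ ‖T (hf.toLp f) x‖ₑ} ≤
        W * (∫⁻ x, ‖f x‖ₑ) / ENNReal.ofReal A

theorem operator_sub_ae {u v : Rd d → ℂ} (hu : MemLp u 2 volume) (hv : MemLp v 2 volume) :
    ∀ᵐ x, T ((hu.sub hv).toLp (u - v)) x = T (hu.toLp u) x - T (hv.toLp v) x := by
  rw [MemLp.toLp_sub, map_sub]
  exact Lp.coeFn_sub _ _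

theorem HasWeakType.sub_le {W : NNReal} (hW : HasWeakType T W) {u v : Rd d → ℂ}
    (hu : MemLp u 2 volume) (hv : MemLp v 2 volume) (hui : Integrable u volume)
    (hvi : Integrable v volume) {A : ℝ} (hA : 0 < A) :
    volume {x | ENNReal.ofReal A ≤ ‖T (hu.toLp u) x - T (hv.toLp v) x‖ₑ} ≤
      W * (∫⁻ x, ‖u x - v x‖ₑ) / ENNReal.ofReal A := by
  refine le_of_eq_of_le (measure_congr ?_) (hW (u - v) (hu.sub hv) (hui.sub hvi) A hA)
  filter_upwards [operator_sub_ae (T := T) hu hv] with x hx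
  change (_ ≤ _) = (_ ≤ _)
  rw [hx]

/-- Bounded truncations with bounded support. -/
noncomputable def truncation {f : Rd d → ℂ} (hf : AEStronglyMeasurable f volume) (n : ℕ) :
    Rd d → ℂ :=
  ({x | ‖hf.mk f x‖ ≤ n} ∩ Metric.closedBall 0 n).indicator f

theorem measurableSet_truncation {f : Rd d → ℂ} (hf : AEStronglyMeasurable f volume) (n : ℕ) :
    MeasurableSet ({x | ‖hf.mk f x‖ ≤ n} ∩ Metric.closedBall 0 n) :=
  (measurableSet_le hf.stronglyMeasurable_mk.norm.measurable measurable_const).inter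
    measurableSet_closedBall

theorem memLp_truncation {f : Rd d → ℂ} (hf : AEStronglyMeasurable f volume) (n : ℕ)
    (p : ENNReal) : MemLp (truncation hf n) p volume := by
  have hm := measurableSet_truncation hf n
  have hfin : IsFiniteMeasure (volume.restrict
      ({x | ‖hf.mk f x‖ ≤ n} ∩ Metric.closedBall (0 : Rd d) n)) :=
    isFiniteMeasure_restrict.2 ((measure_mono Set.inter_subset_right).trans_lt
      measure_closedBall_lt_top).ne
  rw [truncation, memLp_indicator_iff_restrict hm]
  refine MemLp.of_bound hf.restrict n ?_
  rw [ae_restrict_iff' hm]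
  filter_upwards [hf.ae_eq_mk] with x hx hxs
  rw [hx]; exact hxs.1

theorem enorm_truncation_le {f : Rd d → ℂ} (hf : AEStronglyMeasurable f volume) (n : ℕ)
    (x : Rd d) : ‖truncation hf n x‖ₑ ≤ ‖f x‖ₑ :=
  enorm_indicator_le_enorm_self _ _

theorem eventually_truncation_eq {f : Rd d → ℂ} (hf : AEStronglyMeasurable f volume) (x : Rd d) :
    ∀ᶠ n in atTop, truncation hf n x = f x := by
  obtain ⟨m, hm⟩ := exists_nat_ge (max ‖hf.mk f x‖ ‖x‖)
  filter_upwards [eventually_ge_atTop m] with n hn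
  have hn' : (m : ℝ) ≤ n := by exact_mod_cast hn
  rw [truncation, Set.indicator_of_mem]
  refine ⟨((le_max_left _ _).trans hm).trans hn', ?_⟩
  rw [Metric.mem_closedBall, dist_zero_right]
  exact ((le_max_right _ _).trans hm).trans hn'

theorem tendsto_lintegral_truncation {f : Rd d → ℂ} (hf : Integrable f volume) :
    Tendsto (fun n => ∫⁻ x, ‖truncation hf.1 n x - f x‖ₑ) atTop (𝓝 0) := by
  have h := tendsto_lintegral_of_dominated_convergence' (μ := (volume : Measure (Rd d)))
    (F := fun n x => ‖truncation hf.1 n x - f x‖ₑ) (f := fun _ => 0) (fun x => 2 * ‖f x‖ₑ)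
    (fun n => ((memLp_truncation hf.1 n 1).1.sub hf.1).enorm) (fun n => ?_) ?_ ?_
  · simpa using h
  · refine Eventually.of_forall fun x => ?_
    calc _ ≤ ‖truncation hf.1 n x‖ₑ + ‖f x‖ₑ := enorm_sub_le
      _ ≤ ‖f x‖ₑ + ‖f x‖ₑ := by gcongr; exact enorm_truncation_le hf.1 n x
      _ = _ := (two_mul _).symm
  · rw [lintegral_const_mul' _ _ (by norm_num)]
    exact ENNReal.mul_ne_top (by norm_num) hf.2.ne
  · refine Eventually.of_forall fun x => ?_
    refine tendsto_const_nhds.congr' ?_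
    filter_upwards [eventually_truncation_eq hf.1 x] with n hn
    simp [hn]

theorem lintegral_enorm_sub_triangle {f g h : Rd d → ℂ} (hf : AEStronglyMeasurable f volume)
    (hg : AEStronglyMeasurable g volume) :
    ∫⁻ x, ‖f x - h x‖ₑ ≤ (∫⁻ x, ‖f x - g x‖ₑ) + ∫⁻ x, ‖g x - h x‖ₑ := by
  have hm : AEMeasurable (fun x => ‖f x - g x‖ₑ) volume := (hf.sub hg).enorm
  rw [← lintegral_add_left' hm]
  refine lintegral_mono fun x => ?_
  rw [← sub_add_sub_cancel (f x) (g x) (h x)]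
  exact enorm_add_le _ _

/-- The weak type bound that characterizes the values of the extension of `T` to `L¹`. -/
def IsWeakLimit (T : Lp ℂ 2 (volume : Measure (Rd d)) →L[ℂ] Lp ℂ 2 (volume : Measure (Rd d)))
    (W : NNReal) (f g : Rd d → ℂ) : Prop :=
  AEStronglyMeasurable g volume ∧ ∀ (u : Rd d → ℂ) (hu : MemLp u 2 volume),
    Integrable u volume → ∀ A : ℝ, 0 < A →
      volume {x | ENNReal.ofReal A ≤ ‖T (hu.toLp u) x - g x‖ₑ} ≤
        W * (∫⁻ x, ‖u x - f x‖ₑ) / ENNReal.ofReal (A / 2)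

/-- Where `|Tu - g| ≥ A`, almost everywhere `|Tu - Tv_k| ≥ A / 2` for all large `k`. These sets
increase to the relevant one, and the weak type bound holds for each. Halving `A` makes the
inequality strict, so that it passes to large `k`. -/
theorem HasWeakType.isWeakLimit_of_tendsto {W : NNReal} (hW : HasWeakType T W) {f g : Rd d → ℂ}
    (hf : Integrable f volume) {v : ℕ → Rd d → ℂ} (hv : ∀ n, MemLp (v n) 2 volume)
    (hvi : ∀ n, Integrable (v n) volume)
    (hvf : Tendsto (fun n => ∫⁻ x, ‖v n x - f x‖ₑ) atTop (𝓝 0))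
    (hg : ∀ᵐ x, Tendsto (fun n => T ((hv n).toLp (v n)) x) atTop (𝓝 (g x))) :
    IsWeakLimit T W f g := by
  refine ⟨aestronglyMeasurable_of_tendsto_ae atTop
    (fun n => Lp.aestronglyMeasurable _) hg, fun u hu hui A hA => ?_⟩
  have hA2 : 0 < A / 2 := by positivity
  set s : ℕ → Set (Rd d) := fun k =>
    {x | ENNReal.ofReal (A / 2) ≤ ‖T (hu.toLp u) x - T ((hv k).toLp (v k)) x‖ₑ} with hs
  set B : ℕ → Set (Rd d) := fun N => ⋂ k ≥ N, s k
  have hBmono : Monotone B := fun M N hMN => Set.subset_iInter₂ fun k hk =>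
    Set.iInter₂_subset k (le_trans hMN hk)
  have h1 : volume {x | ENNReal.ofReal A ≤ ‖T (hu.toLp u) x - g x‖ₑ} ≤ volume (⋃ N, B N) := by
    refine measure_mono_ae ?_
    filter_upwards [hg] with x hx hxA
    have hlim : Tendsto (fun n => ‖T (hu.toLp u) x - T ((hv n).toLp (v n)) x‖ₑ) atTop
        (𝓝 ‖T (hu.toLp u) x - g x‖ₑ) := (tendsto_const_nhds.sub hx).enorm
    have hlt : ENNReal.ofReal (A / 2) < ‖T (hu.toLp u) x - g x‖ₑ :=
      ((ENNReal.ofReal_lt_ofReal_iff hA).2 (by linarith)).trans_le hxA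
    obtain ⟨N, hN⟩ := eventually_atTop.1 (hlim.eventually_const_lt hlt)
    exact Set.mem_iUnion.2 ⟨N, Set.mem_iInter₂.2 fun k hk => (hN k hk).le⟩
  refine h1.trans ?_
  rw [hBmono.measure_iUnion]
  refine iSup_le fun N => ?_
  have hlim : Tendsto (fun k => W * ((∫⁻ x, ‖u x - f x‖ₑ) + ∫⁻ x, ‖v k x - f x‖ₑ) /
      ENNReal.ofReal (A / 2)) atTop
      (𝓝 (W * ((∫⁻ x, ‖u x - f x‖ₑ) + 0) / ENNReal.ofReal (A / 2))) := by
    refine ENNReal.Tendsto.div_const (ENNReal.Tendsto.const_mul (tendsto_const_nhds.add hvf)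
      (Or.inr ENNReal.coe_ne_top)) (Or.inr ?_)
    simpa using hA2
  rw [add_zero] at hlim
  refine ge_of_tendsto hlim ?_
  filter_upwards [eventually_ge_atTop N] with k hk
  refine (measure_mono (Set.iInter₂_subset k hk)).trans
    ((hW.sub_le hu (hv k) hui (hvi k) hA2).trans ?_)
  gcongr
  refine (lintegral_enorm_sub_triangle hui.1 hf.1).trans_eq ?_
  congr 1
  exact lintegral_congr fun x => enorm_sub_rev _ _

theorem HasWeakType.exists_isWeakLimit {W : NNReal} (hW : HasWeakType T W) {f : Rd d → ℂ}
    (hf : Integrable f volume) : ∃ g, IsWeakLimit T W f g := by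
  have htr := tendsto_lintegral_truncation hf
  -- With errors `8^(-n)` and levels `2^(-n)`, the exceptional sets have measure of order `4^(-n)`.
  -- By Borel–Cantelli the increments are eventually below `2^(-n)` almost everywhere.
  have hex : ∀ n : ℕ, ∃ N, ∫⁻ x, ‖truncation hf.1 N x - f x‖ₑ ≤ ENNReal.ofReal ((1 / 8) ^ n) := by
    intro n
    have hpos : 0 < ENNReal.ofReal ((1 / 8) ^ n) := by simp
    exact (htr.eventually_le_const hpos).exists
  choose N hN using hex
  set v : ℕ → Rd d → ℂ := fun n => truncation hf.1 (N n)
  have hv : ∀ n, MemLp (v n) 2 volume := fun n => memLp_truncation hf.1 _ 2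
  have hvi : ∀ n, Integrable (v n) volume := fun n =>
    memLp_one_iff_integrable.1 (memLp_truncation hf.1 _ 1)
  set s : ℕ → Set (Rd d) := fun n => {x | ENNReal.ofReal ((1 / 2) ^ n) ≤
    ‖T ((hv n).toLp (v n)) x - T ((hv (n + 1)).toLp (v (n + 1))) x‖ₑ} with hs
  have hsle : ∀ n, volume (s n) ≤ W * ENNReal.ofReal (2 * (1 / 4) ^ n) := by
    intro n
    have hp : (0 : ℝ) < (1 / 2) ^ n := by positivity
    refine (hW.sub_le (hv n) (hv (n + 1)) (hvi n) (hvi (n + 1)) hp).trans ?_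
    have h1 : ∫⁻ x, ‖v n x - v (n + 1) x‖ₑ ≤ ENNReal.ofReal (2 * (1 / 8) ^ n) := by
      refine (lintegral_enorm_sub_triangle (hvi n).1 hf.1).trans ?_
      have h2 : ∫⁻ x, ‖f x - v (n + 1) x‖ₑ ≤ ENNReal.ofReal ((1 / 8) ^ n) := by
        simp_rw [enorm_sub_rev (f _)]
        refine (hN (n + 1)).trans (ENNReal.ofReal_le_ofReal ?_)
        exact pow_le_pow_of_le_one (by norm_num) (by norm_num) (Nat.le_succ n)
      rw [two_mul, ENNReal.ofReal_add (by positivity) (by positivity)]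
      exact add_le_add (hN n) h2
    calc _ ≤ W * ENNReal.ofReal (2 * (1 / 8) ^ n) / ENNReal.ofReal ((1 / 2) ^ n) := by gcongr
      _ = _ := by
        rw [mul_div_assoc, ← ENNReal.ofReal_div_of_pos hp, mul_div_assoc, ← div_pow]
        norm_num
  have hsum : ∑' n, volume (s n) ≠ ⊤ := by
    refine ne_top_of_le_ne_top ?_ (ENNReal.tsum_le_tsum hsle)
    rw [ENNReal.tsum_mul_left, ← ENNReal.ofReal_tsum_of_nonneg (fun n => by positivity)
      ((summable_geometric_of_lt_one (by norm_num) (by norm_num)).mul_left 2)]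
    finiteness
  have hcauchy : ∀ᵐ x, ∃ y, Tendsto (fun n => T ((hv n).toLp (v n)) x) atTop (𝓝 y) := by
    filter_upwards [ae_eventually_notMem hsum] with x hx
    refine cauchySeq_tendsto_of_complete (cauchySeq_of_summable_dist ?_)
    have hge : Summable fun n : ℕ => ((1 : ℝ) / 2) ^ n :=
      summable_geometric_of_lt_one (by norm_num) (by norm_num)
    refine hge.of_norm_bounded_eventually_nat ?_
    filter_upwards [hx] with n hn
    simp only [hs, Set.mem_ofPred_eq, not_le] at hn
    rw [Real.norm_of_nonneg dist_nonneg, dist_eq_norm]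
    rw [← ofReal_norm] at hn
    exact (ENNReal.ofReal_lt_ofReal_iff (by positivity)).1 hn |>.le
  classical
  refine ⟨fun x => if h : ∃ y, Tendsto (fun n => T ((hv n).toLp (v n)) x) atTop (𝓝 y)
    then h.choose else 0, hW.isWeakLimit_of_tendsto hf hv hvi ?_ ?_⟩
  · refine tendsto_of_tendsto_of_tendsto_of_le_of_le tendsto_const_nhds ?_
      (fun n => zero_le) hN
    rw [← ENNReal.ofReal_zero]
    exact ENNReal.tendsto_ofReal (tendsto_pow_atTop_nhds_zero_of_lt_one (by norm_num) (by norm_num))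
  · filter_upwards [hcauchy] with x hx
    simp only [hx, dif_pos]
    exact hx.choose_spec

theorem IsWeakLimit.tendstoInMeasure {W : NNReal} {f g : Rd d → ℂ} (h : IsWeakLimit T W f g)
    {u : ℕ → Rd d → ℂ} (hu : ∀ n, MemLp (u n) 2 volume) (hui : ∀ n, Integrable (u n) volume)
    (huf : Tendsto (fun n => ∫⁻ x, ‖u n x - f x‖ₑ) atTop (𝓝 0)) :
    TendstoInMeasure volume (fun n x => T ((hu n).toLp (u n)) x) atTop g := by
  rw [tendstoInMeasure_iff_enorm]
  intro ε hε hεt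
  have hε' : 0 < ε.toReal := ENNReal.toReal_pos hε.ne' hεt
  have hlim : Tendsto (fun n => W * (∫⁻ x, ‖u n x - f x‖ₑ) / ENNReal.ofReal (ε.toReal / 2)) atTop
      (𝓝 (W * 0 / ENNReal.ofReal (ε.toReal / 2))) := by
    refine ENNReal.Tendsto.div_const (ENNReal.Tendsto.const_mul huf
      (Or.inr ENNReal.coe_ne_top)) (Or.inr ?_)
    simpa using hε'
  rw [mul_zero, ENNReal.zero_div] at hlim
  refine tendsto_of_tendsto_of_tendsto_of_le_of_le tendsto_const_nhds hlim
    (fun n => zero_le) fun n => ?_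
  have := h.2 (u n) (hu n) (hui n) ε.toReal hε'
  rwa [ENNReal.ofReal_toReal hεt] at this

theorem IsWeakLimit.isL1Value {W : NNReal} {f g : Rd d → ℂ} (h : IsWeakLimit T W f g) :
    IsL1Value T f g := by
  refine ⟨h.1, fun u hu hui huf => h.tendstoInMeasure hu hui ?_⟩
  simpa only [eLpNorm_one_eq_lintegral_enorm, Pi.sub_apply] using huf

theorem IsL1Value.ae_eq {f g h : Rd d → ℂ} (hf : Integrable f volume) (hg : IsL1Value T f g)
    (hh : IsL1Value T f h) : g =ᵐ[volume] h := by
  have h0 : Tendsto (fun n => eLpNorm (truncation hf.1 n - f) 1 volume) atTop (𝓝 0) := by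
    simpa only [eLpNorm_one_eq_lintegral_enorm, Pi.sub_apply] using tendsto_lintegral_truncation hf
  have h1 := fun n => memLp_truncation hf.1 n 2
  have h2 := fun n => memLp_one_iff_integrable.1 (memLp_truncation hf.1 n 1)
  exact tendstoInMeasure_ae_unique (hg.2 _ h1 h2 h0) (hh.2 _ h1 h2 h0)

end Extension

/-! ### The properties of the extended operator on which the domination rests. -/

/-- An operator `S` on `L¹(ℝ^d; 𝕜)` of weak type `(1, 1)` that is given by the kernel `K` on open
sets on which the function vanishes; only the regularity of `K` in its first variable is kept. -/
structure IsWeakCZ {d : ℕ} {𝕜 : Type*} [RCLike 𝕜] (S : (Rd d → 𝕜) → Rd d → 𝕜)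
    (K : Rd d → Rd d → 𝕜) (C δ : ℝ) (W : NNReal) : Prop where
  nonneg : 0 ≤ C
  pos : 0 < δ
  aestronglyMeasurable : ∀ f, Integrable f volume → AEStronglyMeasurable (S f) volume
  map_add : ∀ f g, Integrable f volume → Integrable g volume → S (f + g) =ᵐ[volume] S f + S g
  map_smul : ∀ (c : 𝕜) f, Integrable f volume → S (c • f) =ᵐ[volume] c • S f
  weakType : ∀ f, Integrable f volume → ∀ A : ℝ, 0 < A →
    volume {x | ENNReal.ofReal A ≤ ‖S f x‖ₑ} ≤ W * (∫⁻ x, ‖f x‖ₑ) / ENNReal.ofReal A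
  rep : ∀ f, Integrable f volume → ∀ U, IsOpen U → (∀ x ∈ U, f x = 0) →
    ∀ᵐ x, x ∈ U → S f x = ∫ y, K x y * f y
  measurable : Measurable (Function.uncurry K)
  size : ∀ x y, x ≠ y → ‖K x y‖ ≤ C / ‖x - y‖ ^ d
  reg : ∀ x x' y, x ≠ y → 2 * ‖x - x'‖ ≤ ‖x - y‖ →
    ‖K x y - K x' y‖ ≤ C * ‖x - x'‖ ^ δ / ‖x - y‖ ^ ((d : ℝ) + δ)

section Extension
variable {d : ℕ}
  {T : Lp ℂ 2 (volume : Measure (Rd d)) →L[ℂ] Lp ℂ 2 (volume : Measure (Rd d))}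

/-- A kernel is not assumed measurable; regularity in both variables gives joint continuity off the
diagonal, and hence measurability once the diagonal is set to `0`. -/
theorem continuousOn_kernel {K : Rd d → Rd d → ℂ} {C δ : ℝ} (hδ : 0 < δ)
    (hreg : ∀ x x' y, x ≠ y → 2 * ‖x - x'‖ ≤ ‖x - y‖ →
        ‖K x y - K x' y‖ ≤ C * ‖x - x'‖ ^ δ / ‖x - y‖ ^ ((d : ℝ) + δ) ∧
        ‖K y x - K y x'‖ ≤ C * ‖x - x'‖ ^ δ / ‖x - y‖ ^ ((d : ℝ) + δ)) :
    ContinuousOn (Function.uncurry K) {p | p.1 ≠ p.2} := by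
  rintro ⟨x, y⟩ hxy
  replace hxy : x ≠ y := hxy
  refine ContinuousAt.continuousWithinAt ?_
  have hxy' : 0 < ‖x - y‖ := norm_pos_iff.2 (sub_ne_zero.2 hxy)
  have hx : Tendsto (fun p : Rd d × Rd d => ‖x - p.1‖) (𝓝 (x, y)) (𝓝 0) := by
    have : Continuous fun p : Rd d × Rd d => ‖x - p.1‖ := by fun_prop
    simpa using this.tendsto (x, y)
  have hy : Tendsto (fun p : Rd d × Rd d => ‖y - p.2‖) (𝓝 (x, y)) (𝓝 0) := by
    have : Continuous fun p : Rd d × Rd d => ‖y - p.2‖ := by fun_prop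
    simpa using this.tendsto (x, y)
  have hyx : Tendsto (fun p : Rd d × Rd d => ‖y - p.1‖) (𝓝 (x, y)) (𝓝 ‖y - x‖) := by
    have : Continuous fun p : Rd d × Rd d => ‖y - p.1‖ := by fun_prop
    exact this.tendsto (x, y)
  have hpow : ∀ {g : Rd d × Rd d → ℝ}, Tendsto g (𝓝 (x, y)) (𝓝 0) →
      Tendsto (fun p => g p ^ δ) (𝓝 (x, y)) (𝓝 0) := fun {g} hg => by
    simpa [Real.zero_rpow hδ.ne'] using hg.rpow_const (Or.inr hδ.le)
  have hlim : Tendsto (fun p : Rd d × Rd d => C * ‖x - p.1‖ ^ δ / ‖x - y‖ ^ ((d : ℝ) + δ) +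
      C * ‖y - p.2‖ ^ δ / ‖y - p.1‖ ^ ((d : ℝ) + δ)) (𝓝 (x, y)) (𝓝 0) := by
    have h1 := ((hpow hx).const_mul C).div_const (‖x - y‖ ^ ((d : ℝ) + δ))
    have h2 := ((hpow hy).const_mul C).div (hyx.rpow_const (p := (d : ℝ) + δ)
      (Or.inr (by positivity))) (by rw [norm_sub_rev]; positivity)
    simpa using h1.add h2
  rw [ContinuousAt, tendsto_iff_norm_sub_tendsto_zero]
  refine squeeze_zero' (Eventually.of_forall fun _ => norm_nonneg _) ?_ hlim
  filter_upwards [hx.eventually_lt_const (show 0 < ‖x - y‖ / 4 by positivity),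
    hy.eventually_lt_const (show 0 < ‖x - y‖ / 4 by positivity)] with p hp1 hp2
  have h3 : ‖x - y‖ ≤ ‖x - p.1‖ + ‖y - p.1‖ := by
    rw [norm_sub_rev y]; exact norm_sub_le_norm_sub_add_norm_sub x p.1 y
  have hne : y ≠ p.1 := by
    rintro h; rw [← h] at hp1; linarith
  have e1 := (hreg x p.1 y hxy (by linarith)).1
  have e2 := (hreg y p.2 p.1 hne (by linarith)).2
  simp only [Function.uncurry]
  calc ‖K p.1 p.2 - K x y‖ ≤ ‖K p.1 p.2 - K p.1 y‖ + ‖K p.1 y - K x y‖ :=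
        norm_sub_le_norm_sub_add_norm_sub _ _ _
    _ ≤ _ := by
        rw [norm_sub_rev (K p.1 p.2), norm_sub_rev (K p.1 y) (K x y), add_comm]
        exact add_le_add e1 e2

/-- The kernel with the values on the diagonal set to `0`. -/
noncomputable def offDiag (K : Rd d → Rd d → ℂ) (x y : Rd d) : ℂ := by
  classical exact if x = y then 0 else K x y

theorem measurable_offDiag {K : Rd d → Rd d → ℂ}
    (hK : ContinuousOn (Function.uncurry K) {p | p.1 ≠ p.2}) :
    Measurable (Function.uncurry (offDiag K)) := by
  classical
  have ho : IsOpen {p : Rd d × Rd d | p.1 ≠ p.2} :=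
    isOpen_ne_fun continuous_fst continuous_snd
  have h := hK.measurable_piecewise (g := fun _ => 0) continuous_const.continuousOn ho.measurableSet
  convert h using 1
  funext p
  by_cases hp : p.1 = p.2 <;> simp [Function.uncurry, offDiag, Set.piecewise, hp]

open Classical in
/-- The extension of `T` to `L¹`. -/
noncomputable def extendL1
    (T : Lp ℂ 2 (volume : Measure (Rd d)) →L[ℂ] Lp ℂ 2 (volume : Measure (Rd d)))
    (W : NNReal) (f : Rd d → ℂ) : Rd d → ℂ :=
  if h : ∃ g, IsWeakLimit T W f g then h.choose else 0

theorem HasWeakType.isWeakLimit_extendL1 {W : NNReal} (hW : HasWeakType T W) {f : Rd d → ℂ}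
    (hf : Integrable f volume) : IsWeakLimit T W f (extendL1 T W f) := by
  have h := hW.exists_isWeakLimit hf
  rw [extendL1, dif_pos h]
  exact h.choose_spec

theorem operator_zero_ae (h0 : MemLp (0 : Rd d → ℂ) 2 volume) :
    ∀ᵐ x, T (h0.toLp 0) x = 0 := by
  have : h0.toLp 0 = 0 := MemLp.toLp_zero h0
  rw [this, map_zero]
  exact Lp.coeFn_zero _ _ _

/-- Convergence in measure gives convergence almost everywhere only along subsequences. Three nested
extractions produce a common one, along which linearity of `T` passes to the limit. -/
theorem IsWeakLimit.add_smul {W : NNReal} {f f' g g' g'' : Rd d → ℂ}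
    (hf : Integrable f volume) (hf' : Integrable f' volume) (c : ℂ) (hg : IsWeakLimit T W f g)
    (hg' : IsWeakLimit T W f' g') (hg'' : IsWeakLimit T W (f + c • f') g'') :
    g'' =ᵐ[volume] g + c • g' := by
  have hu := fun n => memLp_truncation hf.1 n 2
  have hu' := fun n => memLp_truncation hf'.1 n 2
  have hui := fun n => memLp_one_iff_integrable.1 (memLp_truncation hf.1 n 1)
  have hui' := fun n => memLp_one_iff_integrable.1 (memLp_truncation hf'.1 n 1)
  have l1 := tendsto_lintegral_truncation hf
  have l2 := tendsto_lintegral_truncation hf'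
  have l3 : Tendsto (fun n => ∫⁻ x, ‖(truncation hf.1 n + c • truncation hf'.1 n) x -
      (f + c • f') x‖ₑ) atTop (𝓝 0) := by
    have h := l1.add (ENNReal.Tendsto.const_mul l2 (Or.inr (enorm_ne_top (x := c))))
    rw [mul_zero, add_zero] at h
    refine tendsto_of_tendsto_of_tendsto_of_le_of_le tendsto_const_nhds h
      (fun n => zero_le) fun n => ?_
    have hm : AEMeasurable (fun x => ‖truncation hf.1 n x - f x‖ₑ) volume :=
      ((hui n).1.sub hf.1).enorm
    simp only
    rw [← lintegral_const_mul' _ _ enorm_ne_top, ← lintegral_add_left' hm]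
    refine lintegral_mono fun x => ?_
    simp only [Pi.add_apply, Pi.smul_apply, smul_eq_mul]
    rw [← enorm_mul, mul_sub, add_sub_add_comm]
    exact enorm_add_le _ _
  obtain ⟨n1, hn1, t1⟩ := (hg.tendstoInMeasure hu hui l1).exists_seq_tendsto_ae
  obtain ⟨n2, hn2, t2⟩ := ((hg'.tendstoInMeasure hu' hui' l2).comp
    hn1.tendsto_atTop).exists_seq_tendsto_ae
  obtain ⟨n3, hn3, t3⟩ := (((hg''.tendstoInMeasure (fun n => (hu n).add ((hu' n).const_smul c))
    (fun n => (hui n).add ((hui' n).smul c)) l3).comp hn1.tendsto_atTop).comp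
    hn2.tendsto_atTop).exists_seq_tendsto_ae
  have hlin : ∀ n, ∀ᵐ x, T (((hu n).add ((hu' n).const_smul c)).toLp
      (truncation hf.1 n + c • truncation hf'.1 n)) x =
      T ((hu n).toLp _) x + c * T ((hu' n).toLp _) x := by
    intro n
    rw [MemLp.toLp_add (hu n) ((hu' n).const_smul c), MemLp.toLp_const_smul c (hu' n), T.map_add,
      T.map_smul]
    filter_upwards [Lp.coeFn_add (T ((hu n).toLp _)) (c • T ((hu' n).toLp _)),
      Lp.coeFn_smul c (T ((hu' n).toLp _))] with x h1 h2
    rw [h1, Pi.add_apply, h2]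
    simp
  filter_upwards [t1, t2, t3, ae_all_iff.2 hlin] with x t1 t2 t3 hlin
  have t1' := t1.comp (hn2.comp hn3).tendsto_atTop
  have t2' := t2.comp hn3.tendsto_atTop
  refine tendsto_nhds_unique t3 ?_
  refine (t1'.add (t2'.const_mul c)).congr fun i => ?_
  exact (hlin (n1 (n2 (n3 i)))).symm

/-- The truncations of `f` vanish on `U` too, so the representation holds for them there. A point of
`U` has positive distance from the set where `f ≠ 0`, so the kernel is bounded on it and dominated
convergence applies. -/
theorem IsWeakLimit.rep {K : Rd d → Rd d → ℂ} {C : ℝ} (hC : 0 ≤ C)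
    (hsize : ∀ x y, x ≠ y → ‖K x y‖ ≤ C / ‖x - y‖ ^ d)
    (hmeas : Measurable (Function.uncurry (offDiag K)))
    (hrep : ∀ (f : Rd d → ℂ) (hf : MemLp f 2 volume), HasCompactSupport f →
      ∀ᵐ x, x ∉ tsupport f → T (hf.toLp f) x = ∫ y, K x y * f y)
    {W : NNReal} {f g : Rd d → ℂ} (hf : Integrable f volume) (hg : IsWeakLimit T W f g)
    {U : Set (Rd d)} (hU : IsOpen U) (hfU : ∀ x ∈ U, f x = 0) :
    ∀ᵐ x, x ∈ U → g x = ∫ y, offDiag K x y * f y := by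
  have hu := fun n => memLp_truncation hf.1 n 2
  have hui := fun n => memLp_one_iff_integrable.1 (memLp_truncation hf.1 n 1)
  have hu0 : ∀ n x, f x = 0 → truncation hf.1 n x = 0 := fun n x hx => by
    simp [truncation, hx]
  have hcs : ∀ n, HasCompactSupport (truncation hf.1 n) := fun n => by
    refine HasCompactSupport.intro (isCompact_closedBall (0 : Rd d) n) fun x hx => ?_
    exact Set.indicator_of_notMem (fun h => hx h.2) _
  have hts : ∀ n, ∀ x ∈ U, x ∉ tsupport (truncation hf.1 n) := fun n x hx h => by
    have h1 : tsupport (truncation hf.1 n) ⊆ Uᶜ := by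
      refine closure_minimal (fun y hy hyU => hy ?_) hU.isClosed_compl
      exact hu0 n y (hfU y hyU)
    exact h1 h hx
  obtain ⟨n1, hn1, t1⟩ := (hg.tendstoInMeasure hu hui
    (tendsto_lintegral_truncation hf)).exists_seq_tendsto_ae
  filter_upwards [t1, ae_all_iff.2 fun n => hrep _ (hu n) (hcs n)] with x t1 hx hxU
  refine tendsto_nhds_unique t1 ?_
  obtain ⟨ε, hε, hball⟩ := Metric.isOpen_iff.1 hU x hxU
  have hfar : ∀ y, f y ≠ 0 → ε ≤ ‖x - y‖ := fun y hy => by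
    by_contra! h
    refine hy (hfU y (hball ?_))
    rwa [Metric.mem_ball, dist_comm, dist_eq_norm]
  have hKm : Measurable (offDiag K x) := hmeas.comp measurable_prodMk_left
  have heq : ∀ n, T ((hu (n1 n)).toLp _) x = ∫ y, offDiag K x y * truncation hf.1 (n1 n) y := by
    intro n
    rw [hx (n1 n) (hts _ x hxU)]
    refine integral_congr_ae (Eventually.of_forall fun y => ?_)
    by_cases hy : x = y
    · subst hy
      simp [hu0 (n1 n) x (hfU x hxU)]
    · simp [offDiag, hy]
  simp_rw [heq]
  refine tendsto_integral_of_dominated_convergence (fun y => C / ε ^ d * ‖f y‖)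
    (fun n => hKm.aestronglyMeasurable.mul (hui _).1) (hf.norm.const_mul _) (fun n => ?_) ?_
  · refine Eventually.of_forall fun y => ?_
    by_cases hy : f y = 0
    · simp [hu0 _ y hy, hy]
    · have hfy := hfar y hy
      have hxy : x ≠ y := by rintro rfl; exact hy (hfU x hxU)
      have h1 : ‖offDiag K x y‖ ≤ C / ε ^ d := by
        rw [offDiag, if_neg hxy]
        refine (hsize x y hxy).trans ?_
        gcongr
      have h2 : ‖truncation hf.1 (n1 n) y‖ ≤ ‖f y‖ := norm_indicator_le_norm_self _ _
      rw [norm_mul]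
      exact mul_le_mul h1 h2 (norm_nonneg _) (by positivity)
  · refine Eventually.of_forall fun y => Tendsto.const_mul _ ?_
    refine tendsto_const_nhds.congr' ?_
    filter_upwards [hn1.tendsto_atTop.eventually (eventually_truncation_eq hf.1 y)] with n hn
      using hn.symm

theorem IsCZO.exists_isWeakCZ (hd : 0 < d) (hT : IsCZO T) :
    ∃ (S : (Rd d → ℂ) → Rd d → ℂ) (K : Rd d → Rd d → ℂ) (C δ : ℝ) (W : NNReal),
      IsWeakCZ S K C δ W ∧ (∀ f, Integrable f volume → IsL1Value T f (S f)) ∧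
      (IsRealOperator T → ∀ f, Integrable f volume → (∀ x, (f x).im = 0) →
        ∀ᵐ x, (S f x).im = 0) := by
  obtain ⟨W, hW⟩ := hT.exists_weakType hd
  replace hW : HasWeakType T W := hW
  obtain ⟨K, hK, hrep⟩ := hT
  obtain ⟨C, δ, hC, hδ, hsize, hreg⟩ := hK.exists_nonneg
  have hS : ∀ f : Rd d → ℂ, Integrable f volume → IsWeakLimit T W f (extendL1 T W f) :=
    fun f hf => hW.isWeakLimit_extendL1 hf
  have hmeas := measurable_offDiag (continuousOn_kernel hδ hreg)
  refine ⟨extendL1 T W, offDiag K, C, δ, 2 * W, ⟨hC, hδ, fun f hf => (hS f hf).1, ?_, ?_, ?_, ?_,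
    hmeas, ?_, ?_⟩, fun f hf => (hS f hf).isL1Value, ?_⟩
  · intro f g hf hg
    have := (hS f hf).add_smul hf hg 1 (hS g hg) (g'' := extendL1 T W (f + g))
      (by rw [one_smul]; exact hS _ (hf.add hg))
    rwa [one_smul] at this
  · intro c f hf
    have h0 : Integrable (0 : Rd d → ℂ) volume := integrable_zero _ _ _
    have hz : IsWeakLimit T W 0 0 := by
      refine ⟨aestronglyMeasurable_const, fun u hu hui A hA => ?_⟩
      simp only [Pi.zero_apply, sub_zero]
      refine (hW u hu hui A hA).trans ?_
      gcongr
      linarith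
    have := hz.add_smul h0 hf c (hS f hf) (g'' := extendL1 T W (c • f))
      (by rw [zero_add]; exact hS _ (hf.smul c))
    rwa [zero_add] at this
  · intro f hf A hA
    have h0 : MemLp (0 : Rd d → ℂ) 2 volume := MemLp.zero
    -- Comparing with `u = 0` yields the weak type bound; the level `A / 2` in `IsWeakLimit` is the
    -- source of the constant `2 * W`.
    have h := (hS f hf).2 0 h0 (integrable_zero _ _ _) A hA
    have e : volume {x | ENNReal.ofReal A ≤ ‖T (h0.toLp 0) x - extendL1 T W f x‖ₑ} =
        volume {x | ENNReal.ofReal A ≤ ‖extendL1 T W f x‖ₑ} := by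
      refine measure_congr ?_
      filter_upwards [operator_zero_ae (T := T) h0] with x hx
      change (_ ≤ _) = (_ ≤ _)
      rw [hx, zero_sub, enorm_neg]
    rw [e] at h
    simp only [Pi.zero_apply, zero_sub, enorm_neg] at h
    refine h.trans_eq ?_
    rw [ENNReal.ofReal_div_of_pos (by norm_num), ENNReal.ofReal_ofNat, div_eq_mul_inv,
      div_eq_mul_inv, div_eq_mul_inv, ENNReal.mul_inv (Or.inr (by simp)) (Or.inr (by simp)),
      inv_inv]
    push_cast
    ring
  · intro f hf U hU hfU
    exact (hS f hf).rep hC hsize hmeas hrep hf hU hfU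
  · intro x y hxy
    rw [offDiag, if_neg hxy]; exact hsize x y hxy
  · intro x x' y hxy h2
    have hxy' : x' ≠ y := by
      rintro rfl
      have : 0 < ‖x - x'‖ := norm_pos_iff.2 (sub_ne_zero.2 hxy)
      linarith
    rw [offDiag, if_neg hxy, offDiag, if_neg hxy']; exact (hreg x x' y hxy h2).1
  · intro hreal f hf hfim
    have hu := fun n => memLp_truncation hf.1 n 2
    have hui := fun n => memLp_one_iff_integrable.1 (memLp_truncation hf.1 n 1)
    obtain ⟨n1, -, t1⟩ := ((hS f hf).tendstoInMeasure hu hui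
      (tendsto_lintegral_truncation hf)).exists_seq_tendsto_ae
    have him : ∀ n, ∀ᵐ x, (T ((hu n).toLp _) x).im = 0 := fun n => by
      refine hreal _ ?_
      filter_upwards [(hu n).coeFn_toLp] with x hx
      rw [hx]
      by_cases hxs : x ∈ {x | ‖hf.1.mk f x‖ ≤ n} ∩ Metric.closedBall 0 n
      · rw [truncation, Set.indicator_of_mem hxs]; exact hfim x
      · rw [truncation, Set.indicator_of_notMem hxs]; rfl
    filter_upwards [t1, ae_all_iff.2 him] with x t1 him
    refine tendsto_nhds_unique ((Complex.continuous_im.tendsto _).comp t1) ?_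
    simp only [Function.comp_def, him]
    exact tendsto_const_nhds

/-- Provides an operator over the scalar field `ℝ`, to which the domination is applied when `T` is
real. -/
theorem IsWeakCZ.re {S : (Rd d → ℂ) → Rd d → ℂ} {K : Rd d → Rd d → ℂ} {C δ : ℝ} {W : NNReal}
    (h : IsWeakCZ S K C δ W) :
    IsWeakCZ (fun (f : Rd d → ℝ) x => (S (fun y => (f y : ℂ)) x).re) (fun x y => (K x y).re)
      C δ W := by
  have hn : ∀ z : ℂ, ‖z.re‖ ≤ ‖z‖ := fun z => Complex.abs_re_le_norm z
  have hofReal : ∀ f : Rd d → ℝ, Integrable f volume →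
    Integrable (fun x => (f x : ℂ)) volume := fun f hf => hf.ofReal
  refine ⟨h.nonneg, h.pos, fun f hf => ?_, fun f g hf hg => ?_, fun c f hf => ?_,
    fun f hf A hA => ?_, fun f hf U hU hfU => ?_, ?_, fun x y hxy => (hn _).trans (h.size x y hxy),
    fun x x' y hxy h2 => ?_⟩
  · exact Complex.continuous_re.comp_aestronglyMeasurable (h.aestronglyMeasurable _ (hofReal f hf))
  · have := h.map_add _ _ (hofReal f hf) (hofReal g hg)
    filter_upwards [this] with x hx
    have e : (fun y => (((f + g) y : ℝ) : ℂ)) = (fun y => (f y : ℂ)) + fun y => (g y : ℂ) := by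
      funext y; simp
    change (S (fun y => (((f + g) y : ℝ) : ℂ)) x).re = _
    rw [e, hx]
    rfl
  · have := h.map_smul (c : ℂ) _ (hofReal f hf)
    filter_upwards [this] with x hx
    have e : (fun y => (((c • f) y : ℝ) : ℂ)) = (c : ℂ) • fun y => (f y : ℂ) := by
      funext y; simp
    change (S (fun y => (((c • f) y : ℝ) : ℂ)) x).re = _
    rw [e, hx, Pi.smul_apply, smul_eq_mul, Complex.re_ofReal_mul]
    rfl
  · have := h.weakType _ (hofReal f hf) A hA
    refine (measure_mono fun x hx => ?_).trans (this.trans_eq ?_)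
    · simp only [Set.mem_ofPred_eq] at hx ⊢
      refine hx.trans ?_
      rw [← ofReal_norm, ← ofReal_norm]
      exact ENNReal.ofReal_le_ofReal (hn _)
    · congr 2
      refine lintegral_congr fun x => ?_
      simp [← ofReal_norm]
  · have := h.rep _ (hofReal f hf) U hU (fun x hx => by simp [hfU x hx])
    filter_upwards [this] with x hx hxU
    obtain ⟨ε, hε, hball⟩ := Metric.isOpen_iff.1 hU x hxU
    have hint : Integrable (fun y => K x y * (f y : ℂ)) volume := by
      refine ((hf.norm.const_mul (C / ε ^ d)).mono'
        ((h.measurable.comp measurable_prodMk_left).aestronglyMeasurable.mul (hofReal f hf).1)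
        (Eventually.of_forall fun y => ?_))
      by_cases hy : f y = 0
      · simp [hy]
      · have hxy : x ≠ y := by rintro rfl; exact hy (hfU x hxU)
        have hfy : ε ≤ ‖x - y‖ := by
          by_contra! hlt
          refine hy (hfU y (hball ?_))
          rwa [Metric.mem_ball, dist_comm, dist_eq_norm]
        have h1 : ‖K x y‖ ≤ C / ε ^ d := by
          refine (h.size x y hxy).trans ?_
          have := h.nonneg
          gcongr
        rw [norm_mul, Complex.norm_real]
        gcongr
    have hre := (Complex.reCLM.integral_comp_comm hint).symm
    simp only [Complex.reCLM_apply] at hre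
    refine (congrArg Complex.re (hx hxU)).trans (hre.trans ?_)
    refine integral_congr_ae (Eventually.of_forall fun y => ?_)
    simp
  · exact Complex.measurable_re.comp h.measurable
  · rw [← Complex.sub_re]
    exact (hn _).trans (h.reg x x' y hxy h2)

end Extension

/-! ### Nearly Auerbach bases. -/

section Auerbach

/-- Choose vectors of `s` whose determinant exceeds half the supremum in modulus. By Cramer's rule a
coordinate of `w` is a quotient of determinants, with numerator at most the supremum. Settling for
half the supremum avoids compactness of `s`. -/
theorem exists_auerbach_of_span_eq_top {𝕜 W : Type*} [RCLike 𝕜] [AddCommGroup W] [Module 𝕜 W]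
    {n : ℕ} (b : Module.Basis (Fin n) 𝕜 W) {s : Set W} (hs : Submodule.span 𝕜 s = ⊤)
    {R : ℝ} (hR : ∀ w ∈ s, ∀ i, ‖b.repr w i‖ ≤ R) :
    ∃ B : Module.Basis (Fin n) 𝕜 W, (∀ i, B i ∈ s) ∧ ∀ w ∈ s, ∀ i, ‖B.repr w i‖ ≤ 2 := by
  set D : Set ℝ := {r | ∃ v : Fin n → W, (∀ i, v i ∈ s) ∧ ‖b.det v‖ = r} with hD
  have hbdd : BddAbove D := by
    refine ⟨n.factorial • R ^ n, ?_⟩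
    rintro _ ⟨v, hv, rfl⟩
    rw [Module.Basis.det_apply]
    have := Matrix.det_le (A := b.toMatrix v) (abv := NormedField.toAbsoluteValue 𝕜) (x := R)
      (fun i j => hR (v j) (hv j) i)
    exact le_trans this (by simp)
  obtain ⟨u, hus, huspan, huli⟩ := exists_linearIndependent 𝕜 s
  rw [hs] at huspan
  let bu : Module.Basis u 𝕜 W := Module.Basis.mk huli (by rw [Subtype.range_coe, huspan])
  let e : u ≃ Fin n := bu.indexEquiv b
  have hpos : ∃ r ∈ D, 0 < r := by
    refine ⟨_, ⟨bu.reindex e, fun i => ?_, rfl⟩, ?_⟩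
    · simp only [Module.Basis.reindex_apply, bu, Module.Basis.mk_apply]
      exact hus (e.symm i).2
    · exact norm_pos_iff.2 (b.isUnit_det (bu.reindex e)).ne_zero
  obtain ⟨r, hrD, hr⟩ := hpos
  have hsup : 0 < sSup D := hr.trans_le (le_csSup hbdd hrD)
  obtain ⟨_, ⟨v, hv, rfl⟩, hlt⟩ := exists_lt_of_lt_csSup ⟨r, hrD⟩ (half_lt_self hsup)
  have hdet : b.det v ≠ 0 := norm_pos_iff.1 ((half_pos hsup).trans hlt)
  obtain ⟨hli, hsp⟩ := (Module.Basis.is_basis_iff_det b).2 hdet.isUnit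
  refine ⟨Module.Basis.mk hli hsp.ge, fun i => by simpa using hv i, fun w hw i => ?_⟩
  have h1 := congrArg (fun L => L w) (Module.Basis.det_smul_mk_coord_eq_det_update b hli hsp.ge i)
  simp only [LinearMap.smul_apply, smul_eq_mul, Module.Basis.coord_apply] at h1
  have h2 : ‖b.det (Function.update v i w)‖ ≤ sSup D := by
    refine le_csSup hbdd ⟨_, fun j => ?_, rfl⟩
    by_cases hj : j = i
    · subst hj; simpa using hw
    · simpa [hj] using hv j
  have h3 := congrArg norm h1
  rw [norm_mul] at h3
  have h4 : ‖b.det v‖ * ‖(Module.Basis.mk hli hsp.ge).repr w i‖ ≤ sSup D := h3.trans_le h2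
  have h5 : 0 < ‖b.det v‖ := norm_pos_iff.2 hdet
  by_contra! hcon
  nlinarith

/-- A bounded set is contained in twice the absolutely convex hull of few of its elements, with
coordinates given by linear functionals. -/
theorem exists_near_auerbach {𝕜 κ : Type*} [RCLike 𝕜] [Fintype κ] {s : Set (κ → 𝕜)} {R : ℝ}
    (hR : ∀ w ∈ s, ‖w‖ ≤ R) :
    ∃ (n : ℕ) (v : Fin n → κ → 𝕜) (c : Fin n → (κ → 𝕜) →ₗ[𝕜] 𝕜), n ≤ Fintype.card κ ∧
      (∀ i, v i ∈ s) ∧ (∀ i, ∀ w ∈ s, ‖c i w‖ ≤ 2) ∧ ∀ w ∈ s, w = ∑ i, c i w • v i := by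
  -- The set `s` need not span the whole space, so the basis is built in its span and the coordinate
  -- functionals are then extended.
  set V := Submodule.span 𝕜 s
  let b := Module.finBasis 𝕜 V
  set s' : Set V := (fun w : V => (w : κ → 𝕜)) ⁻¹' s
  have hs' : Submodule.span 𝕜 s' = ⊤ := Submodule.span_span_coe_preimage
  have hbound : ∃ M : ℝ, ∀ w ∈ s', ∀ i, ‖b.repr w i‖ ≤ M := by
    let L : V →L[𝕜] (Fin (Module.finrank 𝕜 V) → 𝕜) :=
      LinearMap.toContinuousLinearMap b.equivFun.toLinearMap
    refine ⟨‖L‖ * |R|, fun w hw i => ?_⟩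
    have h1 : ‖L w i‖ ≤ ‖L w‖ := norm_le_pi_norm _ i
    have h2 : ‖w‖ ≤ |R| := (hR _ hw).trans (le_abs_self R)
    calc ‖b.repr w i‖ = ‖L w i‖ := rfl
      _ ≤ ‖L‖ * ‖w‖ := h1.trans (L.le_opNorm w)
      _ ≤ _ := by gcongr
  obtain ⟨M, hM⟩ := hbound
  obtain ⟨B, hBs, hB⟩ := exists_auerbach_of_span_eq_top b hs' hM
  choose c hc using fun i => LinearMap.exists_extend (B.coord i)
  have hcw : ∀ (w : V) i, c i w = B.repr w i := fun w i => by
    have := congrArg (fun L => L w) (hc i)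
    simpa using this
  refine ⟨_, fun i => (B i : κ → 𝕜), c, ?_, hBs, fun i w hw => ?_, fun w hw => ?_⟩
  · simpa using Submodule.finrank_le V
  · have := hB ⟨w, Submodule.subset_span hw⟩ hw i
    rwa [← hcw] at this
  · have h1 := B.sum_repr ⟨w, Submodule.subset_span hw⟩
    have h2 := congrArg (fun z : V => (z : κ → 𝕜)) h1
    simp only [Submodule.coe_sum, Submodule.coe_smul, ← hcw] at h2
    exact h2.symm

end Auerbach

/-! ### Bodies of averages and the stopping step. -/

section Averages
variable {d : ℕ} {𝕜 κ : Type*} [RCLike 𝕜] [Fintype κ]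

/-- The averages `|Q|⁻¹ ∫_s φ F` with `‖φ‖ ≤ 1`, where `|Q|` is the volume at level `l`. -/
def avgBody (F : Rd d → κ → 𝕜) (s : Set (Rd d)) (l : ℤ) : Set (κ → 𝕜) :=
  {w | ∃ φ : Rd d → 𝕜, Measurable φ ∧ (∀ y, ‖φ y‖ ≤ 1) ∧
    w = (cubeVol d l)⁻¹ • ∫ y in s, φ y • F y}

theorem integrable_bounded_smul {F : Rd d → κ → 𝕜} (hF : Integrable F volume) {φ : Rd d → 𝕜}
    (hφ : Measurable φ) {M : ℝ} (hb : ∀ y, ‖φ y‖ ≤ M) : Integrable (fun y => φ y • F y) volume :=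
  hF.bdd_smul M hφ.aestronglyMeasurable (Eventually.of_forall hb)

theorem norm_le_of_mem_avgBody {F : Rd d → κ → 𝕜} (hF : Integrable F volume) {s : Set (Rd d)}
    {l : ℤ} {w : κ → 𝕜} (hw : w ∈ avgBody F s l) : ‖w‖ ≤ (cubeVol d l)⁻¹ * ∫ y, ‖F y‖ := by
  obtain ⟨φ, -, hb, rfl⟩ := hw
  have hp := cubeVol_pos (d := d) l
  rw [norm_smul, Real.norm_of_nonneg (by positivity)]
  gcongr
  calc ‖∫ y in s, φ y • F y‖ ≤ ∫ y in s, ‖F y‖ := by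
        refine norm_integral_le_of_norm_le hF.norm.restrict (Eventually.of_forall fun y => ?_)
        rw [norm_smul]
        exact mul_le_of_le_one_left (norm_nonneg _) (hb y)
    _ ≤ _ := setIntegral_le_integral hF.norm (Eventually.of_forall fun y => norm_nonneg _)

theorem functional_integral (c : (κ → 𝕜) →ₗ[𝕜] 𝕜) {g : Rd d → κ → 𝕜} {μ : Measure (Rd d)}
    (hg : Integrable g μ) : c (∫ y, g y ∂μ) = ∫ y, c (g y) ∂μ := by
  have := (LinearMap.toContinuousLinearMap c).integral_comp_comm hg
  simpa using this.symm

theorem functional_integrable (c : (κ → 𝕜) →ₗ[𝕜] 𝕜) {g : Rd d → κ → 𝕜} {μ : Measure (Rd d)}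
    (hg : Integrable g μ) : Integrable (fun y => c (g y)) μ := by
  simpa using (LinearMap.toContinuousLinearMap c).integrable_comp hg

theorem functional_real_smul {𝕜 κ : Type*} [RCLike 𝕜] (c : (κ → 𝕜) →ₗ[𝕜] 𝕜) (r : ℝ) (w : κ → 𝕜) :
    c (r • w) = r • c w := by
  rw [RCLike.real_smul_eq_coe_smul (K := 𝕜) r w, map_smul, RCLike.real_smul_eq_coe_smul (K := 𝕜)]

theorem aestronglyMeasurable_functional (c : (κ → 𝕜) →ₗ[𝕜] 𝕜) {g : Rd d → κ → 𝕜}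
    {μ : Measure (Rd d)} (hg : AEStronglyMeasurable g μ) :
    AEStronglyMeasurable (fun y => c (g y)) μ :=
  (LinearMap.toContinuousLinearMap c).continuous.comp_aestronglyMeasurable hg

/-- A functional bounded by `M` on the convex body of averages has average at most `M`. -/
theorem lintegral_functional_le {F : Rd d → κ → 𝕜} (hF : Integrable F volume) {s : Set (Rd d)}
    {l : ℤ} (c : (κ → 𝕜) →ₗ[𝕜] 𝕜) {M : ℝ} (hM : ∀ w ∈ avgBody F s l, ‖c w‖ ≤ M) :
    ∫⁻ y in s, ‖c (F y)‖ₑ ≤ ENNReal.ofReal M * ENNReal.ofReal (cubeVol d l) := by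
  have hp := cubeVol_pos (d := d) l
  set g := hF.1.mk F
  have hgm : Measurable fun y => c (g y) :=
    (LinearMap.toContinuousLinearMap c).continuous.measurable.comp
      hF.1.stronglyMeasurable_mk.measurable
  -- The conjugate phase of `c(F)`, equal to `0` where `c(F) = 0`, turns `c` of the average into the
  -- average of `|c(F)|`. The representative `g` makes it measurable everywhere.
  set φ : Rd d → 𝕜 := fun y => (starRingEnd 𝕜) (c (g y)) * ((‖c (g y)‖⁻¹ : ℝ) : 𝕜) with hφ
  have hφm : Measurable φ :=
    (RCLike.continuous_conj.measurable.comp hgm).mul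
      (RCLike.continuous_ofReal.measurable.comp hgm.norm.inv)
  have hφb : ∀ y, ‖φ y‖ ≤ 1 := fun y => by
    simp only [hφ, norm_mul, RCLike.norm_conj, RCLike.norm_ofReal, abs_inv, abs_norm]
    exact mul_inv_le_one
  have hφF : ∀ᵐ y, φ y * c (F y) = ((‖c (F y)‖ : ℝ) : 𝕜) := by
    filter_upwards [hF.1.ae_eq_mk] with y hy
    have hy' : g y = F y := hy.symm
    simp only [hφ, hy']
    rw [mul_right_comm, RCLike.conj_mul]
    by_cases h0 : ‖c (F y)‖ = 0
    · simp [h0]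
    · norm_cast
      field_simp
  have hint := integrable_bounded_smul hF hφm hφb
  have h1 := hM _ ⟨φ, hφm, hφb, rfl⟩
  rw [functional_real_smul, functional_integral c hint.restrict, norm_smul,
    Real.norm_of_nonneg (by positivity)] at h1
  have h2 : ∫ y in s, c (φ y • F y) = ((∫ y in s, ‖c (F y)‖ : ℝ) : 𝕜) := by
    rw [← integral_ofReal]
    refine integral_congr_ae ?_
    filter_upwards [ae_restrict_of_ae hφF] with y hy
    rw [map_smul, smul_eq_mul, hy]
  rw [h2, RCLike.norm_ofReal, abs_of_nonneg (integral_nonneg fun _ => norm_nonneg _)] at h1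
  rw [← ofReal_integral_norm_eq_lintegral_enorm (functional_integrable c hF).restrict,
    ← ENNReal.ofReal_mul' hp.le]
  refine ENNReal.ofReal_le_ofReal ?_
  rw [inv_mul_le_iff₀ hp] at h1
  linarith

/-- Bounds that allow a stopping construction for the functions `A Q`, tested by functionals. -/
structure IsLocallyControlled (t : Fin d → ℤˣ) (star : CubeLabel d → Set (Rd d))
    (F : Rd d → κ → 𝕜) (A : CubeLabel d → Rd d → κ → 𝕜) (ε : ENNReal) (C : ℝ) : Prop where
  integrable : Integrable F volume
  aestronglyMeasurable : ∀ Q, AEStronglyMeasurable (A Q) volume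
  measurableSet : ∀ Q, MeasurableSet (star Q)
  star_mono : ∀ P Q, P.1 < Q.1 → gridCube t P ⊆ gridCube t Q → star P ⊆ star Q
  nonneg : 0 ≤ C
  vanish : ∀ Q (c : (κ → 𝕜) →ₗ[𝕜] 𝕜), (∀ᵐ x, x ∈ star Q → c (F x) = 0) →
    ∀ᵐ x, x ∈ gridCube t Q → c (A Q x) = 0
  control : ∀ Q (c : (κ → 𝕜) →ₗ[𝕜] 𝕜),
    ∫⁻ x in star Q, ‖c (F x)‖ₑ ≤ 2 * volume (gridCube t Q) →
    ∃ Ω : Set (Rd d), volume Ω ≤ ε * volume (gridCube t Q) ∧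
      (∀ᵐ x, x ∈ gridCube t Q → x ∉ Ω → ‖c (A Q x)‖ ≤ C) ∧
      ∀ P, P.1 < Q.1 → gridCube t P ⊆ gridCube t Q →
        2 * volume (gridCube t P ∩ Ω) ≤ volume (gridCube t P) →
        ∀ᵐ x, x ∈ gridCube t P → ‖c (A Q x) - c (A P x)‖ ≤ C

theorem volume_iUnion_le_of_forall {n : ℕ} {Ω : Fin n → Set (Rd d)} {a : ENNReal}
    (h : ∀ i, volume (Ω i) ≤ a) : volume (⋃ i, Ω i) ≤ n * a := by
  refine (measure_iUnion_fintype_le _ _).trans ((Finset.sum_le_sum fun i _ => h i).trans ?_)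
  simp

/-- The stopping cubes of an open set that is small compared to `Q` are small subcubes of `Q`. -/
theorem stopCubes_of_small (t : Fin d → ℤˣ) {O : Set (Rd d)} {Q P : CubeLabel d}
    (hO : 2 ^ (d + 2) * volume O ≤ volume (gridCube t Q)) (hP : P ∈ stopCubes t O) {x : Rd d}
    (hxP : x ∈ gridCube t P) (hxQ : x ∈ gridCube t Q) :
    P.1 < Q.1 ∧ gridCube t P ⊆ gridCube t Q := by
  have hlt : P.1 < Q.1 := by
    by_contra! hle
    have h1 : volume (gridCube t P) < 2 ^ (d + 1) * volume (gridCube t P ∩ O) := hP.1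
    have h2 : 2 ^ (d + 1) * volume (gridCube t P ∩ O) ≤ volume (gridCube t Q) := by
      refine le_trans ?_ hO
      gcongr
      · norm_num
      · omega
      · exact Set.inter_subset_right
    have h3 : volume (gridCube t Q) ≤ volume (gridCube t P) :=
      measure_mono (gridCube_subset_of_le t hle hxQ hxP)
    exact absurd (h1.trans_le (h2.trans h3)) (lt_irrefl _)
  exact ⟨hlt, gridCube_subset_of_le t hlt.le hxP hxQ⟩

-- The function to represent is `A Q - A P` on each stopping cube `P` and `A Q` elsewhere on `Q`.
-- Its coordinates in a nearly Auerbach system of the body of averages are bounded by `C`, and the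
-- system vectors are averages with weights `φ_i`. Hence the function is a single average with
-- kernel `∑ a_i(x) φ_i(y)`.
open Classical in
theorem IsLocallyControlled.exists_step (hd : 0 < d) {t : Fin d → ℤˣ}
    {star : CubeLabel d → Set (Rd d)} {F : Rd d → κ → 𝕜} {A : CubeLabel d → Rd d → κ → 𝕜}
    {ε : ENNReal} {C : ℝ} (h : IsLocallyControlled t star F A ε C)
    (hε : Fintype.card κ * ε * 2 ^ (d + 2) < 1) (Q : CubeLabel d) :
    ∃ (G : Set (CubeLabel d)) (k : Rd d → Rd d → 𝕜),
      (∀ P ∈ G, P.1 < Q.1 ∧ gridCube t P ⊆ gridCube t Q) ∧ G.PairwiseDisjoint (gridCube t) ∧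
      2 * ∑' P : G, volume (gridCube t P) ≤ volume (gridCube t Q) ∧
      Measurable (Function.uncurry k) ∧ (∀ x y, ‖k x y‖ ≤ Fintype.card κ * C) ∧
      ∀ᵐ x, x ∈ gridCube t Q →
        (∀ P ∈ G, x ∈ gridCube t P →
          A Q x = (cubeVol d Q.1)⁻¹ • (∫ y in star Q, k x y • F y) + A P x) ∧
        ((∀ P ∈ G, x ∉ gridCube t P) →
          A Q x = (cubeVol d Q.1)⁻¹ • ∫ y in star Q, k x y • F y) := by
  obtain ⟨n, v, c, hn, hv, hc, hrepr⟩ := exists_near_auerbach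
    (s := avgBody F (star Q) Q.1) (fun w hw => norm_le_of_mem_avgBody h.integrable hw)
  have hctrl : ∀ i, ∫⁻ x in star Q, ‖c i (F x)‖ₑ ≤ 2 * volume (gridCube t Q) := fun i => by
    have := lintegral_functional_le h.integrable (c i) (hc i)
    rwa [ENNReal.ofReal_ofNat, ← volume_gridCube t Q] at this
  choose Ω hΩ hAQ hAP using fun i => h.control Q (c i) (hctrl i)
  -- The stopping cubes of an open set `O` have total volume at most `2^(d+1) |O|`, so the fraction
  -- `2^(-d-2)` leaves at most half of `Q` to them.
  have hvol : volume (⋃ i, Ω i) < volume (gridCube t Q) / 2 ^ (d + 2) := by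
    rw [ENNReal.lt_div_iff_mul_lt (Or.inl (by positivity)) (Or.inl (by finiteness))]
    calc volume (⋃ i, Ω i) * 2 ^ (d + 2)
        ≤ (Fintype.card κ * (ε * volume (gridCube t Q))) * 2 ^ (d + 2) := by
          gcongr
          refine (volume_iUnion_le_of_forall hΩ).trans ?_
          gcongr
      _ = (Fintype.card κ * ε * 2 ^ (d + 2)) * volume (gridCube t Q) := by ring
      _ < 1 * volume (gridCube t Q) :=
          ENNReal.mul_lt_mul_left (volume_gridCube_ne_zero t Q) (volume_gridCube_ne_top t Q) hε
      _ = _ := one_mul _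
  obtain ⟨O, hΩO, hOo, hOlt⟩ := Set.exists_isOpen_lt_of_lt _ _ hvol
  have hO : 2 ^ (d + 2) * volume O ≤ volume (gridCube t Q) := by
    rw [mul_comm]
    exact (ENNReal.le_div_iff_mul_le (Or.inl (by positivity)) (Or.inl (by finiteness))).1 hOlt.le
  have hOt : volume O ≠ ⊤ := hOlt.ne_top
  set G : Set (CubeLabel d) := {P ∈ stopCubes t O | gridCube t P ⊆ gridCube t Q} with hG
  have hGsub : ∀ P ∈ G, P.1 < Q.1 ∧ gridCube t P ⊆ gridCube t Q := fun P hP =>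
    stopCubes_of_small t hO hP.1 (cubeCorner_mem t P) (hP.2 (cubeCorner_mem t P))
  have hGdisj : G.PairwiseDisjoint (gridCube t) :=
    (pairwiseDisjoint_stopCubes t O).subset fun P hP => hP.1
  have hGsum : 2 * ∑' P : G, volume (gridCube t P) ≤ volume (gridCube t Q) := by
    calc 2 * ∑' P : G, volume (gridCube t P)
        ≤ 2 * ∑' P : stopCubes t O, volume (gridCube t P) := by
          gcongr
          exact ENNReal.tsum_mono_subtype (fun P => volume (gridCube t P))
            (fun P (hP : P ∈ G) => hP.1)
      _ ≤ 2 * (2 ^ (d + 1) * volume O) := by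
          gcongr
          exact tsum_volume_stopCubes_le t hOo.measurableSet
      _ = 2 ^ (d + 2) * volume O := by ring
      _ ≤ _ := hO
  have hhalf : ∀ P ∈ G, ∀ i, 2 * volume (gridCube t P ∩ Ω i) ≤ volume (gridCube t P) := by
    intro P hP i
    refine le_trans ?_ (two_mul_volume_inter_le_of_mem_stopCubes t hP.1)
    gcongr
    exact (Set.subset_iUnion Ω i).trans hΩO
  have hcov : ∀ x ∈ gridCube t Q, (∀ P ∈ G, x ∉ gridCube t P) → ∀ i, x ∉ Ω i := by
    intro x hxQ hx i hxi
    obtain ⟨P, hP, hxP⟩ := exists_mem_stopCubes t hd hOo hOt (hΩO (Set.mem_iUnion.2 ⟨i, hxi⟩))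
    exact hx P ⟨hP, (stopCubes_of_small t hO hP hxP hxQ).2⟩ hxP
  -- the function to be represented
  set f : Rd d → κ → 𝕜 := fun x =>
    if hx : ∃ P ∈ G, x ∈ gridCube t P then A Q x - A hx.choose x else A Q x with hf
  have hfP : ∀ P ∈ G, ∀ x ∈ gridCube t P, f x = A Q x - A P x := by
    intro P hP x hx
    have hex : ∃ P ∈ G, x ∈ gridCube t P := ⟨P, hP, hx⟩
    simp only [hf, hex, dif_pos]
    rw [eq_of_mem_stopCubes t hex.choose_spec.1.1 hP.1 hex.choose_spec.2 hx]
  have hfQ : ∀ x, (∀ P ∈ G, x ∉ gridCube t P) → f x = A Q x := by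
    intro x hx
    have hex : ¬ ∃ P ∈ G, x ∈ gridCube t P := by push Not; exact hx
    simp only [hf, hex, dif_neg, not_false_eq_true]
  have hfm : AEStronglyMeasurable f volume := by
    set U := ⋃ P : G, gridCube t P with hU
    have hUm : MeasurableSet U := MeasurableSet.iUnion fun P => measurableSet_gridCube t _
    have h1 : AEStronglyMeasurable f (volume.restrict U) := by
      rw [hU, aestronglyMeasurable_iUnion_iff]
      intro P
      refine (((h.aestronglyMeasurable Q).sub (h.aestronglyMeasurable P)).restrict).congr ?_
      rw [EventuallyEq, ae_restrict_iff' (measurableSet_gridCube t _)]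
      exact Eventually.of_forall fun x hx => (hfP P P.2 x hx).symm
    have h2 : AEStronglyMeasurable f (volume.restrict Uᶜ) := by
      refine (h.aestronglyMeasurable Q).restrict.congr ?_
      rw [EventuallyEq, ae_restrict_iff' hUm.compl]
      refine Eventually.of_forall fun x hx => (hfQ x fun P hP hxP => hx ?_).symm
      exact Set.mem_iUnion.2 ⟨⟨P, hP⟩, hxP⟩
    have h3 := aestronglyMeasurable_union_iff.2 ⟨h1, h2⟩
    rwa [Set.union_compl_self, Measure.restrict_univ] at h3
  have hGae : ∀ {p : CubeLabel d → Rd d → Prop}, (∀ P ∈ G, ∀ᵐ x, p P x) →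
      ∀ᵐ x, ∀ P ∈ G, p P x := fun hp =>
    ae_all_iff.2 fun P => by
      by_cases hP : P ∈ G
      · filter_upwards [hp P hP] with x hx _ using hx
      · exact Eventually.of_forall fun x hx => absurd hx hP
  have hfc : ∀ i, ∀ᵐ x, x ∈ gridCube t Q → ‖c i (f x)‖ ≤ C := by
    intro i
    have h1 := hGae fun P hP => hAP i P (hGsub P hP).1 (hGsub P hP).2 (hhalf P hP i)
    filter_upwards [hAQ i, h1] with x hx1 hx2 hxQ
    by_cases hex : ∃ P ∈ G, x ∈ gridCube t P
    · obtain ⟨P, hP, hxP⟩ := hex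
      rw [hfP P hP x hxP, map_sub]
      exact hx2 P hP hxP
    · push Not at hex
      rw [hfQ x hex]
      exact hx1 hxQ (hcov x hxQ hex i)
  -- Functionals that vanish on the body vanish on `f`. Applied to the defect of the expansion in
  -- the `v i`, coordinate by coordinate, this carries the expansion from the body over to `f`.
  have hvan : ∀ e : (κ → 𝕜) →ₗ[𝕜] 𝕜, (∀ w ∈ avgBody F (star Q) Q.1, e w = 0) →
      ∀ᵐ x, x ∈ gridCube t Q → e (f x) = 0 := by
    intro e he
    have h1 := lintegral_functional_le h.integrable (s := star Q) (l := Q.1) e (M := 0)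
      (fun w hw => by rw [he w hw, norm_zero])
    rw [ENNReal.ofReal_zero, zero_mul, nonpos_iff_eq_zero,
      lintegral_eq_zero_iff' (functional_integrable e h.integrable).1.enorm.restrict,
      EventuallyEq, ae_restrict_iff' (h.measurableSet Q)] at h1
    have h2 : ∀ᵐ x, x ∈ star Q → e (F x) = 0 := by
      filter_upwards [h1] with x hx hxs
      simpa using hx hxs
    have h3 := hGae fun P hP => h.vanish P e (h2.mono fun x hx hxP =>
      hx (h.star_mono P Q (hGsub P hP).1 (hGsub P hP).2 hxP))
    filter_upwards [h.vanish Q e h2, h3] with x hx1 hx2 hxQ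
    by_cases hex : ∃ P ∈ G, x ∈ gridCube t P
    · obtain ⟨P, hP, hxP⟩ := hex
      rw [hfP P hP x hxP, map_sub, hx1 hxQ, hx2 P hP hxP, sub_zero]
    · push Not at hex
      rw [hfQ x hex, hx1 hxQ]
  have hfexp : ∀ᵐ x, x ∈ gridCube t Q → f x = ∑ i, c i (f x) • v i := by
    have h1 : ∀ j, ∀ᵐ x, x ∈ gridCube t Q →
        (LinearMap.proj j - ∑ i, v i j • c i : (κ → 𝕜) →ₗ[𝕜] 𝕜) (f x) = 0 := by
      intro j
      refine hvan _ fun w hw => ?_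
      have := congrFun (hrepr w hw) j
      simp only [Finset.sum_apply, Pi.smul_apply, smul_eq_mul] at this
      simp only [LinearMap.sub_apply, LinearMap.proj_apply, LinearMap.sum_apply,
        LinearMap.smul_apply, smul_eq_mul]
      rw [sub_eq_zero]
      refine this.trans (Finset.sum_congr rfl fun i _ => mul_comm _ _)
    filter_upwards [ae_all_iff.2 h1] with x hx hxQ
    funext j
    have := hx j hxQ
    simp only [LinearMap.sub_apply, LinearMap.proj_apply, LinearMap.sum_apply,
      LinearMap.smul_apply, smul_eq_mul] at this
    rw [sub_eq_zero] at this
    simp only [Finset.sum_apply, Pi.smul_apply, smul_eq_mul]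
    refine this.trans (Finset.sum_congr rfl fun i _ => mul_comm _ _)
  have hcm := fun i => aestronglyMeasurable_functional (c i) hfm
  -- Measurable representatives, set to `0` where they exceed `C`, so that the kernel is measurable
  -- and bounded everywhere.
  set a : Fin n → Rd d → 𝕜 := fun i x =>
    {x | ‖(hcm i).mk _ x‖ ≤ C}.indicator ((hcm i).mk _) x with ha
  have ham : ∀ i, Measurable (a i) := fun i =>
    (hcm i).stronglyMeasurable_mk.measurable.indicator
      (measurableSet_le (hcm i).stronglyMeasurable_mk.measurable.norm measurable_const)
  have hab : ∀ i x, ‖a i x‖ ≤ C := fun i x => by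
    simp only [ha]
    by_cases hx : x ∈ {x | ‖(hcm i).mk _ x‖ ≤ C}
    · rw [Set.indicator_of_mem hx]; exact hx
    · rw [Set.indicator_of_notMem hx, norm_zero]; exact h.nonneg
  have hac : ∀ᵐ x, x ∈ gridCube t Q → ∀ i, a i x = c i (f x) := by
    filter_upwards [ae_all_iff.2 hfc, ae_all_iff.2 fun i => (hcm i).ae_eq_mk] with x hx1 hx2 hxQ i
    have hx : x ∈ {x | ‖(hcm i).mk _ x‖ ≤ C} := by
      simp only [Set.mem_ofPred_eq, ← hx2 i]; exact hx1 i hxQ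
    simp only [ha]
    rw [Set.indicator_of_mem hx, ← hx2 i]
  choose φ hφm hφb hvφ using hv
  refine ⟨G, fun x y => ∑ i, a i x * φ i y, hGsub, hGdisj, hGsum, ?_, fun x y => ?_, ?_⟩
  · refine Finset.measurable_fun_sum _ fun i _ => ?_
    exact ((ham i).comp measurable_fst).mul ((hφm i).comp measurable_snd)
  · calc ‖∑ i, a i x * φ i y‖ ≤ ∑ _i : Fin n, C := by
          refine norm_sum_le_of_le _ fun i _ => ?_
          rw [norm_mul]
          calc _ ≤ C * 1 := mul_le_mul (hab i x) (hφb i y) (norm_nonneg _) h.nonneg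
            _ = C := mul_one C
      _ = n * C := by simp
      _ ≤ _ := by
          have := h.nonneg
          gcongr
  · have hb : ∀ x, (cubeVol d Q.1)⁻¹ • (∫ y in star Q, (∑ i, a i x * φ i y) • F y) =
        ∑ i, a i x • v i := by
      intro x
      have hi : ∀ i, Integrable (fun y => φ i y • F y) (volume.restrict (star Q)) := fun i =>
        (integrable_bounded_smul h.integrable (hφm i) (hφb i)).restrict
      simp_rw [Finset.sum_smul, mul_smul]
      rw [integral_finsetSum (f := fun i y => a i x • φ i y • F y) _
        fun i _ => (hi i).smul (a i x), Finset.smul_sum]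
      refine Finset.sum_congr rfl fun i _ => ?_
      rw [integral_smul, smul_comm, ← hvφ i]
    filter_upwards [hfexp, hac] with x hx1 hx2 hxQ
    have hfx : (cubeVol d Q.1)⁻¹ • (∫ y in star Q, (∑ i, a i x * φ i y) • F y) = f x := by
      rw [hb x]
      exact (Finset.sum_congr rfl fun i _ => by rw [hx2 hxQ i]).trans (hx1 hxQ).symm
    rw [hfx]
    exact ⟨fun P hP hxP => by rw [hfP P hP x hxP, sub_add_cancel], fun hex => (hfQ x hex).symm⟩

end Averages

/-! ### Iteration of a sparse selection of subcubes. -/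

section Tree
variable {d : ℕ} (t : Fin d → ℤˣ) (G : CubeLabel d → Set (CubeLabel d))

/-- The cubes generated from `Q` by iterating the selection `G` of subcubes. -/
def cubeTree (Q : CubeLabel d) : Set (CubeLabel d) :=
  {P | Relation.ReflTransGen (fun Q P => P ∈ G Q) Q P}

/-- The part of `Q` not covered by the selected subcubes. -/
def exclusivePart (Q : CubeLabel d) : Set (Rd d) :=
  gridCube t Q \ ⋃ P ∈ G Q, gridCube t P

/-- The points of `Q` that lie in a cube of the `n`-th generation. -/
def deepPart : ℕ → CubeLabel d → Set (Rd d)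
  | 0, Q => gridCube t Q
  | n + 1, Q => ⋃ P ∈ G Q, deepPart n P

/-- The properties of a sparse selection of subcubes. -/
structure IsSparseSelection : Prop where
  sub : ∀ Q, ∀ P ∈ G Q, P.1 < Q.1 ∧ gridCube t P ⊆ gridCube t Q
  disjoint : ∀ Q, (G Q).PairwiseDisjoint (gridCube t)
  sum_le : ∀ Q, 2 * ∑' P : G Q, volume (gridCube t P) ≤ volume (gridCube t Q)

variable {t G}

theorem IsSparseSelection.sub_of_mem_cubeTree (h : IsSparseSelection t G) {P Q : CubeLabel d}
    (hP : P ∈ cubeTree G Q) : P.1 ≤ Q.1 ∧ gridCube t P ⊆ gridCube t Q := by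
  induction hP with
  | refl => exact ⟨le_rfl, subset_rfl⟩
  | tail _ hbc ih =>
    have := h.sub _ _ hbc
    exact ⟨this.1.le.trans ih.1, this.2.trans ih.2⟩

theorem exclusivePart_subset (Q : CubeLabel d) : exclusivePart t G Q ⊆ gridCube t Q :=
  Set.sdiff_subset

theorem measurableSet_exclusivePart (Q : CubeLabel d) :
    MeasurableSet (exclusivePart t G Q) :=
  (measurableSet_gridCube t Q).diff
    (MeasurableSet.biUnion (Set.to_countable _) fun _ _ => measurableSet_gridCube t _)

theorem IsSparseSelection.volume_le (h : IsSparseSelection t G) (Q : CubeLabel d) :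
    volume (gridCube t Q) ≤ 2 * volume (exclusivePart t G Q) := by
  set U := ⋃ P ∈ G Q, gridCube t P
  have h1 : 2 * volume U ≤ volume (gridCube t Q) := by
    refine le_trans ?_ (h.sum_le Q)
    gcongr
    exact measure_biUnion_le _ (Set.to_countable _) _
  have h2 : volume (gridCube t Q) ≤ volume U + volume (exclusivePart t G Q) := by
    refine (measure_mono ?_).trans (measure_union_le _ _)
    rw [exclusivePart, Set.union_sdiff_self]
    exact Set.subset_union_right
  have h3 : volume (gridCube t Q) + volume (gridCube t Q) ≤
      volume (gridCube t Q) + 2 * volume (exclusivePart t G Q) := by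
    calc _ = 2 * volume (gridCube t Q) := (two_mul _).symm
      _ ≤ 2 * (volume U + volume (exclusivePart t G Q)) := by gcongr
      _ = 2 * volume U + 2 * volume (exclusivePart t G Q) := mul_add _ _ _
      _ ≤ _ := by gcongr
  exact (ENNReal.add_le_add_iff_left (volume_gridCube_ne_top t Q)).1 h3

theorem IsSparseSelection.reflTransGen_through (h : IsSparseSelection t G) {P Q : CubeLabel d}
    (hP : P ∈ cubeTree G Q) {x : Rd d} (hx : x ∈ gridCube t P) :
    Relation.ReflTransGen (fun Q P => P ∈ G Q ∧ x ∈ gridCube t P) Q P := by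
  induction hP with
  | refl => exact Relation.ReflTransGen.refl
  | tail _ hbc ih => exact (ih ((h.sub _ _ hbc).2 hx)).tail ⟨hbc, hx⟩

theorem IsSparseSelection.rightUnique (h : IsSparseSelection t G) (x : Rd d) :
    Relator.RightUnique fun Q P => P ∈ G Q ∧ x ∈ gridCube t P := by
  intro Q P P' hP hP'
  by_contra hne
  exact Set.disjoint_left.1 (h.disjoint Q hP.1 hP'.1 hne) hP.2 hP'.2

/-- The cubes of the tree that contain `x` form a single chain, as the selected subcubes of a cube
are disjoint. Of two such cubes one descends from the other, so `x` lies in a selected subcube of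
the upper one. -/
theorem IsSparseSelection.pairwiseDisjoint_exclusivePart (h : IsSparseSelection t G)
    (Q : CubeLabel d) : (cubeTree G Q).PairwiseDisjoint (exclusivePart t G) := by
  intro P hP P' hP' hne
  refine Set.disjoint_left.2 fun x hx hx' => ?_
  have key : ∀ {P P' : CubeLabel d}, x ∈ exclusivePart t G P → P ≠ P' →
      ¬ Relation.ReflTransGen (fun Q P => P ∈ G Q ∧ x ∈ gridCube t P) P P' := by
    intro P P' hx hne hr
    rcases Relation.ReflTransGen.cases_head hr with rfl | ⟨R, hR, -⟩
    · exact hne rfl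
    · exact hx.2 (Set.mem_iUnion₂.2 ⟨R, hR.1, hR.2⟩)
  rcases Relation.ReflTransGen.total_of_right_unique (h.rightUnique x)
    (h.reflTransGen_through hP hx.1) (h.reflTransGen_through hP' hx'.1) with hr | hr
  · exact key hx hne hr
  · exact key hx' hne.symm hr

theorem IsSparseSelection.volume_deepPart_le (h : IsSparseSelection t G) (n : ℕ)
    (Q : CubeLabel d) : 2 ^ n * volume (deepPart t G n Q) ≤ volume (gridCube t Q) := by
  induction n generalizing Q with
  | zero => simp [deepPart]
  | succ n ih =>
    calc 2 ^ (n + 1) * volume (deepPart t G (n + 1) Q)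
        ≤ 2 ^ (n + 1) * ∑' P : G Q, volume (deepPart t G n P) := by
          gcongr
          exact measure_biUnion_le _ (Set.to_countable _) _
      _ = 2 * ∑' P : G Q, 2 ^ n * volume (deepPart t G n P) := by
          rw [ENNReal.tsum_mul_left]; ring
      _ ≤ 2 * ∑' P : G Q, volume (gridCube t P) := by
          gcongr with P
          exact ih P
      _ ≤ _ := h.sum_le Q

theorem IsSparseSelection.ae_exists_notMem_deepPart (h : IsSparseSelection t G)
    (Q : CubeLabel d) : ∀ᵐ x, ∃ n, x ∉ deepPart t G n Q := by
  have h0 : volume (⋂ n, deepPart t G n Q) = 0 := by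
    by_contra hne
    set a := volume (⋂ n, deepPart t G n Q)
    have hle : ∀ n : ℕ, 2 ^ n * a ≤ volume (gridCube t Q) := fun n =>
      le_trans (by gcongr; exact measure_mono (Set.iInter_subset _ n)) (h.volume_deepPart_le n Q)
    have hat : a ≠ ⊤ := fun hat => volume_gridCube_ne_top t Q (top_le_iff.1 (by
      have := hle 0; rwa [pow_zero, one_mul, hat] at this))
    have hpos := ENNReal.toReal_pos hne hat
    obtain ⟨n, hn⟩ := pow_unbounded_of_one_lt ((volume (gridCube t Q)).toReal / a.toReal)
      one_lt_two
    have h1 := ENNReal.toReal_mono (volume_gridCube_ne_top t Q) (hle n)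
    rw [ENNReal.toReal_mul, ENNReal.toReal_pow, ENNReal.toReal_ofNat] at h1
    rw [div_lt_iff₀ hpos] at hn
    linarith
  have : ∀ᵐ x, x ∉ ⋂ n, deepPart t G n Q := measure_eq_zero_iff_ae_notMem.1 h0
  filter_upwards [this] with x hx
  simpa using hx

/-- A telescoping sum along the chain of cubes containing `x`, which ends before generation `n`; all
other terms vanish at `x`. -/
theorem IsSparseSelection.hasSum_of_notMem_deepPart (h : IsSparseSelection t G) {W : Type*}
    [AddCommGroup W] [TopologicalSpace W] [ContinuousAdd W] {A b : CubeLabel d → W} {x : Rd d}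
    (hstep : ∀ Q, x ∈ gridCube t Q → (∀ P ∈ G Q, x ∈ gridCube t P → A Q = b Q + A P) ∧
      ((∀ P ∈ G Q, x ∉ gridCube t P) → A Q = b Q))
    (hb : ∀ Q, x ∉ gridCube t Q → b Q = 0) (n : ℕ) (Q : CubeLabel d) (hxQ : x ∈ gridCube t Q)
    (hx : x ∉ deepPart t G n Q) : HasSum ((cubeTree G Q).indicator b) (A Q) := by
  classical
  induction n generalizing Q with
  | zero => exact absurd hxQ hx
  | succ n ih =>
    have hQQ : Q ∈ cubeTree G Q := Relation.ReflTransGen.refl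
    by_cases hex : ∃ P ∈ G Q, x ∈ gridCube t P
    · obtain ⟨P, hP, hxP⟩ := hex
      have hxd : x ∉ deepPart t G n P := fun hd => hx (Set.mem_iUnion₂.2 ⟨P, hP, hd⟩)
      rw [(hstep Q hxQ).1 P hP hxP]
      have hs := (hasSum_pi_single Q (b Q)).add (ih P hxP hxd)
      -- Among the cubes containing `x`, the tree of `Q` consists of `Q` and the tree of `P`. Levels
      -- drop strictly, so `Q` does not reappear below `P`.
      have e : (cubeTree G Q).indicator b =
          fun R => (Pi.single Q (b Q) : CubeLabel d → W) R + (cubeTree G P).indicator b R := by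
        funext R
        by_cases hxR : x ∈ gridCube t R
        · by_cases hRQ : R = Q
          · subst hRQ
            have hn : R ∉ cubeTree G P := fun hR =>
              absurd (h.sub_of_mem_cubeTree hR).1 (not_le.2 (h.sub _ _ hP).1)
            simp [hQQ, hn]
          · have hiff : R ∈ cubeTree G Q ↔ R ∈ cubeTree G P := by
              constructor
              · intro hR
                rcases Relation.ReflTransGen.cases_head (h.reflTransGen_through hR hxR) with
                  h1 | ⟨P', hP', hr⟩
                · exact absurd h1.symm hRQ
                · have : P' = P := h.rightUnique x hP' ⟨hP, hxP⟩
                  subst this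
                  exact Relation.ReflTransGen.mono (fun _ _ h => h.1) _ _ hr
              · exact fun hR => Relation.ReflTransGen.head hP hR
            simp [hRQ, Set.indicator_apply, hiff]
        · have h1 : ¬ R = Q := by rintro rfl; exact hxR hxQ
          simp [Set.indicator_apply, hb R hxR, h1]
      rw [e]
      exact hs
    · push Not at hex
      rw [(hstep Q hxQ).2 hex]
      have : (cubeTree G Q).indicator b = Pi.single Q (b Q) := by
        funext R
        by_cases hRQ : R = Q
        · subst hRQ; simp [hQQ]
        · rw [Pi.single_apply, if_neg hRQ]
          refine Set.indicator_apply_eq_zero.2 fun hR => hb R fun hxR => ?_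
          rcases Relation.ReflTransGen.cases_head (h.reflTransGen_through hR hxR) with
            h1 | ⟨P', hP', -⟩
          · exact hRQ h1.symm
          · exact hex P' hP'.1 hP'.2
      rw [this]
      exact hasSum_pi_single Q (b Q)

end Tree

/-! ### Sparse domination from local control. -/

section Sparse
variable {d : ℕ} {𝕜 κ : Type*} [RCLike 𝕜] [Fintype κ]

/-- `𝟙_Q(x) |Q|⁻¹ ∫_s k(x, y) F(y) dy`. -/
noncomputable def avgTerm (t : Fin d → ℤˣ) (F : Rd d → κ → 𝕜) (s : Set (Rd d))
    (k : Rd d → Rd d → 𝕜) (Q : CubeLabel d) : Rd d → κ → 𝕜 :=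
  (gridCube t Q).indicator fun x => (cubeVol d Q.1)⁻¹ • ∫ y in s, k x y • F y

/-- A family of cubes of the grid `t` with disjoint major parts. -/
def IsSparseFamily (t : Fin d → ℤˣ) (S : Set (CubeLabel d)) (E : CubeLabel d → Set (Rd d)) :
    Prop :=
  (∀ Q ∈ S, MeasurableSet (E Q) ∧ E Q ⊆ gridCube t Q ∧
    volume (gridCube t Q) ≤ 2 * volume (E Q)) ∧ S.PairwiseDisjoint E

/-- Sparse convex body domination from local control. -/
theorem IsLocallyControlled.exists_sparse (hd : 0 < d) {t : Fin d → ℤˣ}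
    {star : CubeLabel d → Set (Rd d)} {F : Rd d → κ → 𝕜} {A : CubeLabel d → Rd d → κ → 𝕜}
    {ε : ENNReal} {C : ℝ} (h : IsLocallyControlled t star F A ε C)
    (hε : Fintype.card κ * ε * 2 ^ (d + 2) < 1) (Q : CubeLabel d) :
    ∃ (S : Set (CubeLabel d)) (E : CubeLabel d → Set (Rd d)) (k : CubeLabel d → Rd d → Rd d → 𝕜),
      IsSparseFamily t S E ∧ (∀ P ∈ S, P.1 ≤ Q.1 ∧ gridCube t P ⊆ gridCube t Q) ∧
      (∀ P, Measurable (Function.uncurry (k P)) ∧ ∀ x y, ‖k P x y‖ ≤ Fintype.card κ * C) ∧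
      ∀ᵐ x, x ∈ gridCube t Q →
        HasSum (S.indicator fun P => avgTerm t F (star P) (k P) P x) (A Q x) := by
  choose G k h1 h2 h3 hkm hkb hstep using fun Q => h.exists_step hd hε Q
  have hG : IsSparseSelection t G := ⟨h1, h2, h3⟩
  refine ⟨cubeTree G Q, exclusivePart t G, k,
    ⟨fun P _ => ⟨measurableSet_exclusivePart P, exclusivePart_subset P, hG.volume_le P⟩,
      hG.pairwiseDisjoint_exclusivePart Q⟩, fun P hP => hG.sub_of_mem_cubeTree hP,
    fun P => ⟨hkm P, hkb P⟩, ?_⟩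
  filter_upwards [ae_all_iff.2 hstep, hG.ae_exists_notMem_deepPart Q] with x hx hn hxQ
  obtain ⟨n, hn⟩ := hn
  refine hG.hasSum_of_notMem_deepPart (A := fun P => A P x) (fun P hxP => ?_) (fun P hxP => ?_)
    n Q hxQ hn
  · rw [avgTerm, Set.indicator_of_mem hxP]
    exact hx P hxP
  · exact Set.indicator_of_notMem hxP _

end Sparse

/-! ### Local control of a Calderón–Zygmund operator. -/

section Local
variable {d : ℕ} {𝕜 κ : Type*} [RCLike 𝕜] [Fintype κ]
  {S : (Rd d → 𝕜) → Rd d → 𝕜} {K : Rd d → Rd d → 𝕜} {C δ : ℝ} {W : NNReal}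

theorem IsWeakCZ.ae_eq_zero (h : IsWeakCZ S K C δ W) {f : Rd d → 𝕜} (hf : f =ᵐ[volume] 0) :
    ∀ᵐ x, S f x = 0 := by
  have hfi : Integrable f volume := (integrable_zero _ _ _).congr hf.symm
  have h0 : ∫⁻ x, ‖f x‖ₑ = 0 := by
    rw [lintegral_eq_zero_iff' hfi.1.enorm]
    filter_upwards [hf] with x hx
    simp [hx]
  have h1 : ∀ n : ℕ, ∀ᵐ x, ¬ ENNReal.ofReal (1 / (n + 1)) ≤ ‖S f x‖ₑ := fun n => by
    have := h.weakType f hfi (1 / (n + 1)) (by positivity)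
    rw [h0, mul_zero, ENNReal.zero_div, nonpos_iff_eq_zero] at this
    exact measure_eq_zero_iff_ae_notMem.1 this
  filter_upwards [ae_all_iff.2 h1] with x hx
  by_contra hne
  obtain ⟨n, hn⟩ := exists_nat_one_div_lt (norm_pos_iff.2 hne)
  refine hx n ?_
  rw [← ofReal_norm]
  exact ENNReal.ofReal_le_ofReal hn.le

theorem IsWeakCZ.map_sum (h : IsWeakCZ S K C δ W) {f : κ → Rd d → 𝕜} (a : κ → 𝕜)
    (hf : ∀ i, Integrable (f i) volume) :
    ∀ᵐ x, S (∑ i, a i • f i) x = ∑ i, a i * S (f i) x := by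
  classical
  have key : ∀ s : Finset κ, ∀ᵐ x, S (∑ i ∈ s, a i • f i) x = ∑ i ∈ s, a i * S (f i) x := by
    intro s
    induction s using Finset.induction_on with
    | empty =>
      simp only [Finset.sum_empty]
      exact h.ae_eq_zero (by rfl)
    | insert j s hj ih =>
      have h1 := h.map_add (a j • f j) (∑ i ∈ s, a i • f i) ((hf j).smul _)
        (integrable_finsetSum' _ fun i _ => (hf i).smul _)
      filter_upwards [h1, h.map_smul (a j) (f j) (hf j), ih] with x h1 h2 h3
      rw [Finset.sum_insert hj, Finset.sum_insert hj, h1, Pi.add_apply, h2, h3, Pi.smul_apply,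
        smul_eq_mul]
  exact key Finset.univ

/-- The ball that plays the role of the dilate of a cube. -/
noncomputable def starBall (t : Fin d → ℤˣ) (Q : CubeLabel d) : Set (Rd d) :=
  Metric.ball (cubeCorner t Q) (3 * d * 2 ^ Q.1)

theorem starBall_mono (hd : 0 < d) (t : Fin d → ℤˣ) {P Q : CubeLabel d} (hl : P.1 < Q.1)
    (hPQ : gridCube t P ⊆ gridCube t Q) : starBall t P ⊆ starBall t Q := by
  refine Metric.ball_subset_ball' ?_
  rw [dist_eq_norm]
  have h1 := norm_sub_le_of_mem t (hPQ (cubeCorner_mem t P)) (cubeCorner_mem t Q)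
  have h2 : (2 : ℝ) * 2 ^ P.1 ≤ 2 ^ Q.1 := by
    rw [mul_comm, ← zpow_add_one₀ (by norm_num)]
    exact zpow_le_zpow_right₀ (by norm_num) (by omega)
  have h3 : (0 : ℝ) < d := by exact_mod_cast hd
  have h4 := mul_le_mul_of_nonneg_left h2 h3.le
  have h5 : (0 : ℝ) < d * 2 ^ Q.1 := mul_pos h3 (two_zpow_pos _)
  linarith

theorem gridCube_subset_starBall (hd : 0 < d) (t : Fin d → ℤˣ) (Q : CubeLabel d) :
    gridCube t Q ⊆ starBall t Q := fun x hx => by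
  rw [starBall, Metric.mem_ball, dist_eq_norm]
  have h1 := norm_sub_le_of_mem t hx (cubeCorner_mem t Q)
  have h2 : (0 : ℝ) < d := by exact_mod_cast hd
  have h3 := two_zpow_pos Q.1
  have h4 : (0 : ℝ) < d * 2 ^ Q.1 := by positivity
  linarith

theorem norm_sub_ge_of_notMem_starBall (t : Fin d → ℤˣ) {Q : CubeLabel d} {x y : Rd d}
    (hx : x ∈ gridCube t Q) (hy : y ∉ starBall t Q) : 2 * (d * 2 ^ Q.1) ≤ ‖x - y‖ := by
  rw [starBall, Metric.mem_ball, dist_eq_norm, not_lt] at hy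
  have h1 := norm_sub_le_of_mem t hx (cubeCorner_mem t Q)
  have h2 := norm_sub_le_norm_sub_add_norm_sub y x (cubeCorner t Q)
  rw [norm_sub_rev y x] at h2
  linarith

theorem IsWeakCZ.integrable_kernel_mul (h : IsWeakCZ S K C δ W) {g : Rd d → 𝕜}
    (hg : Integrable g volume) {x : Rd d} {ρ : ℝ} (hρ : 0 < ρ)
    (hfar : ∀ y, g y ≠ 0 → ρ ≤ ‖x - y‖) : Integrable (fun y => K x y * g y) volume := by
  refine (hg.norm.const_mul (C / ρ ^ d)).mono'
    ((h.measurable.comp measurable_prodMk_left).aestronglyMeasurable.mul hg.1)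
    (Eventually.of_forall fun y => ?_)
  by_cases hy : g y = 0
  · simp [hy]
  · have h1 := hfar y hy
    have hxy : x ≠ y := by rintro rfl; simp at h1; linarith
    rw [norm_mul]
    refine mul_le_mul_of_nonneg_right ((h.size x y hxy).trans ?_) (norm_nonneg _)
    have := h.nonneg
    gcongr

/-- Oscillation of the tail part of `S g` on a cube. -/
theorem IsWeakCZ.norm_integral_sub_le (h : IsWeakCZ S K C δ W) {g : Rd d → 𝕜}
    (hg : Integrable g volume) {x x' : Rd d} {r M : ℝ} (hr : 0 < r) (hM : 0 ≤ M)
    (hxx : ‖x - x'‖ ≤ r) (hfar : ∀ y, g y ≠ 0 → 2 * r ≤ ‖x - y‖)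
    (hfar' : ∀ y, g y ≠ 0 → 2 * r ≤ ‖x' - y‖)
    (hgrow : ∀ s ≥ 2 * r, ∫⁻ y in Metric.closedBall x s, ‖g y‖ₑ ≤ ENNReal.ofReal (M * s ^ d)) :
    ‖(∫ y, K x y * g y) - ∫ y, K x' y * g y‖ ≤ C * (2 ^ d / (1 - 2 ^ (-δ)) * M) := by
  have hC := h.nonneg
  have hδ := h.pos
  have h2r : 0 < 2 * r := by positivity
  have hq1 : (2 : ℝ) ^ (-δ) < 1 := Real.rpow_lt_one_of_one_lt_of_neg (by norm_num) (by linarith)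
  have hq2 : 0 < 1 - (2 : ℝ) ^ (-δ) := by linarith
  rw [← integral_sub (h.integrable_kernel_mul hg h2r hfar) (h.integrable_kernel_mul hg h2r hfar')]
  set far : Set (Rd d) := {y | 2 * r ≤ ‖x - y‖} with hfars
  have hfm : MeasurableSet far := measurableSet_le measurable_const (by fun_prop)
  have hmd : Measurable fun y : Rd d => ENNReal.ofReal (1 / ‖x - y‖ ^ ((d : ℝ) + δ)) := by
    fun_prop
  have htail : ∫⁻ y in far, ‖g y‖ₑ * ENNReal.ofReal (1 / ‖x - y‖ ^ ((d : ℝ) + δ)) ≤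
      ENNReal.ofReal (2 ^ d / (1 - 2 ^ (-δ)) * M / (2 * r) ^ δ) := by
    have h1 := lintegral_tail_le (massMeasure g) hδ x h2r hM (fun s hs => by
      rw [massMeasure_apply g measurableSet_closedBall]; exact hgrow s hs)
    rw [massMeasure, restrict_withDensity hfm, lintegral_withDensity_eq_lintegral_mul₀
      hg.1.enorm.restrict hmd.aemeasurable] at h1
    exact h1
  have hpt : ∀ y, ‖K x y * g y - K x' y * g y‖ₑ ≤ far.indicator (fun y =>
      ENNReal.ofReal (C * r ^ δ) *
        (‖g y‖ₑ * ENNReal.ofReal (1 / ‖x - y‖ ^ ((d : ℝ) + δ)))) y := by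
    intro y
    by_cases hy : g y = 0
    · simp [hy]
    · have hyf : y ∈ far := hfar y hy
      rw [Set.indicator_of_mem hyf, ← sub_mul, enorm_mul]
      have hxy : x ≠ y := by
        rintro rfl
        have := hfar x hy
        simp only [sub_self, norm_zero] at this
        linarith
      have h1 := h.reg x x' y hxy (by have := hfar y hy; linarith)
      have h2 : ‖K x y - K x' y‖ₑ ≤
          ENNReal.ofReal (C * r ^ δ) * ENNReal.ofReal (1 / ‖x - y‖ ^ ((d : ℝ) + δ)) := by
        rw [← ofReal_norm, ← ENNReal.ofReal_mul (by positivity)]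
        refine ENNReal.ofReal_le_ofReal (h1.trans ?_)
        rw [mul_one_div]
        gcongr
      calc _ ≤ ENNReal.ofReal (C * r ^ δ) * ENNReal.ofReal (1 / ‖x - y‖ ^ ((d : ℝ) + δ)) *
            ‖g y‖ₑ := by gcongr
        _ = _ := by ring
  have hfin : ‖∫ y, (K x y * g y - K x' y * g y)‖ₑ ≤
      ENNReal.ofReal (C * (2 ^ d / (1 - 2 ^ (-δ)) * M)) := by
    calc _ ≤ ∫⁻ y, ‖K x y * g y - K x' y * g y‖ₑ := enorm_integral_le_lintegral_enorm _
      _ ≤ _ := lintegral_mono hpt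
      _ = ENNReal.ofReal (C * r ^ δ) *
          ∫⁻ y in far, ‖g y‖ₑ * ENNReal.ofReal (1 / ‖x - y‖ ^ ((d : ℝ) + δ)) := by
        rw [lintegral_indicator hfm, lintegral_const_mul' _ _ ENNReal.ofReal_ne_top]
      _ ≤ ENNReal.ofReal (C * r ^ δ) *
          ENNReal.ofReal (2 ^ d / (1 - 2 ^ (-δ)) * M / (2 * r) ^ δ) := by gcongr
      _ ≤ _ := by
        rw [← ENNReal.ofReal_mul (by positivity)]
        refine ENNReal.ofReal_le_ofReal ?_
        have h1 : r ^ δ / (2 * r) ^ δ ≤ 1 := by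
          rw [div_le_one (by positivity)]
          exact Real.rpow_le_rpow hr.le (by linarith) hδ.le
        calc _ = C * (2 ^ d / (1 - 2 ^ (-δ)) * M) * (r ^ δ / (2 * r) ^ δ) := by ring
          _ ≤ C * (2 ^ d / (1 - 2 ^ (-δ)) * M) * 1 := by gcongr
          _ = _ := mul_one _
  rw [← ofReal_norm] at hfin
  exact (ENNReal.ofReal_le_ofReal_iff (by positivity)).1 hfin

/-- The localized operator applied to each component. -/
noncomputable def localOp (S : (Rd d → 𝕜) → Rd d → 𝕜) (t : Fin d → ℤˣ) (F : Rd d → κ → 𝕜)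
    (Q : CubeLabel d) (x : Rd d) (i : κ) : 𝕜 :=
  S ((starBall t Q).indicator fun y => F y i) x

/-- By linearity a functional of the vector-valued operator is the scalar operator applied to the
functional of `F`; this reduces all estimates to the scalar case. -/
theorem IsWeakCZ.functional_localOp (h : IsWeakCZ S K C δ W) (t : Fin d → ℤˣ)
    {F : Rd d → κ → 𝕜} (hF : Integrable F volume) (Q : CubeLabel d) (c : (κ → 𝕜) →ₗ[𝕜] 𝕜) :
    ∀ᵐ x, c (localOp S t F Q x) = S ((starBall t Q).indicator fun y => c (F y)) x := by
  classical
  set a : κ → 𝕜 := fun i => c fun j => if i = j then 1 else 0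
  have hi : ∀ i, Integrable ((starBall t Q).indicator fun y => F y i) volume := fun i =>
    (hF.eval i).indicator measurableSet_ball
  have h1 := h.map_sum a hi
  have e : (starBall t Q).indicator (fun y => c (F y)) =
      ∑ i, a i • (starBall t Q).indicator fun y => F y i := by
    funext y
    rw [Finset.sum_apply]
    by_cases hy : y ∈ starBall t Q
    · rw [Set.indicator_of_mem hy, LinearMap.pi_apply_eq_sum_univ c (F y)]
      refine Finset.sum_congr rfl fun i _ => ?_
      rw [Pi.smul_apply, Set.indicator_of_mem hy, smul_eq_mul, smul_eq_mul, mul_comm]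
    · simp [hy]
  filter_upwards [h1] with x hx
  rw [e, hx, LinearMap.pi_apply_eq_sum_univ c]
  exact Finset.sum_congr rfl fun i _ => by rw [smul_eq_mul, mul_comm]; rfl

theorem aestronglyMeasurable_of_eval {g : Rd d → κ → 𝕜}
    (hg : ∀ i, AEStronglyMeasurable (fun x => g x i) volume) : AEStronglyMeasurable g volume :=
  (aemeasurable_pi_iff.2 fun i => (hg i).aemeasurable).aestronglyMeasurable

/-- Comparison of the localizations to a cube and to a subcube. -/
theorem IsWeakCZ.norm_sub_le_of_subcube (hd : 0 < d) (h : IsWeakCZ S K C δ W) (t : Fin d → ℤˣ)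
    {f : Rd d → 𝕜} (hf : Integrable f volume) {P Q : CubeLabel d} (hl : P.1 < Q.1)
    (hPQ : gridCube t P ⊆ gridCube t Q) {A : ℝ} (hA : 0 < A)
    (hhalf : 2 * volume (gridCube t P ∩
      ({x | ENNReal.ofReal A ≤ ‖S ((starBall t Q).indicator f) x‖ₑ} ∪
        maximalSet (massMeasure ((starBall t Q).indicator f)) A)) ≤ volume (gridCube t P)) :
    ∀ᵐ x, x ∈ gridCube t P →
      ‖S ((starBall t Q).indicator f) x - S ((starBall t P).indicator f) x‖ ≤
        A + (4 * W * A * (4 * d) ^ d + 1) + C * (2 ^ d / (1 - 2 ^ (-δ)) * (2 ^ d * A)) := by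
  set fQ := (starBall t Q).indicator f with hfQ
  set fP := (starBall t P).indicator f with hfP
  set Ω := {x | ENNReal.ofReal A ≤ ‖S fQ x‖ₑ} ∪ maximalSet (massMeasure fQ) A with hΩ
  have hd' : (0 : ℝ) < d := by exact_mod_cast hd
  have hp := two_zpow_pos P.1
  set r : ℝ := d * 2 ^ P.1 with hrdef
  have hr : 0 < r := by positivity
  have hfQi : Integrable fQ volume := hf.indicator measurableSet_ball
  have hfPi : Integrable fP volume := hf.indicator measurableSet_ball
  have hstar := starBall_mono hd t hl hPQ
  have hv0 := volume_gridCube_ne_zero t P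
  have hvt := volume_gridCube_ne_top t P
  -- As `g` vanishes on the dilate of `P`, on `P` the function `S g` is a kernel integral of bounded
  -- oscillation. A bound for `S g = S fQ - S fP` at a single point of `P` is therefore enough.
  set g := fQ - fP with hg
  have hgi : Integrable g volume := hfQi.sub hfPi
  have hgP : ∀ y ∈ starBall t P, g y = 0 := fun y hy => by
    simp [hg, hfQ, hfP, hy, hstar hy]
  have hgle : ∀ y, ‖g y‖ₑ ≤ ‖fQ y‖ₑ := fun y => by
    by_cases hy : y ∈ starBall t P
    · simp [hgP y hy]
    · simp [hg, hfP, hy]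
  have hfPle : ∀ y, ‖fP y‖ₑ ≤ ‖fQ y‖ₑ := fun y => by
    by_cases hy : y ∈ starBall t P
    · simp [hfP, hfQ, hy, hstar hy]
    · simp [hfP, hy]
  have hSg : ∀ᵐ x, S fQ x = S fP x + S g x := by
    have h1 := h.map_add fP g hfPi hgi
    have e : fP + g = fQ := by rw [hg]; abel
    rw [e] at h1
    exact h1
  have hrep := h.rep g hgi (starBall t P) Metric.isOpen_ball hgP
  -- a point outside `Ω`, and the mass near `P`
  have hlt_of : ∀ N : Set (Rd d), 4 * volume (gridCube t P ∩ N) ≤ volume (gridCube t P) →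
      ∃ x ∈ gridCube t P, x ∉ Ω ∧ x ∉ N := by
    intro N hN
    by_contra! hcon
    have h1 : gridCube t P ⊆ (gridCube t P ∩ Ω) ∪ (gridCube t P ∩ N) := fun x hx => by
      by_cases hxΩ : x ∈ Ω
      · exact Or.inl ⟨hx, hxΩ⟩
      · exact Or.inr ⟨hx, hcon x hx hxΩ⟩
    have h2 : 4 * volume (gridCube t P) ≤ 3 * volume (gridCube t P) := by
      calc 4 * volume (gridCube t P)
          ≤ 4 * (volume (gridCube t P ∩ Ω) + volume (gridCube t P ∩ N)) := by
            gcongr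
            exact (measure_mono h1).trans (measure_union_le _ _)
        _ = 2 * (2 * volume (gridCube t P ∩ Ω)) + 4 * volume (gridCube t P ∩ N) := by ring
        _ ≤ 2 * volume (gridCube t P) + volume (gridCube t P) := by gcongr
        _ = _ := by ring
    have h3 := (ENNReal.mul_le_mul_iff_left hv0 hvt).1 h2
    norm_num at h3
  obtain ⟨x₀, hx₀P, hx₀Ω, -⟩ := hlt_of ∅ (by simp)
  have hx₀M : x₀ ∉ maximalSet (massMeasure fQ) A := fun hm => hx₀Ω (Or.inr hm)
  have hmassP : ∫⁻ y, ‖fP y‖ₑ ≤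
      ENNReal.ofReal (A * (4 * d) ^ d) * volume (gridCube t P) := by
    calc ∫⁻ y, ‖fP y‖ₑ ≤ ∫⁻ y in Metric.closedBall x₀ (4 * r), ‖fQ y‖ₑ := by
          rw [← lintegral_indicator measurableSet_closedBall]
          refine lintegral_mono fun y => ?_
          by_cases hy : y ∈ starBall t P
          · rw [Set.indicator_of_mem]
            · exact hfPle y
            · rw [starBall, Metric.mem_ball, dist_eq_norm] at hy
              rw [Metric.mem_closedBall, dist_eq_norm]
              have h1 := norm_sub_le_of_mem t (cubeCorner_mem t P) hx₀P
              have h2 := norm_sub_le_norm_sub_add_norm_sub y (cubeCorner t P) x₀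
              rw [hrdef]; linarith
          · simp [hfP, hy]
      _ ≤ ENNReal.ofReal (A * (4 * r) ^ d) :=
          lintegral_closedBall_le_of_notMem hx₀M (by positivity)
      _ = _ := by
          rw [volume_gridCube, ← ENNReal.ofReal_mul (by positivity), cubeVol, hrdef]
          congr 1
          rw [mul_assoc, ← mul_pow]
          ring_nf
  -- At this level the weak type bound for `fP`, whose mass is at most `A (4d)^d |P|`, excludes at
  -- most a quarter of `P`, while `Ω` excludes at most half. The `+ 1` keeps the level positive if
  -- `W = 0`.
  set A₂ : ℝ := 4 * W * A * (4 * d) ^ d + 1 with hA₂def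
  have hA₂ : 0 < A₂ := by positivity
  have hbad : 4 * volume {x | ENNReal.ofReal A₂ ≤ ‖S fP x‖ₑ} ≤ volume (gridCube t P) := by
    have h1 := h.weakType fP hfPi A₂ hA₂
    calc 4 * volume {x | ENNReal.ofReal A₂ ≤ ‖S fP x‖ₑ}
        ≤ 4 * (W * (ENNReal.ofReal (A * (4 * d) ^ d) * volume (gridCube t P)) /
            ENNReal.ofReal A₂) := by
          gcongr
          refine h1.trans ?_
          gcongr
      _ = ENNReal.ofReal (4 * W * A * (4 * d) ^ d) / ENNReal.ofReal A₂ *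
            volume (gridCube t P) := by
          have e : ENNReal.ofReal (4 * W * A * (4 * d) ^ d) =
              4 * W * ENNReal.ofReal (A * (4 * d) ^ d) := by
            rw [mul_assoc, ENNReal.ofReal_mul (by positivity), ENNReal.ofReal_mul (by norm_num)]
            simp
          rw [e]
          simp only [div_eq_mul_inv]
          ring
      _ ≤ 1 * volume (gridCube t P) := by
          gcongr
          refine ENNReal.div_le_of_le_mul ?_
          rw [one_mul]
          exact ENNReal.ofReal_le_ofReal (by linarith)
      _ = _ := one_mul _
  -- The null set where the almost everywhere identities fail is included, so that they hold at the
  -- chosen point `x₁`.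
  set N : Set (Rd d) := {x | ENNReal.ofReal A₂ ≤ ‖S fP x‖ₑ} ∪
    {x | ¬ (S fQ x = S fP x + S g x ∧ (x ∈ starBall t P → S g x = ∫ y, K x y * g y))}
  have hNull : volume {x | ¬ (S fQ x = S fP x + S g x ∧
      (x ∈ starBall t P → S g x = ∫ y, K x y * g y))} = 0 := by
    have : ∀ᵐ x, S fQ x = S fP x + S g x ∧
        (x ∈ starBall t P → S g x = ∫ y, K x y * g y) := hSg.and hrep
    exact this
  have hN' : volume N ≤ volume {x | ENNReal.ofReal A₂ ≤ ‖S fP x‖ₑ} := by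
    refine (measure_union_le _ _).trans ?_
    rw [hNull, add_zero]
  have hN : 4 * volume (gridCube t P ∩ N) ≤ volume (gridCube t P) :=
    (mul_le_mul_right ((measure_mono Set.inter_subset_right).trans hN') 4).trans hbad
  obtain ⟨x₁, hx₁P, hx₁Ω, hx₁N⟩ := hlt_of N hN
  simp only [N, Set.mem_union, Set.mem_ofPred_eq, not_or, not_not, not_le] at hx₁N
  obtain ⟨hx₁S, hx₁eq, hx₁rep⟩ := hx₁N
  have hx₁Q : ‖S fQ x₁‖ ≤ A := by
    have h1 : ‖S fQ x₁‖ₑ < ENNReal.ofReal A := by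
      by_contra! hc
      exact hx₁Ω (Or.inl hc)
    rw [← ofReal_norm] at h1
    exact ((ENNReal.ofReal_lt_ofReal_iff hA).1 h1).le
  have hx₁S' : ‖S fP x₁‖ ≤ A₂ := by
    rw [← ofReal_norm] at hx₁S
    exact ((ENNReal.ofReal_lt_ofReal_iff hA₂).1 hx₁S).le
  have hx₁g : ‖S g x₁‖ ≤ A + A₂ := by
    have e : S g x₁ = S fQ x₁ - S fP x₁ := by rw [hx₁eq]; ring
    rw [e]
    exact (norm_sub_le _ _).trans (add_le_add hx₁Q hx₁S')
  have hfar : ∀ x ∈ gridCube t P, ∀ y, g y ≠ 0 → 2 * r ≤ ‖x - y‖ := fun x hx y hy =>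
    norm_sub_ge_of_notMem_starBall t hx fun hyP => hy (hgP y hyP)
  filter_upwards [hSg, hrep] with x hx1 hx2 hxP
  -- The ball of radius `s ≥ 2r` about `x` lies in the ball of radius `2s` about `x₀`, a point of
  -- `P` outside the maximal set; hence the factor `2^d`.
  have hosc := h.norm_integral_sub_le hgi hr (M := 2 ^ d * A) (by positivity)
    (norm_sub_le_of_mem t hxP hx₁P) (hfar x hxP) (hfar x₁ hx₁P) (fun s hs => by
      calc ∫⁻ y in Metric.closedBall x s, ‖g y‖ₑ
          ≤ ∫⁻ y in Metric.closedBall x₀ (2 * s), ‖fQ y‖ₑ := by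
            refine (lintegral_mono hgle).trans (lintegral_mono_set ?_)
            refine Metric.closedBall_subset_closedBall' ?_
            rw [dist_eq_norm]
            have := norm_sub_le_of_mem t hxP hx₀P
            linarith
        _ ≤ ENNReal.ofReal (A * (2 * s) ^ d) :=
            lintegral_closedBall_le_of_notMem hx₀M (by linarith)
        _ = _ := by rw [mul_pow]; congr 1; ring)
  have hSx : S g x = ∫ y, K x y * g y := hx2 (gridCube_subset_starBall hd t P hxP)
  have hSx₁ : S g x₁ = ∫ y, K x₁ y * g y := hx₁rep (gridCube_subset_starBall hd t P hx₁P)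
  rw [← hSx, ← hSx₁] at hosc
  have e : S fQ x - S fP x = S g x₁ + (S g x - S g x₁) := by rw [hx1]; ring
  rw [e]
  exact (norm_add_le _ _).trans (add_le_add hx₁g hosc)

/-- The exceptional set consists of the points where the localized operator or the maximal function
is large. By the two weak type bounds its measure is at most `B ε / A` times that of `Q`, and `A >
B`. -/
theorem IsWeakCZ.exists_isLocallyControlled (hd : 0 < d) (h : IsWeakCZ S K C δ W)
    {ε : ENNReal} (hε0 : ε ≠ 0) (hεt : ε ≠ ⊤) :
    ∃ C' : ℝ, ∀ (t : Fin d → ℤˣ) (F : Rd d → κ → 𝕜), Integrable F volume →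
      IsLocallyControlled t (starBall t) F (localOp S t F) ε C' := by
  set B : ENNReal := (W * 2 + 5 ^ d * unitBallVol d * 2) / ε with hB
  have hBt : B ≠ ⊤ := by
    refine ENNReal.div_ne_top ?_ hε0
    have := unitBallVol_ne_top (d := d)
    finiteness
  set A : ℝ := B.toReal + 1 with hAdef
  have hA : 0 < A := by positivity
  have hC := h.nonneg
  have hq1 : (2 : ℝ) ^ (-δ) < 1 :=
    Real.rpow_lt_one_of_one_lt_of_neg (by norm_num) (by linarith [h.pos])
  have hq2 : 0 < 1 - (2 : ℝ) ^ (-δ) := by linarith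
  have hx : 0 ≤ C * (2 ^ d / (1 - 2 ^ (-δ)) * (2 ^ d * A)) := by positivity
  have hy : 0 ≤ 4 * W * A * (4 * (d : ℝ)) ^ d + 1 := by positivity
  refine ⟨A + (4 * W * A * (4 * d) ^ d + 1) + C * (2 ^ d / (1 - 2 ^ (-δ)) * (2 ^ d * A)),
    fun t F hF => ⟨hF, fun Q => aestronglyMeasurable_of_eval fun i =>
      h.aestronglyMeasurable _ ((hF.eval i).indicator measurableSet_ball),
      fun Q => measurableSet_ball, fun P Q => starBall_mono hd t, by positivity,
      fun Q c hc => ?_, fun Q c hc => ?_⟩⟩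
  · have h0 : (starBall t Q).indicator (fun y => c (F y)) =ᵐ[volume] 0 := by
      filter_upwards [hc] with x hx
      exact Set.indicator_apply_eq_zero.2 hx
    filter_upwards [h.functional_localOp t hF Q c, h.ae_eq_zero h0] with x hx1 hx2 _
    rw [hx1, hx2]
  · set f : Rd d → 𝕜 := fun y => c (F y) with hf
    have hfi : Integrable f volume := functional_integrable c hF
    have hmass : ∫⁻ x, ‖(starBall t Q).indicator f x‖ₑ ≤ 2 * volume (gridCube t Q) := by
      refine le_trans (le_of_eq ?_) hc
      have hm : MeasurableSet (starBall t Q) := measurableSet_ball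
      rw [← lintegral_indicator hm]
      exact lintegral_congr fun x => enorm_indicator_eq_indicator_enorm _ _
    have hfQi : Integrable ((starBall t Q).indicator f) volume := hfi.indicator measurableSet_ball
    refine ⟨{x | ENNReal.ofReal A ≤ ‖S ((starBall t Q).indicator f) x‖ₑ} ∪
      maximalSet (massMeasure ((starBall t Q).indicator f)) A, ?_, ?_, fun P hl hPQ hhalf => ?_⟩
    · have hA' : ENNReal.ofReal A ≠ 0 := by simpa using hA
      calc _ ≤ W * (2 * volume (gridCube t Q)) / ENNReal.ofReal A +
            5 ^ d * unitBallVol d * (2 * volume (gridCube t Q)) / ENNReal.ofReal A := by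
            refine (measure_union_le _ _).trans (add_le_add ?_ ?_)
            · refine (h.weakType _ hfQi A hA).trans ?_
              gcongr
            · refine (volume_maximalSet_massMeasure_le hd hfQi hA).trans ?_
              gcongr
        _ = (W * 2 + 5 ^ d * unitBallVol d * 2) / ENNReal.ofReal A * volume (gridCube t Q) := by
            simp only [div_eq_mul_inv]; ring
        _ ≤ ε * volume (gridCube t Q) := by
            gcongr
            refine ENNReal.div_le_of_le_mul ?_
            rw [← ENNReal.div_le_iff' hε0 hεt, ← hB, ← ENNReal.ofReal_toReal hBt]
            exact ENNReal.ofReal_le_ofReal (by linarith)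
    · filter_upwards [h.functional_localOp t hF Q c] with x hx1 _ hxΩ
      rw [hx1]
      have h1 : ‖S ((starBall t Q).indicator f) x‖ₑ < ENNReal.ofReal A := by
        by_contra! hcon
        exact hxΩ (Or.inl hcon)
      rw [← ofReal_norm] at h1
      have := (ENNReal.ofReal_lt_ofReal_iff hA).1 h1
      linarith
    · filter_upwards [h.functional_localOp t hF Q c, h.functional_localOp t hF P c,
        h.norm_sub_le_of_subcube hd t hfi hl hPQ hA hhalf] with x hx1 hx2 hx3 hxP
      rw [hx1, hx2]
      exact hx3 hxP

end Local

/-! ### From averages over dilates to averages over cubes of shifted grids. -/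

section Aggregate
variable {d : ℕ} {𝕜 κ : Type*} [RCLike 𝕜] [Fintype κ]

theorem functional_avgTerm {t : Fin d → ℤˣ} {F : Rd d → κ → 𝕜} (hF : Integrable F volume)
    {s : Set (Rd d)} {k : Rd d → Rd d → 𝕜} (hk : Measurable (Function.uncurry k)) {M : ℝ}
    (hM : ∀ x y, ‖k x y‖ ≤ M) {Q : CubeLabel d} {x : Rd d} (hx : x ∈ gridCube t Q)
    (c : (κ → 𝕜) →ₗ[𝕜] 𝕜) :
    c (avgTerm t F s k Q x) = (cubeVol d Q.1)⁻¹ • ∫ y in s, k x y * c (F y) := by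
  have hi : Integrable (fun y => k x y • F y) (volume.restrict s) :=
    (integrable_bounded_smul hF (hk.comp measurable_prodMk_left) (hM x)).restrict
  rw [avgTerm, Set.indicator_of_mem hx, functional_real_smul, functional_integral c hi]
  simp only [map_smul, smul_eq_mul]

theorem enorm_functional_avgTerm_le {t : Fin d → ℤˣ} {F : Rd d → κ → 𝕜}
    (hF : Integrable F volume) {s : Set (Rd d)} {k : Rd d → Rd d → 𝕜}
    (hk : Measurable (Function.uncurry k)) {M : ℝ} (hM : ∀ x y, ‖k x y‖ ≤ M) {Q : CubeLabel d}
    {x : Rd d} (hx : x ∈ gridCube t Q) (c : (κ → 𝕜) →ₗ[𝕜] 𝕜) :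
    ‖c (avgTerm t F s k Q x)‖ₑ ≤
      ENNReal.ofReal ((cubeVol d Q.1)⁻¹ * M) * ∫⁻ y in s, ‖c (F y)‖ₑ := by
  have hp := cubeVol_pos (d := d) Q.1
  rw [functional_avgTerm hF hk hM hx, enorm_smul, Real.enorm_of_nonneg (by positivity),
    ENNReal.ofReal_mul (by positivity), mul_assoc,
    ← lintegral_const_mul' _ _ ENNReal.ofReal_ne_top]
  gcongr
  refine (enorm_integral_le_lintegral_enorm _).trans (lintegral_mono fun y => ?_)
  rw [enorm_mul]
  gcongr
  rw [← ofReal_norm]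
  exact ENNReal.ofReal_le_ofReal (hM x y)

theorem aestronglyMeasurable_avgTerm {t : Fin d → ℤˣ} {F : Rd d → κ → 𝕜}
    (hF : Integrable F volume) {s : Set (Rd d)} {k : Rd d → Rd d → 𝕜}
    (hk : Measurable (Function.uncurry k)) (Q : CubeLabel d) :
    AEStronglyMeasurable (avgTerm t F s k Q) volume := by
  have h1 : AEStronglyMeasurable (fun p : Rd d × Rd d => k p.1 p.2 • F p.2)
      (volume.prod (volume.restrict s)) :=
    AEStronglyMeasurable.smul hk.aestronglyMeasurable hF.1.restrict.comp_snd
  exact (h1.integral_prod_right'.const_smul (cubeVol d Q.1)⁻¹).indicator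
    (measurableSet_gridCube t Q)

/-- The cubes of `𝓕` whose cover in the grid `t` lies in `P`. -/
def coveredBy (t : Fin d → ℤˣ) (𝓕 : Set (CubeLabel d)) (R : CubeLabel d → CubeLabel d)
    (P : CubeLabel d) : Set (CubeLabel d) :=
  {Q | Q ∈ 𝓕 ∧ gridCube t (R Q) ⊆ gridCube t P}

/-- The sum of the functions `b Q` over the cubes whose cover lies in `P`. -/
noncomputable def aggregate (t : Fin d → ℤˣ) (𝓕 : Set (CubeLabel d))
    (R : CubeLabel d → CubeLabel d) (b : CubeLabel d → Rd d → κ → 𝕜) (P : CubeLabel d)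
    (x : Rd d) : κ → 𝕜 :=
  ∑' Q, (coveredBy t 𝓕 R P).indicator (fun Q => b Q x) Q

/-- The number of covers inside `P` that contain `x`. -/
noncomputable def overlapCount (t : Fin d → ℤˣ) (𝓕 : Set (CubeLabel d))
    (R : CubeLabel d → CubeLabel d) (P : CubeLabel d) (x : Rd d) : ENNReal :=
  ∑' Q : coveredBy t 𝓕 R P, (gridCube t (R Q)).indicator 1 x

theorem measurable_overlapCount (t : Fin d → ℤˣ) (𝓕 : Set (CubeLabel d))
    (R : CubeLabel d → CubeLabel d) (P : CubeLabel d) : Measurable (overlapCount t 𝓕 R P) :=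
  Measurable.tsum fun _ => measurable_one.indicator (measurableSet_gridCube t _)

/-- A cover has volume `2^(sd) |Q| ≤ 2^(sd+1) |E Q|`, and the sets `E Q` are disjoint subsets of
`P`. -/
theorem lintegral_overlapCount_le {t₀ t : Fin d → ℤˣ} {𝓕 : Set (CubeLabel d)}
    {E : CubeLabel d → Set (Rd d)} (h𝓕 : IsSparseFamily t₀ 𝓕 E) {R : CubeLabel d → CubeLabel d}
    {s : ℕ} (hlev : ∀ Q ∈ 𝓕, (R Q).1 = Q.1 + s)
    (hsub : ∀ Q ∈ 𝓕, gridCube t₀ Q ⊆ gridCube t (R Q)) (P : CubeLabel d) :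
    ∫⁻ x, overlapCount t 𝓕 R P x ≤ 2 ^ (s * d + 1) * volume (gridCube t P) := by
  unfold overlapCount
  rw [lintegral_tsum fun _ => (measurable_one.indicator (measurableSet_gridCube t _)).aemeasurable]
  calc ∑' Q : coveredBy t 𝓕 R P, ∫⁻ x, (gridCube t (R Q)).indicator 1 x
      ≤ ∑' Q : coveredBy t 𝓕 R P, 2 ^ (s * d + 1) * volume (E Q) := by
        refine ENNReal.tsum_le_tsum fun Q => ?_
        rw [lintegral_indicator_one (measurableSet_gridCube t _), volume_gridCube,
          hlev _ Q.2.1, cubeVol_add_nat, ENNReal.ofReal_mul (by positivity),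
          ENNReal.ofReal_pow (by norm_num), ENNReal.ofReal_ofNat, ← volume_gridCube t₀ Q, pow_succ,
          mul_assoc]
        gcongr
        exact (h𝓕.1 _ Q.2.1).2.2
    _ = 2 ^ (s * d + 1) * ∑' Q : coveredBy t 𝓕 R P, volume (E Q) := ENNReal.tsum_mul_left
    _ ≤ 2 ^ (s * d + 1) * volume (gridCube t P) := by
        gcongr
        refine (tsum_meas_le_meas_iUnion_of_disjoint volume
          (As := fun Q : coveredBy t 𝓕 R P => E Q) (fun Q => (h𝓕.1 _ Q.2.1).1) ?_).trans
          (measure_mono ?_)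
        · intro Q Q' hne
          exact h𝓕.2 Q.2.1 Q'.2.1 fun h => hne (Subtype.ext h)
        · refine Set.iUnion_subset fun Q => ?_
          exact (h𝓕.1 _ Q.2.1).2.1.trans ((hsub _ Q.2.1).trans Q.2.2)

/-- Below the level `n` of the overlap count, at most `n` covers contain `x`. -/
theorem exists_finset_of_overlapCount_le {t : Fin d → ℤˣ} {𝓕 : Set (CubeLabel d)}
    {R : CubeLabel d → CubeLabel d} {P : CubeLabel d} {x : Rd d} {n : ENNReal}
    (hn : n ≠ ⊤) (hx : overlapCount t 𝓕 R P x ≤ n) :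
    ∃ N : Finset (CubeLabel d), (N.card : ENNReal) ≤ n ∧
      ∀ Q ∈ coveredBy t 𝓕 R P, x ∈ gridCube t (R Q) → Q ∈ N := by
  obtain ⟨hf, hc⟩ := ENNReal.finset_card_const_le_le_of_tsum_le hn hx one_ne_zero
  refine ⟨hf.toFinset.map (Function.Embedding.subtype _), ?_, fun Q hQ hxQ => ?_⟩
  · rw [Finset.card_map]
    simpa using hc
  · simp only [Finset.mem_map, Set.Finite.mem_toFinset, Set.mem_ofPred_eq]
    refine ⟨⟨Q, hQ⟩, ?_, rfl⟩
    simp [hxQ]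

/-- Sums of averages over dilates satisfy the same local control, now with the cubes themselves in
place of their dilates. Where few covers overlap and the maximal function of `c(F)` is small, there
are boundedly many terms, each of them bounded. -/
theorem exists_isLocallyControlled_aggregate (hd : 0 < d) (s : ℕ) {M : ℝ} (hM0 : 0 ≤ M)
    {ε : ENNReal} (hε0 : ε ≠ 0) (hεt : ε ≠ ⊤) :
    ∃ C : ℝ, ∀ (t₀ t : Fin d → ℤˣ) (𝓕 : Set (CubeLabel d)) (E : CubeLabel d → Set (Rd d))
      (R : CubeLabel d → CubeLabel d) (star : CubeLabel d → Set (Rd d))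
      (k : CubeLabel d → Rd d → Rd d → 𝕜) (F : Rd d → κ → 𝕜), Integrable F volume →
      IsSparseFamily t₀ 𝓕 E → (∀ Q ∈ 𝓕, (R Q).1 = Q.1 + s) →
      (∀ Q ∈ 𝓕, gridCube t₀ Q ⊆ gridCube t (R Q)) → (∀ Q ∈ 𝓕, star Q ⊆ gridCube t (R Q)) →
      (∀ Q, Measurable (Function.uncurry (k Q)) ∧ ∀ x y, ‖k Q x y‖ ≤ M) →
      IsLocallyControlled t (gridCube t) F
        (aggregate t 𝓕 R fun Q => avgTerm t₀ F (star Q) (k Q) Q) ε C ∧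
      ∀ P, ∀ᵐ x, Summable fun Q =>
        (coveredBy t 𝓕 R P).indicator (fun Q => avgTerm t₀ F (star Q) (k Q) Q x) Q := by
  set B : ENNReal := (5 ^ d * unitBallVol d * 2 + 2 ^ (s * d + 1)) / ε with hB
  have hBt : B ≠ ⊤ := by
    refine ENNReal.div_ne_top ?_ hε0
    have := unitBallVol_ne_top (d := d)
    finiteness
  set A : ℝ := B.toReal + 1 with hAdef
  have hA : 0 < A := by positivity
  set C₁ : ℝ := M * A * (d * 2 ^ s) ^ d with hC₁
  have hC₁0 : 0 ≤ C₁ := by positivity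
  refine ⟨A * C₁, fun t₀ t 𝓕 E R star k F hF h𝓕 hlev hsub hstar hk => ?_⟩
  set b : CubeLabel d → Rd d → κ → 𝕜 := fun Q => avgTerm t₀ F (star Q) (k Q) Q with hb
  have hb0 : ∀ Q x, x ∉ gridCube t₀ Q → b Q x = 0 := fun Q x hx => Set.indicator_of_notMem hx _
  -- almost everywhere only finitely many covers contain `x`
  have hfin : ∀ P, ∀ᵐ x, overlapCount t 𝓕 R P x < ⊤ := fun P =>
    ae_lt_top (measurable_overlapCount t 𝓕 R P) (ne_top_of_le_ne_top (by
      have := volume_gridCube_ne_top t P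
      finiteness) (lintegral_overlapCount_le h𝓕 hlev hsub P))
  have hsupp : ∀ P x, overlapCount t 𝓕 R P x < ⊤ → ∃ N : Finset (CubeLabel d),
      ∀ Q ∉ N, (coveredBy t 𝓕 R P).indicator (fun Q => b Q x) Q = 0 := fun P x hx => by
    obtain ⟨N, -, hN⟩ := exists_finset_of_overlapCount_le hx.ne le_rfl
    refine ⟨N, fun Q hQ => Set.indicator_apply_eq_zero.2 fun hQP => hb0 Q x fun hxQ => hQ ?_⟩
    exact hN Q hQP (hsub Q hQP.1 hxQ)
  have hsum : ∀ P, ∀ᵐ x, Summable fun Q =>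
      (coveredBy t 𝓕 R P).indicator (fun Q => b Q x) Q := fun P => by
    filter_upwards [hfin P] with x hx
    obtain ⟨N, hN⟩ := hsupp P x hx
    exact summable_of_ne_finset_zero hN
  -- the estimate for a part of the sum
  have hpart : ∀ (P : CubeLabel d) (c : (κ → 𝕜) →ₗ[𝕜] 𝕜) (x x₀ : Rd d)
      (𝒢 : Set (CubeLabel d)), 𝒢 ⊆ coveredBy t 𝓕 R P →
      (∀ Q ∈ 𝒢, x ∈ gridCube t₀ Q → x₀ ∈ gridCube t (R Q)) →
      overlapCount t 𝓕 R P x₀ ≤ ENNReal.ofReal A →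
      x₀ ∉ maximalSet (massMeasure ((gridCube t P).indicator fun y => c (F y))) A →
      ‖c (∑' Q, 𝒢.indicator (fun Q => b Q x) Q)‖ ≤ A * C₁ := by
    intro P c x x₀ 𝒢 h𝒢 hx₀ hcount hmax
    obtain ⟨N, hNc, hN⟩ := exists_finset_of_overlapCount_le ENNReal.ofReal_ne_top hcount
    have hz : ∀ Q ∉ N, 𝒢.indicator (fun Q => b Q x) Q = 0 := fun Q hQ =>
      Set.indicator_apply_eq_zero.2 fun hQ𝒢 => hb0 Q x fun hxQ =>
        hQ (hN Q (h𝒢 hQ𝒢) (hx₀ Q hQ𝒢 hxQ))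
    have hterm : ∀ Q, ‖c (𝒢.indicator (fun Q => b Q x) Q)‖ ≤ C₁ := fun Q => by
      by_cases hQ : Q ∈ 𝒢 ∧ x ∈ gridCube t₀ Q
      · obtain ⟨hQ𝒢, hxQ⟩ := hQ
        obtain ⟨hQ𝓕, hQP⟩ := h𝒢 hQ𝒢
        rw [Set.indicator_of_mem hQ𝒢]
        have hp := cubeVol_pos (d := d) Q.1
        have h1 := enorm_functional_avgTerm_le (s := star Q) hF (hk Q).1 (hk Q).2 hxQ c
        have h2 : ∫⁻ y in star Q, ‖c (F y)‖ₑ ≤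
            ENNReal.ofReal (A * (d * 2 ^ s) ^ d * cubeVol d Q.1) := by
          calc ∫⁻ y in star Q, ‖c (F y)‖ₑ ≤ ∫⁻ y in gridCube t (R Q), ‖c (F y)‖ₑ :=
                lintegral_mono_set (hstar Q hQ𝓕)
            _ = ∫⁻ y in gridCube t (R Q), ‖(gridCube t P).indicator (fun y => c (F y)) y‖ₑ := by
                refine setLIntegral_congr_fun (measurableSet_gridCube t _) fun y hy => ?_
                simp only [Set.indicator_of_mem (hQP hy)]
            _ ≤ ∫⁻ y in Metric.closedBall x₀ (d * 2 ^ (R Q).1),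
                  ‖(gridCube t P).indicator (fun y => c (F y)) y‖ₑ := by
                refine lintegral_mono_set fun y hy => ?_
                rw [Metric.mem_closedBall, dist_eq_norm]
                exact norm_sub_le_of_mem t hy (hx₀ Q hQ𝒢 hxQ)
            _ ≤ ENNReal.ofReal (A * (d * 2 ^ (R Q).1) ^ d) :=
                lintegral_closedBall_le_of_notMem hmax (by
                  have := two_zpow_pos (R Q).1
                  have : (0 : ℝ) < d := by exact_mod_cast hd
                  positivity)
            _ = _ := by
                rw [hlev Q hQ𝓕, zpow_add₀ (by norm_num), zpow_natCast, cubeVol]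
                congr 1
                ring
        have h3 : ‖c (b Q x)‖ₑ ≤ ENNReal.ofReal C₁ := by
          refine h1.trans ((mul_le_mul_right h2 _).trans (le_of_eq ?_))
          rw [← ENNReal.ofReal_mul (by positivity), hC₁]
          congr 1
          field_simp
        rw [← ofReal_norm] at h3
        exact (ENNReal.ofReal_le_ofReal_iff hC₁0).1 h3
      · have : 𝒢.indicator (fun Q => b Q x) Q = 0 :=
          Set.indicator_apply_eq_zero.2 fun hQ𝒢 => hb0 Q x fun hxQ => hQ ⟨hQ𝒢, hxQ⟩
        rw [this, map_zero, norm_zero]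
        exact hC₁0
    rw [tsum_eq_sum hz, map_sum]
    refine (norm_sum_le _ _).trans ((Finset.sum_le_card_nsmul _ _ _ fun Q _ => hterm Q).trans ?_)
    rw [nsmul_eq_mul]
    gcongr
    rw [← ENNReal.ofReal_natCast] at hNc
    exact (ENNReal.ofReal_le_ofReal_iff hA.le).1 hNc
  refine ⟨⟨hF, fun P => ?_, measurableSet_gridCube t, fun P Q _ h => h, by positivity,
    fun P c hc => ?_, fun P c hc => ?_⟩, hsum⟩
  · refine aestronglyMeasurable_of_tendsto_ae (atTop : Filter (Finset (CubeLabel d)))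
      (f := fun N x => ∑ Q ∈ N, (coveredBy t 𝓕 R P).indicator (fun Q => b Q x) Q) (fun N => ?_) ?_
    · refine Finset.aestronglyMeasurable_fun_sum _ fun Q _ => ?_
      by_cases hQ : Q ∈ coveredBy t 𝓕 R P
      · simp only [Set.indicator_of_mem hQ]
        exact aestronglyMeasurable_avgTerm hF (hk Q).1 Q
      · simp only [Set.indicator_of_notMem hQ]
        exact aestronglyMeasurable_const
    · filter_upwards [hsum P] with x hx
      exact hx.hasSum
  · filter_upwards [hfin P] with x hx _
    obtain ⟨N, hN⟩ := hsupp P x hx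
    rw [aggregate, tsum_eq_sum hN, map_sum]
    refine Finset.sum_eq_zero fun Q _ => ?_
    by_cases hQ : Q ∈ coveredBy t 𝓕 R P
    · rw [Set.indicator_of_mem hQ]
      by_cases hxQ : x ∈ gridCube t₀ Q
      · have h1 := enorm_functional_avgTerm_le (s := star Q) hF (hk Q).1 (hk Q).2 hxQ c
        have h2 : ∫⁻ y in star Q, ‖c (F y)‖ₑ = 0 := by
          refine le_antisymm ((lintegral_mono_set ((hstar Q hQ.1).trans hQ.2)).trans
            (le_of_eq ?_)) (zero_le)
          rw [setLIntegral_congr_fun_ae (g := fun _ => 0) (measurableSet_gridCube t P)]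
          · simp
          · filter_upwards [hc] with y hy hyP
            rw [hy hyP, enorm_zero]
        rw [h2, mul_zero, nonpos_iff_eq_zero, enorm_eq_zero] at h1
        exact h1
      · rw [hb0 Q x hxQ, map_zero]
    · rw [Set.indicator_of_notMem hQ, map_zero]
  · set g := (gridCube t P).indicator fun y => c (F y) with hg
    have hgi : Integrable g volume :=
      (functional_integrable c hF).indicator (measurableSet_gridCube t P)
    have hmass : ∫⁻ x, ‖g x‖ₑ ≤ 2 * volume (gridCube t P) := by
      refine le_trans (le_of_eq ?_) hc
      rw [← lintegral_indicator (measurableSet_gridCube t P)]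
      exact lintegral_congr fun x => enorm_indicator_eq_indicator_enorm _ _
    have hA' : ENNReal.ofReal A ≠ 0 := by simpa using hA
    refine ⟨maximalSet (massMeasure g) A ∪ {x | ENNReal.ofReal A ≤ overlapCount t 𝓕 R P x},
      ?_, ?_, fun P' hl hPP hhalf => ?_⟩
    · calc _ ≤ 5 ^ d * unitBallVol d * (2 * volume (gridCube t P)) / ENNReal.ofReal A +
            2 ^ (s * d + 1) * volume (gridCube t P) / ENNReal.ofReal A := by
            refine (measure_union_le _ _).trans (add_le_add ?_ ?_)
            · refine (volume_maximalSet_massMeasure_le hd hgi hA).trans ?_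
              gcongr
            · refine (meas_ge_le_lintegral_div (measurable_overlapCount t 𝓕 R P).aemeasurable
                hA' ENNReal.ofReal_ne_top).trans ?_
              gcongr
              exact lintegral_overlapCount_le h𝓕 hlev hsub P
        _ = (5 ^ d * unitBallVol d * 2 + 2 ^ (s * d + 1)) / ENNReal.ofReal A *
              volume (gridCube t P) := by
            simp only [div_eq_mul_inv]; ring
        _ ≤ ε * volume (gridCube t P) := by
            gcongr
            refine ENNReal.div_le_of_le_mul ?_
            rw [← ENNReal.div_le_iff' hε0 hεt, ← hB, ← ENNReal.ofReal_toReal hBt]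
            exact ENNReal.ofReal_le_ofReal (by linarith)
    · refine Eventually.of_forall fun x _ hxΩ => ?_
      rw [Set.mem_union, not_or, Set.mem_ofPred_eq, not_le] at hxΩ
      exact hpart P c x x _ subset_rfl (fun Q hQ hx => hsub Q hQ.1 hx) hxΩ.2.le hxΩ.1
    -- At least half of `P'` lies outside the exceptional set. One such point `x₀` controls the sum
    -- at every `x` in `P'`.
    · obtain ⟨x₀, hx₀P, hx₀⟩ : ∃ x ∈ gridCube t P', x ∉ maximalSet (massMeasure g) A ∪
          {x | ENNReal.ofReal A ≤ overlapCount t 𝓕 R P x} := by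
        by_contra! hcon
        rw [Set.inter_eq_left.2 hcon] at hhalf
        have h2 : 2 * volume (gridCube t P') ≤ 1 * volume (gridCube t P') := by rwa [one_mul]
        have h3 := (ENNReal.mul_le_mul_iff_left (volume_gridCube_ne_zero t P')
          (volume_gridCube_ne_top t P')).1 h2
        norm_num at h3
      rw [Set.mem_union, not_or, Set.mem_ofPred_eq, not_le] at hx₀
      filter_upwards [hsum P, hsum P'] with x hx hx' hxP
      have hsubP : coveredBy t 𝓕 R P' ⊆ coveredBy t 𝓕 R P := fun Q hQ => ⟨hQ.1, hQ.2.trans hPP⟩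
      have e : aggregate t 𝓕 R b P x - aggregate t 𝓕 R b P' x =
          ∑' Q, (coveredBy t 𝓕 R P \ coveredBy t 𝓕 R P').indicator (fun Q => b Q x) Q := by
        rw [aggregate, aggregate, ← hx.tsum_sub hx']
        refine tsum_congr fun Q => ?_
        rw [Set.indicator_sdiff hsubP, Pi.sub_apply]
      rw [← map_sub, e]
      -- A cover that contains `x` without being contained in `P'` contains all of `P'`, in
      -- particular `x₀`.
      refine hpart P c x x₀ _ Set.sdiff_subset (fun Q hQ hxQ => ?_) hx₀.2.le hx₀.1
      have hxR := hsub Q hQ.1.1 hxQ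
      have hle : P'.1 ≤ (R Q).1 := by
        by_contra! hlt
        exact hQ.2 ⟨hQ.1.1, gridCube_subset_of_le t hlt.le hxR hxP⟩
      exact gridCube_subset_of_le t hle hxP hxR hx₀P

end Aggregate

/-! ### Domination near the support and far from it. -/

section NearFar
variable {d : ℕ} {𝕜 κ : Type*} [RCLike 𝕜] [Fintype κ]
  {S : (Rd d → 𝕜) → Rd d → 𝕜} {K : Rd d → Rd d → 𝕜} {C δ : ℝ} {W : NNReal}

theorem exists_mul_lt_one {b : ENNReal} (hb : b ≠ ⊤) : ∃ ε : ENNReal, ε ≠ 0 ∧ ε ≠ ⊤ ∧ b * ε < 1 := by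
  obtain ⟨ε, h1, h2⟩ := exists_between (ENNReal.div_pos one_ne_zero hb)
  exact ⟨ε, h1.ne', h2.ne_top, by rw [mul_comm]; exact ENNReal.mul_lt_of_lt_div h2⟩

/-- Sparse domination with averages over the dilated cubes, passed to averages over the cubes of
the `2 ^ d` grids. -/
theorem IsWeakCZ.exists_sparse_near (κ : Type*) [Fintype κ] (hd : 0 < d)
    (h : IsWeakCZ S K C δ W) :
    ∃ M : ℝ, 0 ≤ M ∧ ∀ (F : Rd d → κ → 𝕜), Integrable F volume → ∀ Q₀ : CubeLabel d,
      (∀ x, F x ≠ 0 → x ∈ starBall 1 Q₀) →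
      ∃ (𝓢 : (Fin d → ℤˣ) → Set (CubeLabel d)) (E : (Fin d → ℤˣ) → CubeLabel d → Set (Rd d))
        (k : (Fin d → ℤˣ) → CubeLabel d → Rd d → Rd d → 𝕜),
        (∀ t, IsSparseFamily t (𝓢 t) (E t)) ∧
        (∀ t Q, Measurable (Function.uncurry (k t Q)) ∧ ∀ x y, ‖k t Q x y‖ ≤ M) ∧
        ∀ᵐ x, (∀ t, Summable fun Q =>
            (𝓢 t).indicator (fun Q => avgTerm t F (gridCube t Q) (k t Q) Q x) Q) ∧
          (gridCube 1 Q₀).indicator (fun x i => S (fun y => F y i) x) x =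
            ∑ t, ∑' Q, (𝓢 t).indicator (fun Q => avgTerm t F (gridCube t Q) (k t Q) Q x) Q := by
  classical
  obtain ⟨ε, hε0, hεt, hε⟩ := exists_mul_lt_one
    (b := (Fintype.card κ : ENNReal) * 2 ^ (d + 2)) (by finiteness)
  rw [mul_right_comm] at hε
  obtain ⟨C₁, hC₁⟩ := h.exists_isLocallyControlled (κ := κ) hd hε0 hεt
  have hC₁0 : 0 ≤ C₁ := (hC₁ 1 0 (integrable_zero _ _ _)).nonneg
  set M₁ : ℝ := Fintype.card κ * C₁
  obtain ⟨C₂, hC₂⟩ := exists_isLocallyControlled_aggregate (d := d) (𝕜 := 𝕜) (κ := κ) hd (21 * d)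
    (M := M₁) (by positivity) hε0 hεt
  -- Raising the level by `21 d` suffices: `21 d ≤ 2^(21 d)`, so the dilate of radius `3d 2^k` fits
  -- into a ball of radius `2^(k + 21 d) / 7`.
  choose τ hτ using fun Q : CubeLabel d =>
    exists_ball_subset_gridCube (Q.1 + (21 * d : ℕ)) (cubeCorner 1 Q)
  set R : CubeLabel d → CubeLabel d := fun Q =>
    cubeAt (τ Q) (Q.1 + (21 * d : ℕ)) (cubeCorner 1 Q) with hR
  have hstar : ∀ Q, starBall 1 Q ⊆ gridCube (τ Q) (R Q) := fun Q => by
    refine (Metric.ball_subset_ball ?_).trans (hτ Q)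
    have h1 : ((21 * d : ℕ) : ℝ) ≤ 2 ^ (21 * d) := by exact_mod_cast Nat.lt_two_pow_self.le
    have h2 := mul_le_mul_of_nonneg_left h1 (two_zpow_pos Q.1).le
    rw [zpow_add₀ (by norm_num), zpow_natCast]
    push_cast at h2
    linarith
  have hC₂0 : 0 ≤ C₂ := ((hC₂ 1 1 ∅ (fun _ => ∅) R (fun _ => ∅) (fun _ _ _ => 0) 0
    (integrable_zero _ _ _) ⟨by simp, by simp⟩ (by simp) (by simp) (by simp) (fun Q =>
      ⟨measurable_const, fun x y => by rw [norm_zero]; positivity⟩)).1).nonneg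
  refine ⟨Fintype.card κ * C₂, by positivity, fun F hF Q₀ hsupp => ?_⟩
  -- First domination, with averages over the dilates. The second one, below, is applied in each
  -- grid `t` to the terms whose cover lies in that grid.
  obtain ⟨𝓕, E, k, h𝓕, htop, hk, hsum⟩ := (hC₁ 1 F hF).exists_sparse hd hε Q₀
  set b : CubeLabel d → Rd d → κ → 𝕜 := fun Q => avgTerm 1 F (starBall 1 Q) (k Q) Q with hb
  set 𝓕' : (Fin d → ℤˣ) → Set (CubeLabel d) := fun t => {Q | Q ∈ 𝓕 ∧ τ Q = t} with h𝓕'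
  have hctrl := fun t => hC₂ 1 t (𝓕' t) E R (starBall 1) k F hF
    ⟨fun Q hQ => h𝓕.1 Q hQ.1, h𝓕.2.subset fun Q hQ => hQ.1⟩ (fun Q _ => rfl)
    (fun Q hQ => by
      have := (gridCube_subset_starBall hd 1 Q).trans (hstar Q)
      rwa [hQ.2] at this)
    (fun Q hQ => by have := hstar Q; rwa [hQ.2] at this) hk
  obtain ⟨k₁, hk₁⟩ := exists_norm_lt_two_zpow (‖cubeCorner 1 Q₀‖ + d * 2 ^ Q₀.1)
  -- At this level the cube around the origin contains `Q₀` in every grid and is no smaller than the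
  -- covers, hence contains all of them.
  set k₂ : ℤ := max k₁ (Q₀.1 + (21 * d : ℕ))
  have hk₂ : ∀ x ∈ gridCube 1 Q₀, ∀ t, x ∈ gridCube t (cubeAt t k₂ 0) := fun x hx t => by
    refine gridIdx_eq_zero_of_norm_lt t (k := k₂) ?_
    have h1 := norm_sub_le_of_mem 1 hx (cubeCorner_mem 1 Q₀)
    have h2 := norm_le_norm_add_norm_sub' x (cubeCorner 1 Q₀)
    have h3 : (2 : ℝ) ^ k₁ ≤ 2 ^ k₂ := zpow_le_zpow_right₀ (by norm_num) (le_max_left _ _)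
    linarith
  have hcov : ∀ t, coveredBy t (𝓕' t) R (cubeAt t k₂ 0) = 𝓕' t := fun t => by
    refine Set.Subset.antisymm (fun Q hQ => hQ.1) fun Q hQ => ⟨hQ, ?_⟩
    have h1 := htop Q hQ.1
    refine gridCube_subset_of_le t (le_max_of_le_right ?_) (x := cubeCorner 1 Q) ?_
      (hk₂ _ (h1.2 (cubeCorner_mem 1 Q)) t)
    · exact add_le_add_left h1.1 _
    · have : τ Q = t := hQ.2
      rw [← this]
      exact mem_cubeAt _ _ _
  choose 𝓢 E' k' h𝓢 htop' hk' hsum' using fun t =>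
    (hctrl t).1.exists_sparse hd hε (cubeAt t k₂ 0)
  refine ⟨𝓢, E', k', h𝓢, hk', ?_⟩
  have hsm := ae_all_iff.2 fun t => (hctrl t).2 (cubeAt t k₂ 0)
  filter_upwards [hsum, ae_all_iff.2 hsum', hsm] with x hx hx' hxs
  -- The second domination speaks only of points of the top cube; elsewhere both sides are `0`.
  have hout : ∀ t, HasSum (fun Q => (𝓢 t).indicator
      (fun Q => avgTerm t F (gridCube t Q) (k' t Q) Q x) Q)
      (aggregate t (𝓕' t) R b (cubeAt t k₂ 0) x) := fun t => by
    by_cases hxt : x ∈ gridCube t (cubeAt t k₂ 0)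
    · exact hx' t hxt
    · have h1 : aggregate t (𝓕' t) R b (cubeAt t k₂ 0) x = 0 := by
        rw [aggregate, hcov]
        refine (tsum_congr fun Q => ?_).trans tsum_zero
        refine Set.indicator_apply_eq_zero.2 fun hQ => Set.indicator_of_notMem (fun hxQ => hxt ?_) _
        exact hk₂ x ((htop Q hQ.1).2 hxQ) t
      rw [h1]
      convert hasSum_zero with Q
      refine Set.indicator_apply_eq_zero.2 fun hQ => Set.indicator_of_notMem (fun hxQ => hxt ?_) _
      exact (htop' t Q hQ).2 hxQ
  refine ⟨fun t => (hout t).summable, ?_⟩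
  simp only [fun t => (hout t).tsum_eq, aggregate, hcov]
  simp only [hcov] at hxs
  rw [← Summable.tsum_finsetSum fun t _ => hxs t]
  have e : ∀ Q, ∑ t, (𝓕' t).indicator (fun Q => b Q x) Q = 𝓕.indicator (fun Q => b Q x) Q := by
    intro Q
    rw [Finset.sum_eq_single (τ Q)]
    · by_cases hQ : Q ∈ 𝓕
      · have hQ' : Q ∈ 𝓕' (τ Q) := ⟨hQ, rfl⟩
        rw [Set.indicator_of_mem hQ, Set.indicator_of_mem hQ']
      · rw [Set.indicator_of_notMem hQ, Set.indicator_of_notMem fun hQ' => hQ hQ'.1]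
    · intro t _ ht
      exact Set.indicator_of_notMem (fun hQ => ht hQ.2.symm) _
    · simp
  refine Eq.trans ?_ (tsum_congr e).symm
  by_cases hxQ : x ∈ gridCube 1 Q₀
  · rw [Set.indicator_of_mem hxQ]
    refine ((hx hxQ).tsum_eq.trans ?_).symm
    funext i
    have : (starBall 1 Q₀).indicator (fun y => F y i) = fun y => F y i := by
      refine Set.indicator_eq_self.2 fun y hy => hsupp y fun h0 => hy ?_
      simp [h0]
    rw [localOp, this]
  · rw [Set.indicator_of_notMem hxQ]
    refine ((tsum_congr fun Q => ?_).trans tsum_zero).symm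
    exact Set.indicator_apply_eq_zero.2 fun hQ => Set.indicator_of_notMem
      (fun hx => hxQ ((htop Q hQ).2 hx)) _

/-- The kernel on `Q` that represents the operator away from the cube of the previous level. -/
noncomputable def shellKernel (K : Rd d → Rd d → 𝕜) (Q : CubeLabel d) (x y : Rd d) : 𝕜 :=
  {p : Rd d × Rd d | p.1 ∉ gridCube 1 (cubeAt 1 (Q.1 - 1) 0) ∧ 2 ^ Q.1 / 12 ≤ ‖p.1 - p.2‖}.indicator
    (fun p => cubeVol d Q.1 • K p.1 p.2) (x, y)

theorem measurable_shellKernel (hK : Measurable (Function.uncurry K)) (Q : CubeLabel d) :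
    Measurable (Function.uncurry (shellKernel K Q)) := by
  have h1 : MeasurableSet {p : Rd d × Rd d | p.1 ∉ gridCube 1 (cubeAt 1 (Q.1 - 1) 0) ∧
      2 ^ Q.1 / 12 ≤ ‖p.1 - p.2‖} :=
    ((measurableSet_gridCube 1 _).compl.preimage measurable_fst).inter
      (measurableSet_le measurable_const (measurable_fst.sub measurable_snd).norm)
  exact (hK.const_smul (cubeVol d Q.1)).indicator h1

theorem IsWeakCZ.norm_shellKernel_le (h : IsWeakCZ S K C δ W) (Q : CubeLabel d) (x y : Rd d) :
    ‖shellKernel K Q x y‖ ≤ C * 12 ^ d := by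
  have hC := h.nonneg
  have hp := two_zpow_pos Q.1
  unfold shellKernel
  refine (norm_indicator_eq_indicator_norm _ _).le.trans (Set.indicator_apply_le' ?_ ?_)
  · rintro ⟨-, hxy⟩
    simp only at hxy
    have hne : x ≠ y := by
      rintro rfl
      simp only [sub_self, norm_zero] at hxy
      linarith
    rw [norm_smul, Real.norm_of_nonneg (cubeVol_pos _).le]
    calc cubeVol d Q.1 * ‖K x y‖ ≤ (2 ^ Q.1) ^ d * (C / (2 ^ Q.1 / 12) ^ d) := by
          refine mul_le_mul_of_nonneg_left ((h.size x y hne).trans ?_) (cubeVol_pos _).le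
          gcongr
      _ = C * 12 ^ d := by
          rw [div_pow]
          field_simp
  · intro _
    positivity

theorem cubeAt_zero_subset {k l : ℤ} (hkl : k ≤ l) :
    gridCube (1 : Fin d → ℤˣ) (cubeAt 1 k 0) ⊆ gridCube 1 (cubeAt 1 l 0) :=
  gridCube_subset_of_le 1 hkl (mem_cubeAt 1 k 0) (mem_cubeAt 1 l 0)

/-- The cubes of the grid `1` of level above `k₀` that contain the origin form a sparse family. -/
theorem isSparseFamily_tower (hd : 0 < d) (k₀ : ℤ) :
    IsSparseFamily 1 {Q : CubeLabel d | ∃ k > k₀, cubeAt 1 k 0 = Q}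
      fun Q => gridCube 1 Q \ gridCube 1 (cubeAt 1 (Q.1 - 1) 0) := by
  refine ⟨?_, ?_⟩
  · rintro _ ⟨k, -, rfl⟩
    refine ⟨(measurableSet_gridCube 1 _).diff (measurableSet_gridCube 1 _), Set.sdiff_subset, ?_⟩
    have hsub := cubeAt_zero_subset (d := d) (show k - 1 ≤ k by omega)
    have h1 : 2 * volume (gridCube (1 : Fin d → ℤˣ) (cubeAt 1 (k - 1) 0)) ≤
        volume (gridCube (1 : Fin d → ℤˣ) (cubeAt 1 k 0)) := by
      have e := cubeVol_add_nat (d := d) (k - 1) 1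
      rw [Nat.cast_one, sub_add_cancel, one_mul] at e
      have e2 : ∀ a : ℝ, 2 * ENNReal.ofReal a = ENNReal.ofReal (2 * a) := fun a => by
        rw [ENNReal.ofReal_mul (by norm_num), ENNReal.ofReal_ofNat]
      rw [volume_gridCube, volume_gridCube, e2]
      refine ENNReal.ofReal_le_ofReal ?_
      simp only [cubeAt, e]
      have := cubeVol_pos (d := d) (k - 1)
      gcongr
      exact le_self_pow₀ (by norm_num) hd.ne'
    change _ ≤ 2 * volume (gridCube 1 (cubeAt 1 k 0) \ gridCube 1 (cubeAt 1 (k - 1) 0))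
    rw [measure_sdiff hsub (measurableSet_gridCube 1 _).nullMeasurableSet
      (volume_gridCube_ne_top 1 _), ENNReal.mul_sub (by simp)]
    refine ENNReal.le_sub_of_add_le_right
      (ENNReal.mul_ne_top (by simp) (volume_gridCube_ne_top 1 _)) ?_
    rw [two_mul (volume (gridCube 1 (cubeAt 1 k 0)))]
    gcongr
  · have key : ∀ {k l : ℤ}, k < l → ∀ x ∈ gridCube (1 : Fin d → ℤˣ) (cubeAt 1 k 0),
        x ∈ gridCube (1 : Fin d → ℤˣ) (cubeAt 1 (l - 1) 0) := fun hkl x hx =>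
      cubeAt_zero_subset (by omega) hx
    rintro _ ⟨k, -, rfl⟩ _ ⟨l, -, rfl⟩ hne
    refine Set.disjoint_left.2 fun x hx hx' => ?_
    rcases lt_trichotomy k l with hlt | rfl | hlt
    · exact hx'.2 (key hlt x hx.1)
    · exact hne rfl
    · exact hx.2 (key hlt x hx'.1)

/-- For `x` in the shell between the origin cubes of levels `k - 1` and `k > k₀` one has `|x| ≥ 2^k
/ 6`, while `|y| ≤ 2^k / 12` where `F(y) ≠ 0`. So `|K(x, y)|` is at most a multiple of `|Q|⁻¹`, and
the kernel integral is one average over the cube `Q` of level `k`; the other terms of the tower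
vanish at `x`. -/
theorem IsWeakCZ.exists_sparse_far (h : IsWeakCZ S K C δ W) {F : Rd d → κ → 𝕜}
    (hF : Integrable F volume) {k₀ : ℤ} (hsupp : ∀ x, F x ≠ 0 → ‖x‖ ≤ 2 ^ k₀ / 6) :
    ∀ᵐ x, HasSum (fun Q => {Q : CubeLabel d | ∃ k > k₀, cubeAt 1 k 0 = Q}.indicator
        (fun Q => avgTerm 1 F (gridCube 1 Q) (shellKernel K Q) Q x) Q)
      ((gridCube 1 (cubeAt 1 k₀ 0))ᶜ.indicator (fun x i => S (fun y => F y i) x) x) := by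
  set 𝓢 : Set (CubeLabel d) := {Q | ∃ k > k₀, cubeAt 1 k 0 = Q}
  have hrep : ∀ i, ∀ᵐ x, x ∈ {x : Rd d | 2 ^ k₀ / 6 < ‖x‖} →
      S (fun y => F y i) x = ∫ y, K x y * F y i := fun i =>
    h.rep _ (hF.eval i) _ (isOpen_lt continuous_const continuous_norm) fun x hx => by
      by_contra hne
      exact absurd (hsupp x fun h0 => hne (by simp [h0])) (not_le.2 hx)
  have hin : ∀ (k : ℤ) (x : Rd d), x ∉ gridCube 1 (cubeAt 1 k 0) → 2 ^ k / 3 ≤ ‖x‖ := by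
    intro k x hx
    by_contra! hlt
    exact hx (gridIdx_eq_zero_of_norm_lt 1 hlt)
  have hz : ∀ (x : Rd d) (k : ℤ), x ∉ gridCube 1 (cubeAt 1 k 0) \ gridCube 1 (cubeAt 1 (k - 1) 0) →
      avgTerm 1 F (gridCube 1 (cubeAt 1 k 0)) (shellKernel K (cubeAt 1 k 0)) (cubeAt 1 k 0) x
        = 0 := by
    intro x k hx
    refine Set.indicator_apply_eq_zero.2 fun hxk => ?_
    have hxk' : x ∈ gridCube 1 (cubeAt 1 (k - 1) 0) := by
      by_contra hcon
      exact hx ⟨hxk, hcon⟩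
    have : ∀ y, shellKernel K (cubeAt 1 k 0) x y = 0 := fun y =>
      Set.indicator_of_notMem (fun hp => hp.1 hxk') _
    simp [this]
  filter_upwards [ae_all_iff.2 hrep] with x hx
  by_cases hx₀ : x ∈ gridCube 1 (cubeAt 1 k₀ 0)
  · rw [Set.indicator_of_notMem (Set.notMem_compl_iff.2 hx₀)]
    convert hasSum_zero with Q
    refine Set.indicator_apply_eq_zero.2 ?_
    rintro ⟨k, hk, rfl⟩
    exact hz x k fun hxk => hxk.2 (cubeAt_zero_subset (by omega) hx₀)
  · rw [Set.indicator_of_mem hx₀]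
    have hex : ∃ n : ℕ, x ∈ gridCube 1 (cubeAt 1 (k₀ + n) 0) := by
      obtain ⟨l, hl⟩ := exists_norm_lt_two_zpow ‖x‖
      refine ⟨(l - k₀).toNat, cubeAt_zero_subset (k := l) (by omega) ?_⟩
      by_contra hcon
      exact absurd (hin l x hcon) (not_le.2 hl)
    classical
    set n := Nat.find hex with hn
    have hn1 : x ∈ gridCube 1 (cubeAt 1 (k₀ + n) 0) := Nat.find_spec hex
    have hn0 : n ≠ 0 := fun h0 => hx₀ (by simpa [h0] using hn1)
    have hn2 : x ∉ gridCube 1 (cubeAt 1 (k₀ + n - 1) 0) := by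
      have := Nat.find_min hex (Nat.sub_one_lt hn0)
      rw [← hn, Nat.cast_sub (by omega), Nat.cast_one, ← add_sub_assoc] at this
      exact this
    set k := k₀ + n with hk
    have hk₀ : k₀ < k := by omega
    have hval : avgTerm 1 F (gridCube 1 (cubeAt 1 k 0)) (shellKernel K (cubeAt 1 k 0))
        (cubeAt 1 k 0) x = fun i => S (fun y => F y i) x := by
      have hp := cubeVol_pos (d := d) k
      have hlow := hin _ x hn2
      have h2 : (2 : ℝ) ^ (k - 1) = 2 ^ k / 2 := by
        rw [zpow_sub_one₀ (by norm_num)]; rfl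
      have h3 : (2 : ℝ) ^ k₀ ≤ 2 ^ k / 2 := by
        rw [← h2]; exact zpow_le_zpow_right₀ (by norm_num) (by omega)
      have h4 := two_zpow_pos k
      rw [h2] at hlow
      have e : ∀ y ∈ gridCube 1 (cubeAt 1 k 0), shellKernel K (cubeAt 1 k 0) x y • F y =
          cubeVol d k • (K x y • F y) := by
        intro y _
        by_cases hy : F y = 0
        · simp [hy]
        · have h5 := hsupp y hy
          have h6 := norm_sub_norm_le x y
          have h7 : (x, y) ∈ {p : Rd d × Rd d | p.1 ∉ gridCube 1 (cubeAt 1 ((cubeAt 1 k 0 :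
              CubeLabel d).1 - 1) 0) ∧ 2 ^ (cubeAt 1 k 0 : CubeLabel d).1 / 12 ≤ ‖p.1 - p.2‖} := by
            refine ⟨hn2, ?_⟩
            simp only [cubeAt]
            linarith
          rw [shellKernel, Set.indicator_of_mem h7, smul_assoc]
          rfl
      have hint : ∀ i, Integrable (fun y => K x y * F y i) volume := fun i =>
        h.integrable_kernel_mul (hF.eval i) (ρ := 2 ^ k / 12) (by positivity) fun y hy => by
          have h5 := hsupp y fun h0 => hy (by simp [h0])
          have h6 := norm_sub_norm_le x y
          linarith
      rw [avgTerm, Set.indicator_of_mem hn1, setIntegral_congr_fun (measurableSet_gridCube 1 _) e,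
        integral_smul, smul_smul]
      change ((cubeVol d k)⁻¹ * cubeVol d k) • _ = _
      rw [inv_mul_cancel₀ hp.ne', one_smul, setIntegral_eq_integral_of_forall_compl_eq_zero]
      · funext i
        rw [eval_integral (f := fun y => K x y • F y) hint, hx i]
        · rfl
        · linarith
      · intro y hy
        by_contra hne
        have hy0 : F y ≠ 0 := fun h0 => hne (by simp [h0])
        have h5 := hsupp y hy0
        have h6 := hin _ y hy
        linarith
    have hmem : cubeAt 1 k 0 ∈ 𝓢 := ⟨k, hk₀, rfl⟩
    have hs := hasSum_single (f := fun Q => 𝓢.indicator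
        (fun Q => avgTerm 1 F (gridCube 1 Q) (shellKernel K Q) Q x) Q) (cubeAt 1 k 0) (by
      intro Q hQ
      refine Set.indicator_apply_eq_zero.2 ?_
      rintro ⟨l, hl, rfl⟩
      refine hz x l fun hxl => ?_
      rcases lt_trichotomy k l with hlt | rfl | hlt
      · exact hxl.2 (cubeAt_zero_subset (by omega) hn1)
      · exact hQ rfl
      · exact hn2 (cubeAt_zero_subset (by omega) hxl.1))
    simp only [Set.indicator_of_mem hmem, hval] at hs
    exact hs

end NearFar

/-! ### Collecting the families and normalizing the kernels. -/

section Core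
variable {d : ℕ} {𝕜 κ : Type*} [RCLike 𝕜] [Fintype κ]
  {S : (Rd d → 𝕜) → Rd d → 𝕜} {K : Rd d → Rd d → 𝕜} {C δ : ℝ} {W : NNReal}

theorem avgTerm_smul_kernel (t : Fin d → ℤˣ) (F : Rd d → κ → 𝕜) (s : Set (Rd d))
    (k : Rd d → Rd d → 𝕜) (a : ℝ) (Q : CubeLabel d) (x : Rd d) :
    avgTerm t F s (fun x y => a • k x y) Q x = a • avgTerm t F s k Q x := by
  unfold avgTerm
  by_cases hx : x ∈ gridCube t Q
  · simp only [Set.indicator_of_mem hx, smul_assoc, integral_smul]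
    rw [smul_comm]
  · simp only [Set.indicator_of_notMem hx, smul_zero]

theorem IsSparseFamily.subset {t : Fin d → ℤˣ} {𝓢 𝓢' : Set (CubeLabel d)}
    {E : CubeLabel d → Set (Rd d)} (h : IsSparseFamily t 𝓢 E) (hs : 𝓢' ⊆ 𝓢) :
    IsSparseFamily t 𝓢' E :=
  ⟨fun Q hQ => h.1 Q (hs hQ), h.2.subset hs⟩

/-- There are `2^d` grids and one tower around the origin, and `2^d + 1 ≤ 3^d` because `d ≥ 1`. -/
theorem exists_injective_fin (hd : 0 < d) :
    ∃ e : Option (Fin d → ℤˣ) → Fin (3 ^ d), Function.Injective e := by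
  have h1 : Fintype.card (Option (Fin d → ℤˣ)) ≤ Fintype.card (Fin (3 ^ d)) := by
    rw [Fintype.card_option, Fintype.card_fun, Fintype.card_units_int, Fintype.card_fin,
      Fintype.card_fin]
    exact Nat.pow_lt_pow_left (by norm_num) hd.ne'
  obtain ⟨e⟩ := Function.Embedding.nonempty_of_card_le h1
  exact ⟨e, e.injective⟩

/-- Sparse domination of all components at once, indexed by the grids and the tower of cubes
around the origin. -/
theorem IsWeakCZ.exists_sparse_option (κ : Type*) [Fintype κ] (hd : 0 < d)
    (h : IsWeakCZ S K C δ W) :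
    ∃ M : ℝ, 0 < M ∧ ∀ (F : Rd d → κ → 𝕜) (r : ℝ), Integrable F volume →
      (∀ x, F x ≠ 0 → ‖x‖ ≤ r) →
      ∃ (t : Option (Fin d → ℤˣ) → Fin d → ℤˣ) (𝓢 : Option (Fin d → ℤˣ) → Set (CubeLabel d))
        (E : Option (Fin d → ℤˣ) → CubeLabel d → Set (Rd d))
        (k : Option (Fin d → ℤˣ) → CubeLabel d → Rd d → Rd d → 𝕜),
        (∀ j, IsSparseFamily (t j) (𝓢 j) (E j)) ∧
        (∀ j Q, Measurable (Function.uncurry (k j Q)) ∧ ∀ x y, ‖k j Q x y‖ ≤ M) ∧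
        ∀ᵐ x, ∃ a : Option (Fin d → ℤˣ) → κ → 𝕜,
          (∀ j, HasSum (fun Q => (𝓢 j).indicator
            (fun Q => avgTerm (t j) F (gridCube (t j) Q) (k j Q) Q x) Q) (a j)) ∧
          (fun i => S (fun y => F y i) x) = ∑ j, a j := by
  obtain ⟨M, hM, hnear⟩ := h.exists_sparse_near κ hd
  have hC := h.nonneg
  refine ⟨M + C * 12 ^ d + 1, by positivity, fun F r hF hr => ?_⟩
  obtain ⟨k₀, hk₀⟩ := exists_norm_lt_two_zpow (2 * r)
  have hsupp : ∀ x, F x ≠ 0 → ‖x‖ ≤ 2 ^ k₀ / 6 := fun x hx => by linarith [hr x hx]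
  have hsupp' : ∀ x, F x ≠ 0 → x ∈ starBall 1 (cubeAt 1 k₀ 0) := fun x hx => by
    rw [starBall, Metric.mem_ball, dist_eq_norm]
    have h1 := norm_sub_le_of_mem (1 : Fin d → ℤˣ) (mem_cubeAt 1 k₀ 0)
      (cubeCorner_mem 1 (cubeAt 1 k₀ 0))
    have h2 := norm_sub_le_norm_sub_add_norm_sub x 0 (cubeCorner 1 (cubeAt 1 k₀ 0))
    have h3 := hsupp x hx
    have h4 : (1 : ℝ) * 2 ^ k₀ ≤ d * 2 ^ k₀ :=
      mul_le_mul_of_nonneg_right (by exact_mod_cast hd) (two_zpow_pos k₀).le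
    have h5 := two_zpow_pos k₀
    rw [sub_zero] at h2
    simp only [cubeAt] at h1 h2 ⊢
    linarith
  obtain ⟨𝓢, E, k, h𝓢, hk, hsum⟩ := hnear F hF (cubeAt 1 k₀ 0) hsupp'
  refine ⟨fun j => j.elim 1 id, fun j => j.elim {Q | ∃ k > k₀, cubeAt 1 k 0 = Q} 𝓢,
    fun j => j.elim (fun Q => gridCube 1 Q \ gridCube 1 (cubeAt 1 (Q.1 - 1) 0)) E,
    fun j => j.elim (shellKernel K) k, ?_, ?_, ?_⟩
  · rintro (_ | t)
    · exact isSparseFamily_tower hd k₀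
    · exact h𝓢 t
  · rintro (_ | t) Q
    · exact ⟨measurable_shellKernel h.measurable Q, fun x y =>
        (h.norm_shellKernel_le Q x y).trans (by linarith)⟩
    · have : 0 ≤ C * 12 ^ d := by positivity
      exact ⟨(hk t Q).1, fun x y => ((hk t Q).2 x y).trans (by linarith)⟩
  · filter_upwards [hsum, h.exists_sparse_far hF hsupp] with x hx hx'
    refine ⟨fun j => j.elim ((gridCube 1 (cubeAt 1 k₀ 0))ᶜ.indicator
      (fun x i => S (fun y => F y i) x) x) fun t => ∑' Q, (𝓢 t).indicator
        (fun Q => avgTerm t F (gridCube t Q) (k t Q) Q x) Q, ?_, ?_⟩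
    · rintro (_ | t)
      · exact hx'
      · exact (hx.1 t).hasSum
    · rw [Fintype.sum_option]
      simp only [Option.elim]
      rw [← hx.2, ← Pi.add_apply, Set.indicator_compl_add_self]

/-- Sparse domination of all components at once, with normalized kernels and `3 ^ d` families. -/
theorem IsWeakCZ.exists_sparse_fin (κ : Type*) [Fintype κ] (hd : 0 < d)
    (h : IsWeakCZ S K C δ W) :
    ∃ c : ℝ, 0 < c ∧ ∀ (F : Rd d → κ → 𝕜) (r : ℝ), Integrable F volume →
      (∀ x, F x ≠ 0 → ‖x‖ ≤ r) →
      ∃ (t : Fin (3 ^ d) → Fin d → ℤˣ) (𝓢 : Fin (3 ^ d) → Set (CubeLabel d))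
        (E : Fin (3 ^ d) → CubeLabel d → Set (Rd d))
        (k : Fin (3 ^ d) → CubeLabel d → Rd d → Rd d → 𝕜),
        (∀ j, IsSparseFamily (t j) (𝓢 j) (E j)) ∧
        (∀ j Q, Measurable (Function.uncurry (k j Q)) ∧ ∀ x y, ‖k j Q x y‖ ≤ 1) ∧
        ∀ᵐ x, ∃ a : Fin (3 ^ d) → κ → 𝕜,
          (∀ j, HasSum (fun Q => (𝓢 j).indicator
            (fun Q => avgTerm (t j) F (gridCube (t j) Q) (k j Q) Q x) Q) (a j)) ∧
          (fun i => S (fun y => F y i) x) = c • ∑ j, a j := by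
  classical
  obtain ⟨c, hc, hcore⟩ := h.exists_sparse_option κ hd
  obtain ⟨e, he⟩ := exists_injective_fin hd
  have hinv : ∀ o, Function.invFun e (e o) = o := Function.leftInverse_invFun he
  refine ⟨c, hc, fun F r hF hr => ?_⟩
  obtain ⟨t, 𝓢, E, k, h𝓢, hk, hsum⟩ := hcore F r hF hr
  set π : Fin (3 ^ d) → Option (Fin d → ℤˣ) := Function.invFun e
  -- Indices outside the range of `e` receive the empty family.
  refine ⟨fun j => t (π j), fun j => if e (π j) = j then 𝓢 (π j) else ∅, fun j => E (π j),
    fun j Q x y => c⁻¹ • k (π j) Q x y, fun j => (h𝓢 (π j)).subset ?_,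
    fun j Q => ⟨(hk (π j) Q).1.const_smul c⁻¹, fun x y => ?_⟩, ?_⟩
  · dsimp only
    split_ifs
    · exact subset_rfl
    · exact Set.empty_subset _
  · rw [norm_smul, Real.norm_of_nonneg (by positivity), inv_mul_le_one₀ hc]
    exact (hk (π j) Q).2 x y
  · filter_upwards [hsum] with x hx
    obtain ⟨a, ha, hS⟩ := hx
    refine ⟨fun j => if e (π j) = j then c⁻¹ • a (π j) else 0, fun j => ?_, ?_⟩
    · dsimp only
      split_ifs with hj
      · convert (ha (π j)).const_smul c⁻¹ using 2 with Q
        by_cases hQ : Q ∈ 𝓢 (π j)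
        · rw [Set.indicator_of_mem hQ, Set.indicator_of_mem hQ, avgTerm_smul_kernel]
        · rw [Set.indicator_of_notMem hQ, Set.indicator_of_notMem hQ, smul_zero]
      · simp
    · rw [hS, Finset.smul_sum]
      refine Fintype.sum_of_injective e he _ _ (fun j hj => ?_) fun o => ?_
      · rw [if_neg fun hj' => hj ⟨_, hj'⟩]
        exact smul_zero _
      · simp only [π, hinv, if_true]
        rw [smul_inv_smul₀ hc.ne']

end Core

/-! ### Linear images of the dominated vector. -/

section Commutator
variable {d m : ℕ} {𝕜 κ : Type*} [RCLike 𝕜] [Fintype κ]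

/-- The terms of the sparse operator are images of the vector averages under a linear map. -/
theorem sparseTerm_eq (φ : 𝕜 → ℂ) {f : Rd d → Fin m → ℂ} {B : Rd d → Matrix (Fin m) (Fin m) ℂ}
    {F : Rd d → κ → 𝕜} (hF : Integrable F volume) {x : Rd d} (L : (κ → 𝕜) →L[ℝ] (Fin m → ℂ))
    (hL : ∀ a y, L (a • F y) = φ a • (B x - B y).mulVec (f y)) {t : Fin d → ℤˣ} {Q : CubeLabel d}
    {k : Rd d → Rd d → 𝕜} (hk : Measurable (Function.uncurry k)) {M : ℝ}
    (hM : ∀ x y, ‖k x y‖ ≤ M) :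
    sparseTerm (fun x y => φ (k x y)) B f (gridCube t Q) x =
      L (avgTerm t F (gridCube t Q) k Q x) := by
  unfold sparseTerm avgTerm
  by_cases hx : x ∈ gridCube t Q
  · have hi : Integrable (fun y => k x y • F y) (volume.restrict (gridCube t Q)) :=
      (integrable_bounded_smul hF (hk.comp measurable_prodMk_left) (hM x)).restrict
    rw [Set.indicator_of_mem hx, Set.indicator_of_mem hx, map_smul, setAverage_eq,
      measureReal_gridCube, ← L.integral_comp_comm hi]
    simp only [hL]
  · rw [Set.indicator_of_notMem hx, Set.indicator_of_notMem hx, map_zero]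

/-- The domination of `F` is an identity of vectors at almost every `x`, so a linear map that
depends on `x` may be applied to it, without any bound on that map. The function `φ` stands for the
inclusion of `𝕜` in `ℂ`, so that the real and the complex case are treated together. -/
theorem IsWeakCZ.exists_sparse_commutator {S : (Rd d → 𝕜) → Rd d → 𝕜} {K : Rd d → Rd d → 𝕜}
    {C δ : ℝ} {W : NNReal} (κ : Type*) [Fintype κ] (hd : 0 < d) (hS : IsWeakCZ S K C δ W)
    {φ : 𝕜 → ℂ} (hφm : Measurable φ) (hφ : ∀ a, ‖φ a‖ ≤ ‖a‖) :
    ∃ c : ℝ, 0 < c ∧ ∀ (f : Rd d → Fin m → ℂ) (B : Rd d → Matrix (Fin m) (Fin m) ℂ)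
      (F : Rd d → κ → 𝕜) (L : Rd d → (κ → 𝕜) →L[ℝ] (Fin m → ℂ)) (h : Rd d → Fin m → ℂ),
      Integrable F volume → HasCompactSupport F →
      (∀ x a y, L x (a • F y) = φ a • (B x - B y).mulVec (f y)) →
      (∀ᵐ x, h x = L x fun i => S (fun y => F y i) x) →
      ∃ (D 𝓢 : Fin (3 ^ d) → Set (Set (Rd d))) (k : Fin (3 ^ d) → Set (Rd d) → Rd d → Rd d → ℂ),
        (∀ j, IsDyadicGrid (D j) ∧ IsSparse (D j) (𝓢 j)) ∧
        (∀ j Q, Measurable (Function.uncurry (k j Q)) ∧ (∀ x y, ‖k j Q x y‖ ≤ 1) ∧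
          ∀ x y, k j Q x y ∈ Set.range φ) ∧
        ∀ᵐ x, (∀ j, Summable fun Q : 𝓢 j => sparseTerm (k j Q) B f Q x) ∧
          h x = c • ∑ j, ∑' Q : 𝓢 j, sparseTerm (k j Q) B f Q x := by
  obtain ⟨c, hc, hcore⟩ := hS.exists_sparse_fin κ hd
  refine ⟨c, hc, fun f B F L h hF hsupp hL hh => ?_⟩
  obtain ⟨r, hr⟩ := hsupp.isCompact.isBounded.exists_norm_le
  obtain ⟨t, 𝓢, E, k, h𝓢, hk, hsum⟩ := hcore F r hF fun x hx => hr x (subset_tsupport F hx)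
  have hinv : ∀ t (Q : CubeLabel d), Function.invFun (gridCube t) (gridCube t Q) = Q := fun t =>
    Function.leftInverse_invFun (gridCube_injective t hd)
  refine ⟨fun j => Set.range (gridCube (t j)), fun j => gridCube (t j) '' 𝓢 j,
    fun j Q x y => φ (k j (Function.invFun (gridCube (t j)) Q) x y),
    fun j => ⟨isDyadicGrid_range (t j), Set.image_subset_range _ _,
      fun Q => E j (Function.invFun (gridCube (t j)) Q), ?_, ?_⟩,
    fun j Q => ⟨hφm.comp (hk j _).1, fun x y => (hφ _).trans ((hk j _).2 x y), fun x y => ⟨_, rfl⟩⟩,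
    ?_⟩
  · rintro _ ⟨Q, hQ, rfl⟩
    simp only [hinv]
    exact (h𝓢 j).1 Q hQ
  · rintro _ ⟨P, hP, rfl⟩ _ ⟨Q, hQ, rfl⟩ hne
    simp only [Function.onFun, hinv]
    exact (h𝓢 j).2 hP hQ fun h => hne (by rw [h])
  · filter_upwards [hsum, hh] with x hx hhx
    obtain ⟨a, ha, hSx⟩ := hx
    have key : ∀ j, HasSum (fun Q : gridCube (t j) '' 𝓢 j => sparseTerm
        (fun x y => φ (k j (Function.invFun (gridCube (t j)) Q) x y)) B f Q x) (L x (a j)) := by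
      intro j
      rw [← (Equiv.Set.image (gridCube (t j)) (𝓢 j) (gridCube_injective (t j) hd)).hasSum_iff]
      have h1 : HasSum ((𝓢 j).indicator fun Q =>
          L x (avgTerm (t j) F (gridCube (t j) Q) (k j Q) Q x)) (L x (a j)) := by
        convert (ha j).mapL (L x) using 2 with Q
        by_cases hQ : Q ∈ 𝓢 j
        · rw [Set.indicator_of_mem hQ, Set.indicator_of_mem hQ]
        · rw [Set.indicator_of_notMem hQ, Set.indicator_of_notMem hQ, map_zero]
      rw [← hasSum_subtype_iff_indicator] at h1
      convert h1 using 2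
      funext Q
      simp only [Function.comp_apply, Equiv.Set.image_apply, hinv]
      exact sparseTerm_eq φ hF (L x) (hL x) (hk j Q).1 (hk j Q).2
    refine ⟨fun j => (key j).summable, ?_⟩
    simp only [fun j => (key j).tsum_eq]
    rw [hhx, hSx, _root_.map_smul, _root_.map_sum]

end Commutator

/-! ### The joint vector of `f` and `Bf`, and the theorem. -/

section Main
variable {d m : ℕ}

/-- The linear map that sends the averages of `f` and `B f` to the averages of `(B x - B y) f y`. -/
noncomputable def commutatorMap (M : Matrix (Fin m) (Fin m) ℂ) :
    (Fin m ⊕ Fin m → ℂ) →ₗ[ℂ] Fin m → ℂ :=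
  M.mulVecLin ∘ₗ LinearMap.funLeft ℂ ℂ Sum.inl - LinearMap.funLeft ℂ ℂ Sum.inr

theorem commutatorMap_apply (M : Matrix (Fin m) (Fin m) ℂ) (w : Fin m ⊕ Fin m → ℂ) :
    commutatorMap M w = M.mulVec (fun i => w (Sum.inl i)) - fun i => w (Sum.inr i) := rfl

/-- The vector of real and imaginary parts as a complex vector. -/
noncomputable def complexify (ι : Type*) : (ι ⊕ ι → ℝ) →ₗ[ℝ] ι → ℂ :=
  LinearMap.pi fun i => Complex.ofRealCLM.toLinearMap ∘ₗ LinearMap.proj (Sum.inl i) +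
    Complex.I • (Complex.ofRealCLM.toLinearMap ∘ₗ LinearMap.proj (Sum.inr i))

theorem complexify_apply {ι : Type*} (w : ι ⊕ ι → ℝ) (i : ι) :
    complexify ι w i = w (Sum.inl i) + Complex.I * w (Sum.inr i) := rfl

/-- The functions `f` and `B f` as a single vector function. -/
noncomputable def joinMul (B : Rd d → Matrix (Fin m) (Fin m) ℂ) (f : Rd d → Fin m → ℂ) (x : Rd d) :
    Fin m ⊕ Fin m → ℂ :=
  Sum.elim (f x) ((B x).mulVec (f x))

/-- The real and imaginary parts of a complex vector. -/
def reImParts {ι : Type*} (w : ι → ℂ) : ι ⊕ ι → ℝ :=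
  Sum.elim (fun i => (w i).re) fun i => (w i).im

theorem complexify_reImParts {ι : Type*} (w : ι → ℂ) : complexify ι (reImParts w) = w := by
  funext i
  rw [complexify_apply, mul_comm]
  exact Complex.re_add_im (w i)

theorem commutatorMap_joinMul (B : Rd d → Matrix (Fin m) (Fin m) ℂ) (f : Rd d → Fin m → ℂ)
    (x y : Rd d) : commutatorMap (B x) (joinMul B f y) = (B x - B y).mulVec (f y) := by
  rw [commutatorMap_apply, Matrix.sub_mulVec]
  rfl

theorem integrable_joinMul {B : Rd d → Matrix (Fin m) (Fin m) ℂ} {f : Rd d → Fin m → ℂ}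
    (hf : Integrable f volume) (hBf : Integrable (fun x => (B x).mulVec (f x)) volume) :
    Integrable (joinMul B f) volume := by
  refine Integrable.of_eval ?_
  rintro (i | i)
  · exact hf.eval i
  · exact hBf.eval i

theorem hasCompactSupport_joinMul (B : Rd d → Matrix (Fin m) (Fin m) ℂ) {f : Rd d → Fin m → ℂ}
    (hf : HasCompactSupport f) : HasCompactSupport (joinMul B f) := by
  refine hf.mono fun x hx h0 => hx ?_
  funext i
  rcases i with i | i <;> simp [joinMul, h0]

/-- Values on `L¹` are unique almost everywhere, so the commutator may be computed with the chosen
extension `S` applied to the components of the joint vector. -/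
theorem isCommutatorValue_iff
    {T : Lp ℂ 2 (volume : Measure (Rd d)) →L[ℂ] Lp ℂ 2 (volume : Measure (Rd d))}
    {S : (Rd d → ℂ) → Rd d → ℂ} (hS : ∀ f, Integrable f volume → IsL1Value T f (S f))
    {B : Rd d → Matrix (Fin m) (Fin m) ℂ} {f : Rd d → Fin m → ℂ}
    (hF : Integrable (joinMul B f) volume) {h : Rd d → Fin m → ℂ} :
    IsCommutatorValue T B f h ↔
      ∀ᵐ x, h x = commutatorMap (B x) fun i => S (fun y => joinMul B f y i) x := by
  constructor
  · rintro ⟨F, G, hF', hG', hh⟩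
    have h1 : ∀ᵐ x, ∀ i, F x i = S (fun y => joinMul B f y (Sum.inl i)) x :=
      ae_all_iff.2 fun i => IsL1Value.ae_eq (hF.eval (Sum.inl i)) (hF' i)
        (hS _ (hF.eval (Sum.inl i)))
    have h2 : ∀ᵐ x, ∀ i, G x i = S (fun y => joinMul B f y (Sum.inr i)) x :=
      ae_all_iff.2 fun i => IsL1Value.ae_eq (hF.eval (Sum.inr i)) (hG' i)
        (hS _ (hF.eval (Sum.inr i)))
    filter_upwards [hh, h1, h2] with x hx h1 h2
    rw [hx, commutatorMap_apply, funext h1, funext h2]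
  · intro hh
    exact ⟨_, _, fun i => hS _ (hF.eval (Sum.inl i)), fun i => hS _ (hF.eval (Sum.inr i)), hh⟩

/-- For a real operator the real-scalar operator of `IsWeakCZ.re`, applied to real and imaginary
parts, recovers `S`. -/
theorem IsWeakCZ.ae_eq_re_add_im {S : (Rd d → ℂ) → Rd d → ℂ} {K : Rd d → Rd d → ℂ} {C δ : ℝ}
    {W : NNReal} (h : IsWeakCZ S K C δ W)
    (hreal : ∀ f, Integrable f volume → (∀ x, (f x).im = 0) → ∀ᵐ x, (S f x).im = 0)
    {f : Rd d → ℂ} (hf : Integrable f volume) :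
    ∀ᵐ x, S f x = ((S (fun y => ((f y).re : ℂ)) x).re : ℂ) +
      Complex.I * ((S (fun y => ((f y).im : ℂ)) x).re : ℂ) := by
  have hre : Integrable (fun y => ((f y).re : ℂ)) volume := hf.re.ofReal
  have him : Integrable (fun y => ((f y).im : ℂ)) volume := hf.im.ofReal
  have e : f = (fun y => ((f y).re : ℂ)) + Complex.I • fun y => ((f y).im : ℂ) := by
    funext y
    rw [Pi.add_apply, Pi.smul_apply, smul_eq_mul, mul_comm]
    exact (Complex.re_add_im (f y)).symm
  have h1 := h.map_add _ _ hre (him.smul Complex.I)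
  rw [← e] at h1
  filter_upwards [h1, h.map_smul Complex.I _ him, hreal _ hre fun x => Complex.ofReal_im _,
    hreal _ him fun x => Complex.ofReal_im _] with x h1 h2 h3 h4
  rw [h1, Pi.add_apply, h2, Pi.smul_apply, smul_eq_mul]
  congr 1
  · exact Complex.ext rfl (by simpa using h3)
  · congr 1
    exact Complex.ext rfl (by simpa using h4)

end Main

theorem theorem1p7 (d m : ℕ) (hd : 0 < d)
    (T : Lp ℂ 2 (volume : Measure (Rd d)) →L[ℂ] Lp ℂ 2 (volume : Measure (Rd d)))
    (hT : IsCZO T) :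
    ∃ c : ℝ, 0 < c ∧
      ∀ (f : Rd d → Fin m → ℂ) (B : Rd d → Matrix (Fin m) (Fin m) ℂ),
        Integrable f volume → HasCompactSupport f →
        Integrable (fun x => (B x).mulVec (f x)) volume →
        (∃ h, IsCommutatorValue T B f h) ∧
        ∀ h, IsCommutatorValue T B f h →
          ∃ (D S : Fin (3 ^ d) → Set (Set (Rd d)))
            (k : Fin (3 ^ d) → Set (Rd d) → Rd d → Rd d → ℂ),
            (∀ j, IsDyadicGrid (D j) ∧ IsSparse (D j) (S j)) ∧
            (∀ j, ∀ Q ∈ S j, Measurable (Function.uncurry (k j Q)) ∧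
              (∀ x y, ‖k j Q x y‖ ≤ 1) ∧
              (IsRealOperator T → ∀ x y, (k j Q x y).im = 0)) ∧
            ∀ᵐ x, (∀ j, Summable fun Q : S j => sparseTerm (k j Q) B f Q x) ∧
              h x = c • ∑ j, ∑' Q : S j, sparseTerm (k j Q) B f Q x := by

  obtain ⟨S, K, C, δ, W, hS, hval, hreal⟩ := hT.exists_isWeakCZ hd
  suffices hmain : ∃ c : ℝ, 0 < c ∧ ∀ (f : Rd d → Fin m → ℂ) (B : Rd d → Matrix (Fin m) (Fin m) ℂ)
      (h : Rd d → Fin m → ℂ), Integrable (joinMul B f) volume → HasCompactSupport (joinMul B f) →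
      (∀ᵐ x, h x = commutatorMap (B x) fun i => S (fun y => joinMul B f y i) x) →
      ∃ (D 𝓢 : Fin (3 ^ d) → Set (Set (Rd d))) (k : Fin (3 ^ d) → Set (Rd d) → Rd d → Rd d → ℂ),
        (∀ j, IsDyadicGrid (D j) ∧ IsSparse (D j) (𝓢 j)) ∧
        (∀ j Q, Measurable (Function.uncurry (k j Q)) ∧ (∀ x y, ‖k j Q x y‖ ≤ 1) ∧
          (IsRealOperator T → ∀ x y, (k j Q x y).im = 0)) ∧
        ∀ᵐ x, (∀ j, Summable fun Q : 𝓢 j => sparseTerm (k j Q) B f Q x) ∧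
          h x = c • ∑ j, ∑' Q : 𝓢 j, sparseTerm (k j Q) B f Q x by
    obtain ⟨c, hc, hmain⟩ := hmain
    refine ⟨c, hc, fun f B hf hsupp hBf => ?_⟩
    have hF := integrable_joinMul hf hBf
    refine ⟨⟨_, (isCommutatorValue_iff hval hF).2 (Eventually.of_forall fun x => rfl)⟩,
      fun h hh => ?_⟩
    obtain ⟨D, 𝓢, k, h1, h2, h3⟩ := hmain f B h hF (hasCompactSupport_joinMul B hsupp)
      ((isCommutatorValue_iff hval hF).1 hh)
    exact ⟨D, 𝓢, k, h1, fun j Q _ => h2 j Q, h3⟩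
  -- For real `T` the domination is carried out over `ℝ`, with `4m` real components, and its kernels
  -- are real by construction. Otherwise it is carried out over `ℂ` with `2m` components. The
  -- constant may differ between the cases, since it is allowed to depend on `T`.
  by_cases hTr : IsRealOperator T
  · obtain ⟨c, hc, hmain⟩ := hS.re.exists_sparse_commutator (m := m)
      ((Fin m ⊕ Fin m) ⊕ (Fin m ⊕ Fin m)) hd (φ := Complex.ofReal) Complex.measurable_ofReal
      fun a => (Complex.norm_real a).le
    refine ⟨c, hc, fun f B h hF hsupp hh => ?_⟩
    obtain ⟨D, 𝓢, k, h1, h2, h3⟩ := hmain f B (fun x => reImParts (joinMul B f x))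
      (fun x => LinearMap.toContinuousLinearMap
        ((commutatorMap (B x)).restrictScalars ℝ ∘ₗ complexify (Fin m ⊕ Fin m))) h
      (Integrable.of_eval (by
        rintro (i | i)
        · exact (hF.eval i).re
        · exact (hF.eval i).im))
      (hsupp.mono fun x hx h0 => hx (by
        funext i
        rcases i with i | i <;> simp [reImParts, h0]))
      (fun x a y => by
        rw [_root_.map_smul]
        change a • commutatorMap (B x) (complexify _ (reImParts (joinMul B f y))) = _
        rw [complexify_reImParts, commutatorMap_joinMul]
        rfl)
      (by
        filter_upwards [hh, ae_all_iff.2 fun i => hS.ae_eq_re_add_im (hreal hTr) (hF.eval i)]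
          with x hx hx'
        rw [hx]
        change _ = commutatorMap (B x) (complexify _ _)
        congr 1
        funext i
        exact hx' i)
    refine ⟨D, 𝓢, k, h1, fun j Q => ⟨(h2 j Q).1, (h2 j Q).2.1, fun _ x y => ?_⟩, h3⟩
    obtain ⟨a, ha⟩ := (h2 j Q).2.2 x y
    rw [← ha]
    exact Complex.ofReal_im a
  · obtain ⟨c, hc, hmain⟩ := hS.exists_sparse_commutator (m := m) (Fin m ⊕ Fin m) hd (φ := id)
      measurable_id fun a => le_rfl
    refine ⟨c, hc, fun f B h hF hsupp hh => ?_⟩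
    obtain ⟨D, 𝓢, k, h1, h2, h3⟩ := hmain f B (joinMul B f)
      (fun x => LinearMap.toContinuousLinearMap ((commutatorMap (B x)).restrictScalars ℝ)) h hF
      hsupp (fun x a y => by
        change commutatorMap (B x) (a • joinMul B f y) = _
        rw [_root_.map_smul, commutatorMap_joinMul]
        rfl) hh
    exact ⟨D, 𝓢, k, h1, fun j Q => ⟨(h2 j Q).1, (h2 j Q).2.1, fun hr => absurd hr hTr⟩, h3⟩
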